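/- **Subject reduction for MPST!, the multiparty session calculus with replicated receives and first-class roles.** Everything is taken up to renaming of bound names; all syntax and all contexts are finite; a family indexed by $i\in I$ is finite. In messages, session-typed payloads precede role payloads. *Processes.* A role is $\rho ::= \mathsf q \mid \alpha$ (role name or role variable), a channel is $c ::= s[\mathsf q]\mid x$, and $$P ::= \mathbf 0 \mid P\,|\,Q \mid (\nu s)P \mid \textstyle\sum_{i\in I} c_i[\rho_i]\oplus m_i\langle\tilde c_i,\tilde\rho_i\rangle.P_i \mid c[\rho]\&_{i\in I} m_i(\tilde x_i,\tilde\alpha_i).P_i \mid {!}c[\rho]\&_{i\in I} m_i(\tilde x_i,\tilde\alpha_i).P_i \mid \mathbf{def}\ X(\tilde x)=P\ \mathbf{in}\ Q \mid X\langle\tilde c\rangle .$$ In a replicated receive, $\rho$ is a role name or a variable bound by the receive (universal receive). $d$ ranges over concrete values, i.e. endpoints $s[\mathsf q]$ and role names. Reduction is generated by (all substitutions matching in length, $k\in I$) - $s[\mathsf p][\mathsf q]\&_{i\in I}m_i(\tilde b_i).P_i \mid s[\mathsf q][\mathsf p]\oplus m_k\langle\tilde d\rangle.Q\to P_k\{\tilde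 d/\tilde b_k\}\mid Q$; - $s[\mathsf q][\mathsf p]\oplus m_k\langle\tilde d\rangle.P\mid R\to P\mid R\mid Q_k\{\tilde d/\tilde b_k\}$ for $R={!}s[\mathsf p][\mathsf q]\&_{i\in I}m_i(\tilde b_i).Q_i$, and $\to P\mid R\mid Q_k\{\tilde d/\tilde b_k\}\{\mathsf q/\alpha\}$ for $R={!}s[\mathsf p][\alpha]\&_{i\in I}m_i(\tilde b_i).Q_i$; - a choice of sends on endpoints to role names with concrete payloads reduces to any one of its summands; - $\mathbf{def}\ X(\tilde x)=P\ \mathbf{in}\ (X\langle\tilde d\rangle\mid Q)\to\mathbf{def}\ X(\tilde x)=P\ \mathbf{in}\ (P\{\tilde d/\tilde x\}\mid Q)$ for endpoints $\tilde d$; closed under the contexts $\mathbb C::=[\,]\mid\mathbb C\,|\,P\mid(\nu s)\mathbb C\mid\mathbf{def}\ D\ \mathbf{in}\ \mathbb C$ and under structural congruence on both sides. Structural congruence is the least reflexive and transitive relation closed under all process constructors containing, in both directions, the commutative monoid laws of $(|,\mathbf 0)$, $(\nu s)\mathbf 0\equiv\mathbf 0$, $(\nu s)(\nu s')P\equiv(\nu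 s')(\nu s)P$, $(\nu s)(P|Q)\equiv P|(\nu s)Q$ for $s$ not free in $P$, $\mathbf{def}\ D\ \mathbf{in}\ (\nu s)Q\equiv(\nu s)(\mathbf{def}\ D\ \mathbf{in}\ Q)$ for $s$ not free in $D$, $\mathbf{def}\ D\ \mathbf{in}\ (P|Q)\equiv(\mathbf{def}\ D\ \mathbf{in}\ P)|Q$ when $Q$ does not use the variable of $D$, the exchange of two nested definitions neither of which uses the variable of the other, and, from left to right only, $\mathbf{def}\ D\ \mathbf{in}\ \mathbf 0\equiv\mathbf 0$ (garbage definitions may be removed, not introduced). *Types.* Session types are $$S::=\rho\,\&_{i\in I}m_i(\tilde S_i,\tilde\alpha_i).S_i'\mid{!}\rho\,\&_{i\in I}m_i(\tilde S_i,\tilde\alpha_i).S_i'\mid\oplus_{i\in I}\rho_i\,m_i(\tilde S_i,\tilde\rho_i').S_i'\mid\mu t.S\mid t\mid\mathsf{end},$$ with guarded recursion, no free recursion variables, $I\ne\emptyset$, and pairwise distinct labels in a branching; $\tilde\alpha_i$ is bound in the $i$-th branch; in ${!}\rho\,\&$, $\rho$ is a role name or a variable bound in all branches. Runtime types are $U::=S\mid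 U_1\|U_2$. Type congruence $\equiv$ on runtime types makes $\|$ commutative and associative with identity $\mathsf{end}$ and identifies $\mu t.S$ with $S\{\mu t.S/t\}$. Subtyping $\leqslant$ is coinductive: reflexive; up to unfolding $\mu$ on either side; for (replicated) branchings from the same $\rho$ the subtype has fewer branches, with covariant payloads and continuations; for selections the subtype has more messages, with contravariant payloads and covariant continuations; role payloads agree. A context $\Gamma$ is a finite partial map from channels to runtime types with a finite set of entries $\alpha:\alpha$. In $\Gamma_1+\Gamma_2$ role entries are shared and the types of a common channel are composed by $\|$; $\Gamma=\Gamma_1\cdot\Gamma_2$ means that $\Gamma_1,\Gamma_2$ have the same role entries as $\Gamma$ and $\Gamma\equiv\Gamma_1+\Gamma_2$. $\mathsf{end}(\Gamma)$ means that all channel types of $\Gamma$ are $\equiv\mathsf{end}$. Below, an explicit entry $c:S$ in a split of $\Gamma$ carries the role entries of $\Gamma$. *Context reduction.* Labelled transitions: $s[\mathsf p]:\mathsf q\,\&_i m_i(\tilde T_i).S_i$ inputs $m_k(\tilde T_k)$ from $\mathsf q$ and becomes $s[\mathsf p]:S_k$; $s[\mathsf p]:\oplus_i\mathsf q_i m_i(\tilde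 T_i).S_i$ outputs $m_k(\tilde T_k)$ to $\mathsf q_k$ and becomes $s[\mathsf p]:S_k$; $s[\mathsf p]:R$ with $R={!}\rho\,\&_i m_i(\tilde T_i).S_i$ inputs $m_k(\tilde T_k)$ from $\rho$ and becomes $s[\mathsf p]:R\|S_k$. Transitions extend to larger contexts (add role entries; $\Gamma\cdot\Gamma''\xrightarrow{\gamma}\Gamma'+\Gamma''$ if $\Gamma\xrightarrow{\gamma}\Gamma'$) and hold up to unfolding an entry. If $\Gamma=\Gamma_1\cdot\Gamma_2$, $\Gamma_1$ goes to $\Gamma_1'$ by the output from $\mathsf p$ to $\mathsf q$ in $s$ of $m(\tilde S,\tilde{\mathsf r})$, $\Gamma_2$ goes to $\Gamma_2'$ by the input at $\mathsf q$ in $s$ of $m(\tilde S',\tilde\alpha)$ from $\mathsf p$ (respectively, from a bound variable $\alpha_0$), $|\tilde{\mathsf r}|=|\tilde\alpha|$ and $\tilde S\leqslant\tilde S'$, then $\Gamma\to\Gamma_1'+\Gamma_2'\{\tilde{\mathsf r}/\tilde\alpha\}$ (respectively $\Gamma_1'+\Gamma_2'\{\mathsf p/\alpha_0\}\{\tilde{\mathsf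 r}/\tilde\alpha\}$). $\to^*$ is the reflexive transitive closure. *Safety.* A property $\varphi$ of contexts is a safety property if: 1. whenever $\varphi(\Gamma\cdot s[\mathsf p]:\oplus_{i\in I}\rho_i m_i(\tilde S_i,\tilde\rho_i').S_i'\cdot s[\mathsf q]:S)$, where $S=\mathsf p\,\&_{j\in J}m_j(\tilde S_j'',\tilde\alpha_j).S_j'''$ or $S={!}\rho_0\,\&_{j\in J}m_j(\tilde S_j'',\tilde\alpha_j).S_j'''$ with $\rho_0$ a variable or $\mathsf p$, every message $i\in I$ with $\rho_i=\mathsf q$ has its label among those of $J$, with $\tilde S_i\leqslant\tilde S_i''$ and $|\tilde\rho_i'|=|\tilde\alpha_i|$; 2. $\varphi(\Gamma\cdot s[\mathsf q]:\mu t.S)$ implies $\varphi(\Gamma+ s[\mathsf q]:S\{\mu t.S/t\})$; 3. $\varphi(\Gamma)$ implies that all role variables free in the types of $\Gamma$ are bound by $\Gamma$; 4. $\varphi(\Gamma)$ and $\Gamma\to\Gamma'$ imply $\varphi(\Gamma')$. *Typing.* Values: $\emptyset\vdash\mathsf q:\mathsf q$; $\alpha:\alpha\vdash\alpha:\alpha$;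 $c:S\vdash c:S'$ if $S\leqslant S'$; and $\Gamma\vdash V:T$ if $\Gamma\equiv\Gamma_1+\Gamma_2$, $\Gamma_1\vdash V:T$, $\mathsf{end}(\Gamma_2)$. With $\Theta$ mapping process variables to tuples of session types, $\Theta;\Gamma\vdash P$ is inductively defined by: - $\Theta;\Gamma\vdash\mathbf 0$ if $\mathsf{end}(\Gamma)$; $\Theta;\Gamma_1\cdot\Gamma_2\vdash P_1|P_2$ if $\Theta;\Gamma_i\vdash P_i$; a sum over $I\neq\emptyset$ is typed by $\Theta;\Gamma$ if each summand is; - $\Theta;\Gamma\vdash(\nu s)P$ if, for some finite partial map $\Psi$ from role names to runtime types and some safety property $\varphi'$, $\varphi'(\mathsf{assoc}_s(\Psi))$ and $\Theta;\Gamma+\mathsf{assoc}_s(\Psi)\vdash P$, where $s\notin\Gamma$ and $\mathsf{assoc}_s(\Psi)=\{s[\mathsf q]:\Psi(\mathsf q)\}$; - $\Theta;\Gamma\cdot\Gamma_\oplus\cdot\Gamma_r(\cdot\Gamma_i)_i\vdash c[\rho]\oplus m\langle(V_i)_i\rangle.P$ if $\Gamma_\oplus\vdash c:\rho\oplus m(\tilde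 T).S'$, $\Gamma_r\vdash\rho:\rho$, $\Gamma_i\vdash V_i:T_i$ and $\Theta;\Gamma+c:S'\vdash P$; - $\Theta;\Gamma\cdot\Gamma_\&\cdot\Gamma_r\vdash c[\rho]\&_i m_i(\tilde b_i).P_i$ if $\Gamma_\&\vdash c:\rho\,\&_i m_i(\tilde T_i).S_i'$, $\Gamma_r\vdash\rho:\rho$ and $\Theta;\Gamma+c:S_i'+\tilde b_i:\tilde T_i\vdash P_i$ for all $i$; - $\Theta;\Gamma\cdot\Gamma_!\vdash{!}c[\rho]\&_i m_i(\tilde b_i).P_i$ if $\Gamma_!\vdash c:{!}\rho\,\&_i m_i(\tilde T_i).S_i'$, $\mathsf{end}(\Gamma)$ and, for all $i$, $\Theta;\Gamma+c:S_i'+\tilde b_i:\tilde T_i\vdash P_i$, with $\rho:\rho$ added to the context if $\rho$ is a variable; - $\Theta;\Gamma\cdot\Gamma'\vdash\mathbf{def}\ X(\tilde x)=P\ \mathbf{in}\ Q$ if for some $\tilde S$: $\Theta,X:\tilde S;\Gamma,\tilde x:\tilde S\vdash P$, $\mathsf{end}(\Gamma)$ and $\Theta,X:\tilde S;\Gamma'\vdash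 Q$; - $\Theta;\Gamma_0(\cdot\Gamma_i)_i\vdash X\langle(c_i)_i\rangle$ if $\Theta(X)=(S_i)_i$, $\mathsf{end}(\Gamma_0)$ and $\Gamma_i\vdash c_i:S_i$. **Theorem (Subject Reduction).** Let $\varphi$ be a safety property. If $\Theta;\Gamma\vdash P$ with $\varphi(\Gamma)$ and $P\to P'$, then there is a context $\Gamma'$ with $\Gamma\to^*\Gamma'$ and $\varphi(\Gamma')$ such that $\Theta;\Gamma'\vdash P'$. -/

import Mathlib

namespace MPSTBang

/-! A session-typed multiparty calculus with replicated receives and first-class roles.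

All bound names are de Bruijn indices, so that terms and types are identified up to renaming of
bound names and every binder is automatically fresh. There are five sorts of them: sessions (bound
by restriction), channel variables (bound by receives and process declarations), role variables
(bound by receives, in processes and in types), process variables (bound by process declarations)
and recursion variables (bound by recursive types). Free names are the indices that exceed the
binders above them. A family indexed by a finite set `I` is a function on some `Fin n`. In messages,
session-typed payloads precede role-typed payloads. -/

/-! ### Names -/

/-- Concrete role names. -/
abbrev Role := ℕ

/-- Message labels. -/
abbrev Label := ℕ

/-- Roles: a role name, or a role variable. -/
inductive RoleE : Type
  | name (q : Role) : RoleE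
  | var (a : ℕ) : RoleE

/-- Channels: an endpoint `s[q]`, or a channel variable. -/
inductive Chan : Type
  | ep (s : ℕ) (q : Role) : Chan
  | var (x : ℕ) : Chan

/-- The renaming of indices that skips `k` binders and acts as `f` above them. -/
def liftIdx (f : ℕ → ℕ) (k : ℕ) (i : ℕ) : ℕ := if i < k then i else f (i - k) + k

/-- The transposition of the two innermost indices. -/
def swapIdx : ℕ → ℕ
  | 0 => 1
  | 1 => 0
  | n + 2 => n + 2

/-- Apply a substitution of role variables. -/
def RoleE.subst (σ : ℕ → RoleE) : RoleE → RoleE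
  | .name q => .name q
  | .var a => σ a

/-- Weakening by `k` role variables. -/
def RoleE.shift (k : ℕ) : RoleE → RoleE
  | .name q => .name q
  | .var a => .var (a + k)

/-- A role substitution under `k` role binders. -/
def liftRo (σ : ℕ → RoleE) (k : ℕ) (i : ℕ) : RoleE :=
  if i < k then .var i else (σ (i - k)).shift k

/-- Replace the innermost role variables by the listed role names. -/
def instRo (rs : List Role) (i : ℕ) : RoleE :=
  match rs[i]? with
  | some r => .name r
  | none => .var (i - rs.length)

/-- The number of role variables bound by a (replicated) branch with `k` role payloads: a universal
receive also binds the role of the sender, as the outermost one. -/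
def repDepth (r : Option Role) (k : ℕ) : ℕ :=
  match r with
  | some _ => k
  | none => k + 1

/-! ### Types -/

/-- Session types.

* `sel n tgt lab ar pay rol cont` is the selection of one of `n` messages, the `i`-th one being sent
  to `tgt i` with label `lab i`, session payloads `pay i`, role payloads `rol i` and continuation
  `cont i`.
* `bra ρ n lab ar pay k cont` is the branching on messages from `ρ`, the `i`-th one having label
  `lab i`, session payloads `pay i` and `k i` role payloads, each of which binds a role variable (the
  indices below `k i`) in this branch.
* `rep r n lab ar pay k cont` is the replicated branching on messages from the role `q` if
  `r = some q`. If `r = none`, it is a universal receive: it accepts messages from any role and binds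
  a role variable to it (index `k i` in the `i`-th branch). -/
inductive SType : Type
  | fin : SType
  | tvar (t : ℕ) : SType
  | mu (S : SType) : SType
  | sel (n : ℕ) (tgt : Fin n → RoleE) (lab : Fin n → Label) (ar : Fin n → ℕ)
      (pay : (i : Fin n) → Fin (ar i) → SType) (rol : Fin n → List RoleE)
      (cont : Fin n → SType) : SType
  | bra (ρ : RoleE) (n : ℕ) (lab : Fin n → Label) (ar : Fin n → ℕ)
      (pay : (i : Fin n) → Fin (ar i) → SType) (k : Fin n → ℕ) (cont : Fin n → SType) : SType
  | rep (r : Option Role) (n : ℕ) (lab : Fin n → Label) (ar : Fin n → ℕ)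
      (pay : (i : Fin n) → Fin (ar i) → SType) (k : Fin n → ℕ) (cont : Fin n → SType) : SType

namespace SType

/-- Substitution of role variables. -/
def rsubst : (ℕ → RoleE) → SType → SType
  | _, fin => fin
  | _, tvar t => tvar t
  | σ, mu S => mu (S.rsubst σ)
  | σ, sel n tgt lab ar pay rol cont =>
      sel n (fun i => (tgt i).subst σ) lab ar (fun i j => (pay i j).rsubst σ)
        (fun i => (rol i).map (RoleE.subst σ)) (fun i => (cont i).rsubst σ)
  | σ, bra ρ n lab ar pay k cont =>
      bra (ρ.subst σ) n lab ar (fun i j => (pay i j).rsubst (liftRo σ (k i))) k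
        (fun i => (cont i).rsubst (liftRo σ (k i)))
  | σ, rep r n lab ar pay k cont =>
      rep r n lab ar (fun i j => (pay i j).rsubst (liftRo σ (repDepth r (k i)))) k
        (fun i => (cont i).rsubst (liftRo σ (repDepth r (k i))))

/-- Weakening by `k` role variables. -/
def rshift (k : ℕ) (S : SType) : SType := S.rsubst (fun a => .var (a + k))

/-- Weakening of the recursion variables from `c` on by one. -/
def tshift : ℕ → SType → SType
  | _, fin => fin
  | c, tvar t => tvar (if t < c then t else t + 1)
  | c, mu S => mu (S.tshift (c + 1))
  | c, sel n tgt lab ar pay rol cont =>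
      sel n tgt lab ar (fun i j => (pay i j).tshift c) rol (fun i => (cont i).tshift c)
  | c, bra ρ n lab ar pay k cont =>
      bra ρ n lab ar (fun i j => (pay i j).tshift c) k (fun i => (cont i).tshift c)
  | c, rep r n lab ar pay k cont =>
      rep r n lab ar (fun i j => (pay i j).tshift c) k (fun i => (cont i).tshift c)

/-- Substitution of recursion variables. -/
def tsubst : (ℕ → SType) → SType → SType
  | _, fin => fin
  | τ, tvar t => τ t
  | τ, mu S => mu (S.tsubst (fun t => match t with
      | 0 => tvar 0
      | t + 1 => (τ t).tshift 0))
  | τ, sel n tgt lab ar pay rol cont =>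
      sel n tgt lab ar (fun i j => (pay i j).tsubst τ) rol (fun i => (cont i).tsubst τ)
  | τ, bra ρ n lab ar pay k cont =>
      bra ρ n lab ar (fun i j => (pay i j).tsubst (fun t => (τ t).rshift (k i))) k
        (fun i => (cont i).tsubst (fun t => (τ t).rshift (k i)))
  | τ, rep r n lab ar pay k cont =>
      rep r n lab ar
        (fun i j => (pay i j).tsubst (fun t => (τ t).rshift (repDepth r (k i)))) k
        (fun i => (cont i).tsubst (fun t => (τ t).rshift (repDepth r (k i))))

/-- The body `S` of `μt.S` with `t` replaced by `μt.S`. -/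
def unfold (S : SType) : SType :=
  S.tsubst (fun t => match t with
    | 0 => mu S
    | t + 1 => tvar t)

/-- The recursion variable that occurs unguarded in a type, if there is one. -/
def headVar : SType → Option ℕ
  | tvar t => some t
  | mu S =>
      match S.headVar with
      | some (t + 1) => some t
      | _ => none
  | _ => none

/-- Well-formedness, with at most `d` free recursion variables: recursion is guarded, branchings and
selections are non-empty, and the labels of a branching are pairwise distinct. -/
def WFAt : ℕ → SType → Prop
  | _, fin => True
  | d, tvar t => t < d
  | d, mu S => S.headVar ≠ some 0 ∧ S.WFAt (d + 1)
  | d, sel n _ _ _ pay _ cont =>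
      0 < n ∧ (∀ i j, (pay i j).WFAt d) ∧ ∀ i, (cont i).WFAt d
  | d, bra _ n lab _ pay _ cont =>
      0 < n ∧ Function.Injective lab ∧ (∀ i j, (pay i j).WFAt d) ∧ ∀ i, (cont i).WFAt d
  | d, rep _ n lab _ pay _ cont =>
      0 < n ∧ Function.Injective lab ∧ (∀ i j, (pay i j).WFAt d) ∧ ∀ i, (cont i).WFAt d

/-- Well-formed types without free recursion variables. -/
def WF (S : SType) : Prop := S.WFAt 0

/-- All free role variables belong to `A`. -/
def RScoped : Set ℕ → SType → Prop
  | _, fin => True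
  | _, tvar _ => True
  | A, mu S => S.RScoped A
  | A, sel _ tgt _ _ pay rol cont =>
      (∀ i a, tgt i = .var a → a ∈ A) ∧ (∀ i a, RoleE.var a ∈ rol i → a ∈ A) ∧
        (∀ i j, (pay i j).RScoped A) ∧ ∀ i, (cont i).RScoped A
  | A, bra ρ _ _ _ pay k cont =>
      (∀ a, ρ = .var a → a ∈ A) ∧
        (∀ i j, (pay i j).RScoped {a | k i ≤ a → a - k i ∈ A}) ∧
        ∀ i, (cont i).RScoped {a | k i ≤ a → a - k i ∈ A}
  | A, rep r _ _ _ pay k cont =>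
      (∀ i j, (pay i j).RScoped {a | repDepth r (k i) ≤ a → a - repDepth r (k i) ∈ A}) ∧
        ∀ i, (cont i).RScoped {a | repDepth r (k i) ≤ a → a - repDepth r (k i) ∈ A}

/-- The rules of subtyping, with the relation `R` in place of the premises. Role payloads are related
by equality. -/
inductive SubRule (R : SType → SType → Prop) : SType → SType → Prop
  | refl (S : SType) : SubRule R S S
  | bra {ρ : RoleE} {n : ℕ} {lab : Fin n → Label} {ar : Fin n → ℕ}
      {pay : (i : Fin n) → Fin (ar i) → SType} {k : Fin n → ℕ} {cont : Fin n → SType}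
      {n' : ℕ} {lab' : Fin n' → Label} {ar' : Fin n' → ℕ}
      {pay' : (i : Fin n') → Fin (ar' i) → SType} {k' : Fin n' → ℕ} {cont' : Fin n' → SType}
      (h : ∀ i, ∃ j, lab i = lab' j ∧ k i = k' j ∧
        List.Forall₂ R (List.ofFn (pay i)) (List.ofFn (pay' j)) ∧ R (cont i) (cont' j)) :
      SubRule R (.bra ρ n lab ar pay k cont) (.bra ρ n' lab' ar' pay' k' cont')
  | rep {r : Option Role} {n : ℕ} {lab : Fin n → Label} {ar : Fin n → ℕ}
      {pay : (i : Fin n) → Fin (ar i) → SType} {k : Fin n → ℕ} {cont : Fin n → SType}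
      {n' : ℕ} {lab' : Fin n' → Label} {ar' : Fin n' → ℕ}
      {pay' : (i : Fin n') → Fin (ar' i) → SType} {k' : Fin n' → ℕ} {cont' : Fin n' → SType}
      (h : ∀ i, ∃ j, lab i = lab' j ∧ k i = k' j ∧
        List.Forall₂ R (List.ofFn (pay i)) (List.ofFn (pay' j)) ∧ R (cont i) (cont' j)) :
      SubRule R (.rep r n lab ar pay k cont) (.rep r n' lab' ar' pay' k' cont')
  | sel {n : ℕ} {tgt : Fin n → RoleE} {lab : Fin n → Label} {ar : Fin n → ℕ}
      {pay : (i : Fin n) → Fin (ar i) → SType} {rol : Fin n → List RoleE} {cont : Fin n → SType}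
      {n' : ℕ} {tgt' : Fin n' → RoleE} {lab' : Fin n' → Label} {ar' : Fin n' → ℕ}
      {pay' : (i : Fin n') → Fin (ar' i) → SType} {rol' : Fin n' → List RoleE}
      {cont' : Fin n' → SType}
      (h : ∀ j, ∃ i, tgt i = tgt' j ∧ lab i = lab' j ∧ rol i = rol' j ∧
        List.Forall₂ R (List.ofFn (pay' j)) (List.ofFn (pay i)) ∧ R (cont i) (cont' j)) :
      SubRule R (.sel n tgt lab ar pay rol cont) (.sel n' tgt' lab' ar' pay' rol' cont')
  | unfoldL {S S' : SType} (h : R S.unfold S') : SubRule R (.mu S) S'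
  | unfoldR {S S' : SType} (h : R S S'.unfold) : SubRule R S (.mu S')

/-- Subtyping, coinductively defined by the rules: the largest relation each of whose instances is
the conclusion of a rule with premises in the relation. -/
def Sub (S S' : SType) : Prop :=
  ∃ R : SType → SType → Prop, R S S' ∧ ∀ A B, R A B → SubRule R A B

end SType

/-- Runtime types: session types in parallel. -/
inductive RType : Type
  | one (S : SType) : RType
  | par (U V : RType) : RType

namespace RType

/-- Substitution of role variables. -/
def rsubst (σ : ℕ → RoleE) : RType → RType
  | one S => one (S.rsubst σ)
  | par U V => par (U.rsubst σ) (V.rsubst σ)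

/-- Weakening by `k` role variables. -/
def rshift (k : ℕ) (U : RType) : RType := U.rsubst (fun a => .var (a + k))

/-- All components are well-formed. -/
def WF : RType → Prop
  | one S => S.WF
  | par U V => U.WF ∧ V.WF

/-- All free role variables belong to `A`. -/
def RScoped (A : Set ℕ) : RType → Prop
  | one S => S.RScoped A
  | par U V => U.RScoped A ∧ V.RScoped A

/-- Type congruence: parallel composition is commutative and associative with identity `end`, and a
(well-formed) recursive type is identified with its unfolding. -/
inductive Cong : RType → RType → Prop
  | refl (U : RType) : Cong U U
  | symm {U V : RType} : Cong U V → Cong V U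
  | trans {U V W : RType} : Cong U V → Cong V W → Cong U W
  | congr {U U' V V' : RType} : Cong U U' → Cong V V' → Cong (par U V) (par U' V')
  | comm (U V : RType) : Cong (par U V) (par V U)
  | assoc (U V W : RType) : Cong (par (par U V) W) (par U (par V W))
  | unit (U : RType) : Cong (par U (one .fin)) U
  | unfold (S : SType) (h : (SType.mu S).WF) : Cong (one (.mu S)) (one S.unfold)

end RType

/-! ### Typing contexts -/

/-- Typing contexts: a partial map from channels to runtime types, and a finite set of role variables
`α`, standing for the entries `α : α`. -/
structure Ctx : Type where
  ch : Chan → Option RType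
  ro : Finset ℕ

/-- Parallel composition of the entries of a channel in two contexts. -/
def parEntry : Option RType → Option RType → Option RType
  | none, V => V
  | U, none => U
  | some U, some V => some (.par U V)

/-- Congruence of the entries of a channel in two contexts. -/
def CongEntry : Option RType → Option RType → Prop
  | none, none => True
  | some U, some V => RType.Cong U V
  | _, _ => False

namespace Ctx

/-- The empty context. -/
def empty : Ctx := ⟨fun _ => none, ∅⟩

/-- The context whose only channel entry is `c : S`, with the role variables of `A`. -/
def entry (c : Chan) (S : SType) (A : Finset ℕ) : Ctx :=
  ⟨fun c' => match c, c' with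
    | .ep s q, .ep s' q' => if s = s' ∧ q = q' then some (.one S) else none
    | .var x, .var x' => if x = x' then some (.one S) else none
    | _, _ => none, A⟩

/-- The context `c : S`. -/
def single (c : Chan) (S : SType) : Ctx := entry c S ∅

/-- The context `α : α`. -/
def role (a : ℕ) : Ctx := ⟨fun _ => none, {a}⟩

/-- Context addition: role variables are shared, and the types of a common channel are composed in
parallel. -/
def add (Γ Δ : Ctx) : Ctx := ⟨fun c => parEntry (Γ.ch c) (Δ.ch c), Γ.ro ∪ Δ.ro⟩

/-- Type congruence, lifted to contexts. -/
def Cong (Γ Δ : Ctx) : Prop := Γ.ro = Δ.ro ∧ ∀ c, CongEntry (Γ.ch c) (Δ.ch c)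

/-- Context splitting `Γ = Γ₁ · Γ₂`, up to type congruence: both parts have all the role variables
of `Γ`, and each channel goes to one part with its whole type, or to both parts with the two
components of a parallel type. -/
def Split (Γ Γ₁ Γ₂ : Ctx) : Prop := Γ₁.ro = Γ.ro ∧ Γ₂.ro = Γ.ro ∧ Γ.Cong (Γ₁.add Γ₂)

/-- End-typed contexts. -/
def End (Γ : Ctx) : Prop := ∀ c U, Γ.ch c = some U → U.Cong (.one .fin)

/-- Well-formed contexts: finitely many entries, with well-formed types. -/
def WF (Γ : Ctx) : Prop := {c | Γ.ch c ≠ none}.Finite ∧ ∀ c U, Γ.ch c = some U → U.WF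

/-- No free role variables: all role variables that occur in the types of the context are bound by
the context. -/
def RClosed (Γ : Ctx) : Prop := ∀ c U, Γ.ch c = some U → U.RScoped {a | a ∈ Γ.ro}

/-- Weakening by `n` channel variables and `k` role variables. -/
def lift (n k : ℕ) (Γ : Ctx) : Ctx :=
  ⟨fun c => match c with
    | .ep s q => (Γ.ch (.ep s q)).map (RType.rshift k)
    | .var x => if x < n then none else (Γ.ch (.var (x - n))).map (RType.rshift k),
   Γ.ro.image (· + k)⟩

/-- Weakening by a session. -/
def liftSess (Γ : Ctx) : Ctx :=
  ⟨fun c => match c with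
    | .ep 0 _ => none
    | .ep (s + 1) q => Γ.ch (.ep s q)
    | .var x => Γ.ch (.var x), Γ.ro⟩

/-- Replace the innermost role variables by the listed role names. -/
def inst (rs : List Role) (Γ : Ctx) : Ctx :=
  ⟨fun c => (Γ.ch c).map (RType.rsubst (instRo rs)),
   (Γ.ro.filter (rs.length ≤ ·)).image (· - rs.length)⟩

/-- The entries `x : S` of the `n` innermost channel variables. -/
def binders {n : ℕ} (S : Fin n → SType) : Ctx :=
  ⟨fun c => match c with
    | .ep _ _ => none
    | .var x => if h : x < n then some (.one (S ⟨x, h⟩)) else none, ∅⟩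

/-- The entries `α : α` of the `k` innermost role variables. -/
def roles (k : ℕ) : Ctx := ⟨fun _ => none, Finset.range k⟩

end Ctx

/-- Session protocols: partial maps from roles to types. Those that a programmer writes contain no
parallel types, but these arise during execution. -/
abbrev Protocol := Role → Option RType

/-- Well-formed protocols: finitely many entries, with well-formed types. -/
def Protocol.WF (Ψ : Protocol) : Prop :=
  {q | Ψ q ≠ none}.Finite ∧ ∀ q U, Ψ q = some U → U.WF

/-- The context that associates a protocol to the innermost session. -/
def Protocol.assoc (Ψ : Protocol) : Ctx :=
  ⟨fun c => match c with
    | .ep 0 q => Ψ q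
    | _ => none, ∅⟩

/-! ### Type semantics -/

/-- Actions `s:p!q:m(S̃,ρ̃)`, `s:p?q:m(S̃,α̃)` and `s:p,q:m`. In an input, the origin is `none` for a
universal receive, and the role payloads `α̃` are given by their number. -/
inductive Act : Type
  | out (s : ℕ) (p q : Role) (m : Label) (Ss : List SType) (ρs : List RoleE) : Act
  | inp (s : ℕ) (p : Role) (q : Option Role) (m : Label) (Ss : List SType) (k : ℕ) : Act
  | com (s : ℕ) (p q : Role) (m : Label) : Act

/-- The number of role variables that an action leaves free in the context it leads to. -/
def Act.depth : Act → ℕ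
  | .out _ _ _ _ _ _ => 0
  | .inp _ _ q _ _ k => repDepth q k
  | .com _ _ _ _ => 0

/-- Labelled transitions of contexts. After an input, the context is in the scope of the role
variables bound by the input, until a communication replaces them. -/
inductive Trans : Ctx → Act → Ctx → Prop
  | rcv (s : ℕ) (p q : Role) (n : ℕ) (lab : Fin n → Label) (ar : Fin n → ℕ)
      (pay : (i : Fin n) → Fin (ar i) → SType) (k : Fin n → ℕ) (cont : Fin n → SType)
      (i : Fin n) :
      Trans (.single (.ep s p) (.bra (.name q) n lab ar pay k cont))
        (.inp s p (some q) (lab i) (List.ofFn (pay i)) (k i))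
        (.single (.ep s p) (cont i))
  | snd (s : ℕ) (p q : Role) (n : ℕ) (tgt : Fin n → RoleE) (lab : Fin n → Label) (ar : Fin n → ℕ)
      (pay : (i : Fin n) → Fin (ar i) → SType) (rol : Fin n → List RoleE) (cont : Fin n → SType)
      (i : Fin n) (hq : tgt i = .name q) :
      Trans (.single (.ep s p) (.sel n tgt lab ar pay rol cont))
        (.out s p q (lab i) (List.ofFn (pay i)) (rol i))
        (.single (.ep s p) (cont i))
  | bang (s : ℕ) (p : Role) (r : Option Role) (n : ℕ) (lab : Fin n → Label) (ar : Fin n → ℕ)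
      (pay : (i : Fin n) → Fin (ar i) → SType) (k : Fin n → ℕ) (cont : Fin n → SType)
      (i : Fin n) :
      Trans (.single (.ep s p) (.rep r n lab ar pay k cont))
        (.inp s p r (lab i) (List.ofFn (pay i)) (k i))
        ((Ctx.single (.ep s p) ((SType.rep r n lab ar pay k cont).rshift (repDepth r (k i)))).add
          (.single (.ep s p) (cont i)))
  | role {Γ Γ' : Ctx} {γ : Act} (a : ℕ) :
      Trans Γ γ Γ' → Trans (Γ.add (.role a)) γ (Γ'.add (.role (a + γ.depth)))
  | cong {Δ Γ Γ' Γ'' : Ctx} {γ : Act} :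
      Δ.Split Γ Γ'' → Trans Γ γ Γ' → Trans Δ γ (Γ'.add (Γ''.lift 0 γ.depth))
  | unfold {Δ Δ' Γ Γ' : Ctx} {γ : Act} {c : Chan} {S : SType} :
      Δ.Split Γ (.entry c (.mu S) Γ.ro) → Δ'.Split Γ (.entry c S.unfold Γ.ro) →
      Trans Δ' γ Γ' → Trans Δ γ Γ'
  | com₁ {Γ Γ₁ Γ₂ Γ₁' Γ₂' : Ctx} {s : ℕ} {p q : Role} {m : Label} {Ss Ss' : List SType}
      {rs : List Role} :
      Γ.Split Γ₁ Γ₂ →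
      Trans Γ₁ (.out s p q m Ss (rs.map .name)) Γ₁' →
      Trans Γ₂ (.inp s q (some p) m Ss' rs.length) Γ₂' →
      List.Forall₂ SType.Sub (Ss.map (SType.rshift rs.length)) Ss' →
      Trans Γ (.com s p q m) (Γ₁'.add (Γ₂'.inst rs))
  | com₂ {Γ Γ₁ Γ₂ Γ₁' Γ₂' : Ctx} {s : ℕ} {p q : Role} {m : Label} {Ss Ss' : List SType}
      {rs : List Role} :
      Γ.Split Γ₁ Γ₂ →
      Trans Γ₁ (.out s p q m Ss (rs.map .name)) Γ₁' →
      Trans Γ₂ (.inp s q none m Ss' rs.length) Γ₂' →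
      List.Forall₂ SType.Sub (Ss.map (SType.rshift (rs.length + 1))) Ss' →
      Trans Γ (.com s p q m) (Γ₁'.add (Γ₂'.inst (rs ++ [p])))

/-- Context reduction. -/
def Ctx.Red (Γ Γ' : Ctx) : Prop := ∃ s p q m, Trans Γ (.com s p q m) Γ'

/-- The reflexive and transitive closure of context reduction. -/
def Ctx.Reds : Ctx → Ctx → Prop := Relation.ReflTransGen Ctx.Red

/-- Safety properties of contexts. -/
structure IsSafety (φ : Ctx → Prop) : Prop where
  /-- A receiver that waits for a sender offers each label that the sender may select for it, with
  compatible payloads. -/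
  com : ∀ (Δ Δ' Γ : Ctx) (s : ℕ) (p q : Role)
    (n : ℕ) (tgt : Fin n → RoleE) (lab : Fin n → Label) (ar : Fin n → ℕ)
    (pay : (i : Fin n) → Fin (ar i) → SType) (rol : Fin n → List RoleE) (cont : Fin n → SType)
    (n' : ℕ) (lab' : Fin n' → Label) (ar' : Fin n' → ℕ)
    (pay' : (i : Fin n') → Fin (ar' i) → SType) (k' : Fin n' → ℕ) (cont' : Fin n' → SType),
    φ Δ →
    Δ.Split Δ' (.entry (.ep s q) (.bra (.name p) n' lab' ar' pay' k' cont') Δ.ro) →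
    Δ'.Split Γ (.entry (.ep s p) (.sel n tgt lab ar pay rol cont) Δ.ro) →
    ∀ i, tgt i = .name q → ∃ j, lab i = lab' j ∧ (rol i).length = k' j ∧
      List.Forall₂ SType.Sub ((List.ofFn (pay i)).map (SType.rshift (k' j))) (List.ofFn (pay' j))
  /-- The same for a replicated receiver that waits for the sender, or for any role. -/
  bang : ∀ (Δ Δ' Γ : Ctx) (s : ℕ) (p q : Role)
    (n : ℕ) (tgt : Fin n → RoleE) (lab : Fin n → Label) (ar : Fin n → ℕ)
    (pay : (i : Fin n) → Fin (ar i) → SType) (rol : Fin n → List RoleE) (cont : Fin n → SType)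
    (r : Option Role) (n' : ℕ) (lab' : Fin n' → Label) (ar' : Fin n' → ℕ)
    (pay' : (i : Fin n') → Fin (ar' i) → SType) (k' : Fin n' → ℕ) (cont' : Fin n' → SType),
    φ Δ →
    Δ.Split Δ' (.entry (.ep s q) (.rep r n' lab' ar' pay' k' cont') Δ.ro) →
    Δ'.Split Γ (.entry (.ep s p) (.sel n tgt lab ar pay rol cont) Δ.ro) →
    (r = none ∨ r = some p) →
    ∀ i, tgt i = .name q → ∃ j, lab i = lab' j ∧ (rol i).length = k' j ∧
      List.Forall₂ SType.Sub ((List.ofFn (pay i)).map (SType.rshift (repDepth r (k' j))))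
        (List.ofFn (pay' j))
  /-- Closure under unfolding. -/
  unfold : ∀ (Δ Γ : Ctx) (s : ℕ) (q : Role) (S : SType),
    φ Δ → Δ.Split Γ (.entry (.ep s q) (.mu S) Δ.ro) →
    φ (Γ.add (.entry (.ep s q) S.unfold Δ.ro))
  /-- No free role variables. -/
  closed : ∀ Γ : Ctx, φ Γ → Γ.RClosed
  /-- Closure under reduction. -/
  red : ∀ Γ Γ' : Ctx, φ Γ → Γ.Red Γ' → φ Γ'

/-! ### Processes -/

/-- Processes.

* `sum n c ρ m V W P` is the choice between `n` sends, the `i`-th one being a send on channel `c i` to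
  role `ρ i` of a message with label `m i` and payloads `V i` (channels) and `W i` (roles), continued
  as `P i`.
* `rcv c ρ n m nx k P` is the branching receive on `c` from `ρ`, whose `i`-th branch has label `m i`
  and binds `nx i` channel variables and `k i` role variables in `P i`.
* `rep c r n m nx k P` is the replicated branching receive, from the role `q` if `r = some q`, and
  from any role if `r = none`; in this case it binds one more role variable (index `k i` in the
  `i`-th branch) to the role of the sender.
* `defn k P Q` is the definition `X(x₁, …, xₖ) = P` in `Q`, which binds the process variable `X` in
  `P` and `Q`, and the channel variables in `P`. -/
inductive Proc : Type
  | nil : Proc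
  | par (P Q : Proc) : Proc
  | nu (P : Proc) : Proc
  | sum (n : ℕ) (c : Fin n → Chan) (ρ : Fin n → RoleE) (m : Fin n → Label)
      (V : Fin n → List Chan) (W : Fin n → List RoleE) (P : Fin n → Proc) : Proc
  | rcv (c : Chan) (ρ : RoleE) (n : ℕ) (m : Fin n → Label) (nx k : Fin n → ℕ)
      (P : Fin n → Proc) : Proc
  | rep (c : Chan) (r : Option Role) (n : ℕ) (m : Fin n → Label) (nx k : Fin n → ℕ)
      (P : Fin n → Proc) : Proc
  | defn (k : ℕ) (P Q : Proc) : Proc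
  | call (X : ℕ) (c : List Chan) : Proc

/-- A single send. -/
def Proc.snd (c : Chan) (ρ : RoleE) (m : Label) (V : List Chan) (W : List RoleE) (P : Proc) : Proc :=
  .sum 1 (fun _ => c) (fun _ => ρ) (fun _ => m) (fun _ => V) (fun _ => W) (fun _ => P)

/-- Simultaneous substitutions: renamings of sessions and of process variables, and substitutions of
channels for channel variables and of roles for role variables. -/
structure Subst : Type where
  se : ℕ → ℕ
  ch : ℕ → Chan
  ro : ℕ → RoleE
  pv : ℕ → ℕ

/-- Rename sessions in a channel. -/
def Chan.renSess (f : ℕ → ℕ) : Chan → Chan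
  | .ep s q => .ep (f s) q
  | .var x => .var x

/-- Weakening by `n` channel variables. -/
def Chan.shift (n : ℕ) : Chan → Chan
  | .ep s q => .ep s q
  | .var x => .var (x + n)

/-- Apply a substitution to a channel. -/
def Chan.subst (σ : Subst) : Chan → Chan
  | .ep s q => .ep (σ.se s) q
  | .var x => σ.ch x

namespace Subst

/-- The identity. -/
def id : Subst := ⟨fun s => s, .var, .var, fun X => X⟩

/-- A substitution under `n` channel binders and `k` role binders. -/
def lift (n k : ℕ) (σ : Subst) : Subst :=
  { σ with
    ch := fun x => if x < n then .var x else (σ.ch (x - n)).shift n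
    ro := liftRo σ.ro k }

/-- A substitution under a session binder. -/
def liftSess (σ : Subst) : Subst :=
  { σ with
    se := liftIdx σ.se 1
    ch := fun x => (σ.ch x).renSess (· + 1) }

/-- A substitution under a process variable binder. -/
def liftPv (σ : Subst) : Subst := { σ with pv := liftIdx σ.pv 1 }

end Subst

namespace Proc

/-- Apply a substitution to a process. -/
def subst : Subst → Proc → Proc
  | _, nil => nil
  | σ, par P Q => par (P.subst σ) (Q.subst σ)
  | σ, nu P => nu (P.subst σ.liftSess)
  | σ, sum n c ρ m V W P =>
      sum n (fun i => (c i).subst σ) (fun i => (ρ i).subst σ.ro) m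
        (fun i => (V i).map (Chan.subst σ)) (fun i => (W i).map (RoleE.subst σ.ro))
        (fun i => (P i).subst σ)
  | σ, rcv c ρ n m nx k P =>
      rcv (c.subst σ) (ρ.subst σ.ro) n m nx k (fun i => (P i).subst (σ.lift (nx i) (k i)))
  | σ, rep c r n m nx k P =>
      rep (c.subst σ) r n m nx k
        (fun i => (P i).subst (σ.lift (nx i) (repDepth r (k i))))
  | σ, defn k P Q => defn k (P.subst (σ.lift k 0).liftPv) (Q.subst σ.liftPv)
  | σ, call X c => call (σ.pv X) (c.map (Chan.subst σ))

/-- Rename sessions. -/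
def renSess (f : ℕ → ℕ) (P : Proc) : Proc := P.subst { Subst.id with se := f }

/-- Rename process variables. -/
def renPv (f : ℕ → ℕ) (P : Proc) : Proc := P.subst { Subst.id with pv := f }

/-- Replace the innermost channel variables by the listed endpoints, and the innermost role variables
by the listed role names. -/
def inst (ds : List (ℕ × Role)) (rs : List Role) (P : Proc) : Proc :=
  P.subst { Subst.id with
    ch := fun x => match ds[x]? with
      | some d => .ep d.1 d.2
      | none => .var (x - ds.length)
    ro := instRo rs }

end Proc

/-- The endpoint given by a session and a role. -/
def mkEp (d : ℕ × Role) : Chan := .ep d.1 d.2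

/-- The axioms of structural congruence that may be used in both directions. That a name is not free
in a process is expressed by weakening the process by this name. -/
inductive CongAx : Proc → Proc → Prop
  | comm (P Q : Proc) : CongAx (.par P Q) (.par Q P)
  | assoc (P Q R : Proc) : CongAx (.par (.par P Q) R) (.par P (.par Q R))
  | unit (P : Proc) : CongAx (.par P .nil) P
  | nuNil : CongAx (.nu .nil) .nil
  | nuNu (P : Proc) : CongAx (.nu (.nu P)) (.nu (.nu (P.renSess swapIdx)))
  | nuPar (P Q : Proc) : CongAx (.nu (.par (P.renSess (· + 1)) Q)) (.par P (.nu Q))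
  | defNu (k : ℕ) (P Q : Proc) :
      CongAx (.defn k P (.nu Q)) (.nu (.defn k (P.renSess (· + 1)) Q))
  | defPar (k : ℕ) (D P Q : Proc) :
      CongAx (.defn k D (.par P (Q.renPv (· + 1)))) (.par (.defn k D P) Q)
  | defDef (k k' : ℕ) (D D' P : Proc) :
      CongAx (.defn k D (.defn k' (D'.renPv (liftIdx (· + 1) 1)) P))
        (.defn k' D' (.defn k (D.renPv (liftIdx (· + 1) 1)) (P.renPv swapIdx)))

/-- Structural congruence. A definition around the inactive process may be removed, but not
introduced. -/
inductive SCong : Proc → Proc → Prop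
  | refl (P : Proc) : SCong P P
  | trans {P Q R : Proc} : SCong P Q → SCong Q R → SCong P R
  | ax {P Q : Proc} : CongAx P Q → SCong P Q
  | ax_symm {P Q : Proc} : CongAx P Q → SCong Q P
  | defNil (k : ℕ) (D : Proc) : SCong (.defn k D .nil) .nil
  | par {P P' Q Q' : Proc} : SCong P P' → SCong Q Q' → SCong (.par P Q) (.par P' Q')
  | nu {P P' : Proc} : SCong P P' → SCong (.nu P) (.nu P')
  | sum {n : ℕ} {c : Fin n → Chan} {ρ : Fin n → RoleE} {m : Fin n → Label}
      {V : Fin n → List Chan} {W : Fin n → List RoleE} {P P' : Fin n → Proc} :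
      (∀ i, SCong (P i) (P' i)) → SCong (.sum n c ρ m V W P) (.sum n c ρ m V W P')
  | rcv {c : Chan} {ρ : RoleE} {n : ℕ} {m : Fin n → Label} {nx k : Fin n → ℕ}
      {P P' : Fin n → Proc} :
      (∀ i, SCong (P i) (P' i)) → SCong (.rcv c ρ n m nx k P) (.rcv c ρ n m nx k P')
  | rep {c : Chan} {r : Option Role} {n : ℕ} {m : Fin n → Label} {nx k : Fin n → ℕ}
      {P P' : Fin n → Proc} :
      (∀ i, SCong (P i) (P' i)) → SCong (.rep c r n m nx k P) (.rep c r n m nx k P')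
  | defn {k : ℕ} {P P' Q Q' : Proc} :
      SCong P P' → SCong Q Q' → SCong (.defn k P Q) (.defn k P' Q')

/-- Process reduction. -/
inductive Step : Proc → Proc → Prop
  | com (s : ℕ) (p q : Role) (n : ℕ) (m : Fin n → Label) (nx k : Fin n → ℕ) (P : Fin n → Proc)
      (i : Fin n) (ds : List (ℕ × Role)) (rs : List Role) (Q : Proc)
      (hd : ds.length = nx i) (hr : rs.length = k i) :
      Step (.par (.rcv (.ep s p) (.name q) n m nx k P)
          (.snd (.ep s q) (.name p) (m i) (ds.map mkEp) (rs.map .name) Q))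
        (.par ((P i).inst ds rs) Q)
  | bang₁ (s : ℕ) (p q : Role) (n : ℕ) (m : Fin n → Label) (nx k : Fin n → ℕ) (P : Fin n → Proc)
      (i : Fin n) (ds : List (ℕ × Role)) (rs : List Role) (Q : Proc)
      (hd : ds.length = nx i) (hr : rs.length = k i) :
      Step (.par (.snd (.ep s q) (.name p) (m i) (ds.map mkEp) (rs.map .name) Q)
          (.rep (.ep s p) (some q) n m nx k P))
        (.par (.par Q (.rep (.ep s p) (some q) n m nx k P)) ((P i).inst ds rs))
  | bang₂ (s : ℕ) (p q : Role) (n : ℕ) (m : Fin n → Label) (nx k : Fin n → ℕ) (P : Fin n → Proc)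
      (i : Fin n) (ds : List (ℕ × Role)) (rs : List Role) (Q : Proc)
      (hd : ds.length = nx i) (hr : rs.length = k i) :
      Step (.par (.snd (.ep s q) (.name p) (m i) (ds.map mkEp) (rs.map .name) Q)
          (.rep (.ep s p) none n m nx k P))
        (.par (.par Q (.rep (.ep s p) none n m nx k P)) ((P i).inst ds (rs ++ [q])))
  | choice (n : ℕ) (s : Fin n → ℕ) (q p : Fin n → Role) (m : Fin n → Label)
      (ds : Fin n → List (ℕ × Role)) (rs : Fin n → List Role) (P : Fin n → Proc) (j : Fin n) :
      Step (.sum n (fun i => .ep (s i) (q i)) (fun i => .name (p i)) m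
          (fun i => (ds i).map mkEp) (fun i => (rs i).map .name) P)
        (.snd (.ep (s j) (q j)) (.name (p j)) (m j) ((ds j).map mkEp) ((rs j).map .name) (P j))
  | call (P Q : Proc) (ds : List (ℕ × Role)) :
      Step (.defn ds.length P (.par (.call 0 (ds.map mkEp)) Q))
        (.defn ds.length P (.par (P.inst ds []) Q))
  | cong {P P' Q Q' : Proc} : SCong P' P → Step P Q → SCong Q Q' → Step P' Q'
  | par {P P' : Proc} (Q : Proc) : Step P P' → Step (.par P Q) (.par P' Q)
  | nu {P P' : Proc} : Step P P' → Step (.nu P) (.nu P')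
  | defn {P P' : Proc} (k : ℕ) (D : Proc) : Step P P' → Step (.defn k D P) (.defn k D P')

/-! ### Typing rules -/

/-- Values. -/
inductive Val : Type
  | chan (c : Chan) : Val
  | role (ρ : RoleE) : Val

/-- Static types: session types and role singletons. -/
inductive Ty : Type
  | sess (S : SType) : Ty
  | role (ρ : RoleE) : Ty

/-- Value typing. -/
inductive ValTyped : Ctx → Val → Ty → Prop
  | wkn {Γ Γ₁ Γ₂ : Ctx} {V : Val} {T : Ty} :
      Γ.Cong (Γ₁.add Γ₂) → ValTyped Γ₁ V T → Γ₂.End → ValTyped Γ V T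
  | roleName (q : Role) : ValTyped .empty (.role (.name q)) (.role (.name q))
  | sub (c : Chan) {S S' : SType} : S.WF → S'.WF → S.Sub S' →
      ValTyped (.single c S) (.chan c) (.sess S')
  | roleVar (a : ℕ) : ValTyped (.role a) (.role (.var a)) (.role (.var a))

/-- `ValsTyped Γ Γ₀ Vs Ts`: the context splits as `Γ = Γ₀ · Γ₁ · … · Γₙ`, where `Γᵢ` types the `i`-th
value with the `i`-th type. -/
inductive ValsTyped : Ctx → Ctx → List Val → List Ty → Prop
  | nil (Γ : Ctx) : ValsTyped Γ Γ [] []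
  | cons {Γ Γ' Γ₀ Γ₁ : Ctx} {V : Val} {T : Ty} {Vs : List Val} {Ts : List Ty} :
      Γ.Split Γ' Γ₁ → ValTyped Γ₁ V T → ValsTyped Γ' Γ₀ Vs Ts → ValsTyped Γ Γ₀ (V :: Vs) (T :: Ts)

/-- Contexts for process variables: the types of their parameters. -/
abbrev PCtx := ℕ → Option (List SType)

/-- Well-formed types only. -/
def PCtx.WF (Θ : PCtx) : Prop := ∀ X Ss, Θ X = some Ss → ∀ S ∈ Ss, S.WF

/-- Weakening by `k` role variables. -/
def PCtx.rshift (k : ℕ) (Θ : PCtx) : PCtx := fun X => (Θ X).map (List.map (SType.rshift k))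

/-- Extension by a process variable. -/
def PCtx.cons (Ss : List SType) (Θ : PCtx) : PCtx
  | 0 => some Ss
  | X + 1 => Θ X

/-- Process typing `Θ ; Γ ⊢ P`. -/
inductive Typed : PCtx → Ctx → Proc → Prop
  | nil {Θ : PCtx} {Γ : Ctx} : Γ.End → Typed Θ Γ .nil
  | par {Θ : PCtx} {Γ Γ₁ Γ₂ : Ctx} {P Q : Proc} :
      Γ.Split Γ₁ Γ₂ → Typed Θ Γ₁ P → Typed Θ Γ₂ Q → Typed Θ Γ (.par P Q)
  | nu {Θ : PCtx} {Γ : Ctx} {P : Proc} (Ψ : Protocol) (φ : Ctx → Prop) :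
      Ψ.WF → IsSafety φ → φ Ψ.assoc → Typed Θ (Γ.liftSess.add Ψ.assoc) P → Typed Θ Γ (.nu P)
  | sum {Θ : PCtx} {Γ : Ctx} {n : ℕ} {c : Fin n → Chan} {ρ : Fin n → RoleE} {m : Fin n → Label}
      {V : Fin n → List Chan} {W : Fin n → List RoleE} {P : Fin n → Proc} :
      0 < n → (∀ i, Typed Θ Γ (.snd (c i) (ρ i) (m i) (V i) (W i) (P i))) →
      Typed Θ Γ (.sum n c ρ m V W P)
  | snd {Θ : PCtx} {Δ Δ' Δ'' Γ Γs Γr : Ctx} {c : Chan} {ρ : RoleE} {m : Label} {V : List Chan}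
      {W : List RoleE} {P : Proc} {a : ℕ} {pay : Fin a → SType} {rs : List RoleE} {S : SType} :
      ValsTyped Δ Δ' (V.map .chan ++ W.map .role)
        ((List.ofFn pay).map .sess ++ rs.map .role) →
      Δ'.Split Δ'' Γr → Δ''.Split Γ Γs →
      ValTyped Γs (.chan c) (.sess (.sel 1 (fun _ => ρ) (fun _ => m) (fun _ => a) (fun _ => pay)
        (fun _ => rs) (fun _ => S))) →
      ValTyped Γr (.role ρ) (.role ρ) →
      Typed Θ (Γ.add (.single c S)) P →
      Typed Θ Δ (.snd c ρ m V W P)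
  | rcv {Θ : PCtx} {Δ Δ' Γ Γs Γr : Ctx} {c : Chan} {ρ : RoleE} {n : ℕ} {m : Fin n → Label}
      {nx k : Fin n → ℕ} {P : Fin n → Proc} {pay : (i : Fin n) → Fin (nx i) → SType}
      {S : Fin n → SType} :
      Δ.Split Δ' Γr → Δ'.Split Γ Γs →
      ValTyped Γs (.chan c) (.sess (.bra ρ n m nx pay k S)) →
      ValTyped Γr (.role ρ) (.role ρ) →
      (∀ i, Typed (Θ.rshift (k i))
        ((((Γ.lift (nx i) (k i)).add (.single (c.shift (nx i)) (S i))).add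
          (.binders (pay i))).add (.roles (k i))) (P i)) →
      Typed Θ Δ (.rcv c ρ n m nx k P)
  | rep {Θ : PCtx} {Δ Γ Γs : Ctx} {c : Chan} {r : Option Role} {n : ℕ} {m : Fin n → Label}
      {nx k : Fin n → ℕ} {P : Fin n → Proc} {pay : (i : Fin n) → Fin (nx i) → SType}
      {S : Fin n → SType} :
      Δ.Split Γ Γs →
      ValTyped Γs (.chan c) (.sess (.rep r n m nx pay k S)) →
      Γ.End →
      (∀ i, Typed (Θ.rshift (repDepth r (k i)))
        ((((Γ.lift (nx i) (repDepth r (k i))).add (.single (c.shift (nx i)) (S i))).add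
          (.binders (pay i))).add (.roles (repDepth r (k i)))) (P i)) →
      Typed Θ Δ (.rep c r n m nx k P)
  | defn {Θ : PCtx} {Δ Γ Γ' : Ctx} {k : ℕ} {P Q : Proc} (S : Fin k → SType) :
      (∀ i, (S i).WF) →
      Δ.Split Γ Γ' →
      Typed (Θ.cons (List.ofFn S)) ((Γ.lift k 0).add (.binders S)) P →
      Γ.End →
      Typed (Θ.cons (List.ofFn S)) Γ' Q →
      Typed Θ Δ (.defn k P Q)
  | call {Θ : PCtx} {Δ Γ₀ : Ctx} {X : ℕ} {c : List Chan} {Ss : List SType} :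
      Θ X = some Ss →
      Γ₀.End →
      ValsTyped Δ Γ₀ (c.map .chan) (Ss.map .sess) →
      Typed Θ Δ (.call X c)

end MPSTBang

namespace MPSTBang

/-! ### Role substitutions -/

/-! The difficulty is that contexts are split only up to type congruence, so typing derivations are
hard to invert and to rearrange. The remedy is a normal form. Modulo congruence, a runtime type is
the finite multiset of the head normal forms of its components, with `end` left out
(`RType.cong_iff`). A context is then, up to congruence, its set of role variables, its domain, and
a multiset of pairs of a channel and a head normal form (`LCtx`). Splitting becomes addition of
multisets.

Typing is recast as `LTyped`, defined by recursion on the process. The role variables and the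
channels in scope are separate parameters, so weakening by `end` entries disappears, and the
multiset is consumed exactly. `Typed.ltyped` and `LTyped.typed` translate in both directions. On the
linear side a single substitution lemma, `LTyped.subst`, covers renaming, weakening, narrowing along
subtyping and the instantiation of received values; it passes under restrictions because safety
forces protocols to be closed. Its counterpart for renamings, `LTyped.of_ren`, shows that a weakened
process uses none of the new names. Together they give invariance under structural congruence,
`SCong.ltyped`.

Context reduction becomes a reaction of two components (`LCtx.Red`), which contexts simulate without
changing domain or role variables (`LCtx.Reds.simulate`). Hence a safety property makes all
reachable linear contexts compatible (`IsSafety.safe`). This consequence, `LCtx.Safe`, is the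
hypothesis of the induction on reduction: it passes to parts (`LCtx.Safe.left`) and to the union
with a fresh session (`LCtx.Safe.renSess_add`).

The core is communication (`React.of_compat`, `LTyped.communicate`). The sender's actual type is a
subtype of the singleton selection that types the send, so it contains that message. Compatibility
gives the receiver's actual type a branch with this label, and subtyping transports the branch to
the type used by the receiving process; as labels are distinct, it is the branch that the process
takes. The payload types then form a chain of subtypings, and both continuations are typed by
narrowing. A replicated receiver also keeps its component. Choices and calls need no context
reduction. Under a restriction, the reduction of the inner context separates into one of the outer
context and one of the protocol (`LCtx.Reds.of_renSess_add`), and the reduced protocol is safe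
again. -/

@[simp] theorem RoleE.subst_var (ρ : RoleE) : ρ.subst .var = ρ := by cases ρ <;> rfl

theorem RoleE.subst_subst (ρ : RoleE) (σ σ' : ℕ → RoleE) :
    (ρ.subst σ).subst σ' = ρ.subst (fun a => (σ a).subst σ') := by cases ρ <;> rfl

theorem RoleE.shift_eq_subst (ρ : RoleE) (k : ℕ) : ρ.shift k = ρ.subst (fun a => .var (a + k)) := by
  cases ρ <;> rfl

@[simp] theorem liftRo_var (k : ℕ) : liftRo RoleE.var k = RoleE.var := by
  funext i
  unfold liftRo
  split
  · rfl
  · simp only [RoleE.shift, RoleE.var.injEq]; omega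

theorem liftRo_add (σ : ℕ → RoleE) (k i : ℕ) : liftRo σ k (i + k) = (σ i).shift k := by
  simp [liftRo]

theorem liftRo_comp (σ σ' : ℕ → RoleE) (k : ℕ) :
    (fun a => (liftRo σ k a).subst (liftRo σ' k)) = liftRo (fun a => (σ a).subst σ') k := by
  funext i
  by_cases h : i < k
  · simp [liftRo, h, RoleE.subst]
  · have : liftRo σ k i = (σ (i - k)).shift k := by simp [liftRo, h]
    rw [this]
    have : liftRo (fun a => (σ a).subst σ') k i = ((σ (i - k)).subst σ').shift k := by
      simp [liftRo, h]
    rw [this]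
    cases σ (i - k) with
    | name q => rfl
    | var a => exact liftRo_add σ' k a

/-- The role substitutes of a received message: a universal receive also gets the sender. -/
def recvRoles (r : Option Role) (rs : List Role) (p : Role) : List Role :=
  match r with
  | some _ => rs
  | none => rs ++ [p]

@[simp] theorem length_recvRoles (r : Option Role) (rs : List Role) (p : Role) :
    (recvRoles r rs p).length = repDepth r rs.length := by
  cases r <;> simp [recvRoles, repDepth]

theorem instRo_add (rs : List Role) (a : ℕ) : instRo rs (a + rs.length) = .var a := by
  simp [instRo]

/-! ### Role substitution in session types -/

namespace SType

theorem rsubst_rsubst (S : SType) (σ σ' : ℕ → RoleE) :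
    (S.rsubst σ).rsubst σ' = S.rsubst (fun a => (σ a).subst σ') := by
  induction S generalizing σ σ' with
  | fin => rfl
  | tvar t => rfl
  | mu S ih => simp [rsubst, ih]
  | sel n tgt lab ar pay rol cont ihp ihc =>
    simp [rsubst, ihp, ihc, RoleE.subst_subst, Function.comp_def]
  | bra ρ n lab ar pay k cont ihp ihc =>
    simp [rsubst, ihp, ihc, RoleE.subst_subst, liftRo_comp]
  | rep r n lab ar pay k cont ihp ihc =>
    simp [rsubst, ihp, ihc, liftRo_comp]

@[simp] theorem rsubst_var (S : SType) : S.rsubst .var = S := by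
  induction S with
  | fin => rfl
  | tvar t => rfl
  | mu S ih => simp [rsubst, ih]
  | sel n tgt lab ar pay rol cont ihp ihc =>
    have : RoleE.subst RoleE.var = fun ρ => ρ := funext RoleE.subst_var
    simp [rsubst, ihp, ihc, this]
  | bra ρ n lab ar pay k cont ihp ihc => simp [rsubst, ihp, ihc]
  | rep r n lab ar pay k cont ihp ihc => simp [rsubst, ihp, ihc]

/-- A weakened type does not mention the `k` new variables, and above them the lifted substitution
acts as `σ`. -/
theorem rshift_rsubst_liftRo (S : SType) (σ : ℕ → RoleE) (k : ℕ) :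
    (S.rshift k).rsubst (liftRo σ k) = (S.rsubst σ).rshift k := by
  simp only [rshift, rsubst_rsubst]
  congr 1
  funext a
  rw [← RoleE.shift_eq_subst]
  exact liftRo_add σ k a

-- An input weakens the types around it by its bound roles; the communication that instantiates
-- these roles cancels the weakening.
@[simp] theorem rshift_rsubst_instRo (S : SType) (rs : List Role) :
    (S.rshift rs.length).rsubst (instRo rs) = S := by
  simp only [rshift, rsubst_rsubst]
  have : (fun a => RoleE.subst (instRo rs) (.var (a + rs.length))) = RoleE.var := by
    funext a; exact instRo_add rs a
  rw [this, rsubst_var]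

theorem tshift_rsubst (S : SType) (c : ℕ) (σ : ℕ → RoleE) :
    (S.tshift c).rsubst σ = (S.rsubst σ).tshift c := by
  induction S generalizing c σ with
  | fin => rfl
  | tvar t => rfl
  | mu S ih => simp [rsubst, tshift, ih]
  | sel n tgt lab ar pay rol cont ihp ihc => simp [rsubst, tshift, ihp, ihc]
  | bra ρ n lab ar pay k cont ihp ihc => simp [rsubst, tshift, ihp, ihc]
  | rep r n lab ar pay k cont ihp ihc => simp [rsubst, tshift, ihp, ihc]

/-- Below a role binder the substitutes `τ t` are weakened while `σ` is lifted;
`rshift_rsubst_liftRo` makes the two compatible. The use is that role substitution commutes with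
unfolding. -/
theorem tsubst_rsubst (S : SType) (τ : ℕ → SType) (σ : ℕ → RoleE) :
    (S.tsubst τ).rsubst σ = (S.rsubst σ).tsubst (fun t => (τ t).rsubst σ) := by
  induction S generalizing τ σ with
  | fin => rfl
  | tvar t => rfl
  | mu S ih =>
    simp only [rsubst, tsubst, ih, mu.injEq]
    congr 1
    funext t
    cases t with
    | zero => rfl
    | succ t => exact tshift_rsubst _ _ _
  | sel n tgt lab ar pay rol cont ihp ihc => simp [rsubst, tsubst, ihp, ihc]
  | bra ρ n lab ar pay k cont ihp ihc =>
    simp [rsubst, tsubst, ihp, ihc, rshift_rsubst_liftRo]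
  | rep r n lab ar pay k cont ihp ihc =>
    simp [rsubst, tsubst, ihp, ihc, rshift_rsubst_liftRo]

theorem unfold_rsubst (S : SType) (σ : ℕ → RoleE) : S.unfold.rsubst σ = (S.rsubst σ).unfold := by
  unfold unfold
  rw [tsubst_rsubst]
  congr 1
  funext t
  cases t <;> rfl

/-! ### Well-formedness -/

@[simp] theorem headVar_rsubst (S : SType) (σ : ℕ → RoleE) : (S.rsubst σ).headVar = S.headVar := by
  induction S generalizing σ with
  | mu S ih => simp [rsubst, headVar, ih]
  | _ => simp [rsubst, headVar]

@[simp] theorem wfAt_rsubst (S : SType) (d : ℕ) (σ : ℕ → RoleE) :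
    (S.rsubst σ).WFAt d ↔ S.WFAt d := by
  induction S generalizing d σ with
  | fin => rfl
  | tvar t => rfl
  | mu S ih => simp [rsubst, WFAt, ih]
  | sel n tgt lab ar pay rol cont ihp ihc => simp [rsubst, WFAt, ihp, ihc]
  | bra ρ n lab ar pay k cont ihp ihc => simp [rsubst, WFAt, ihp, ihc]
  | rep r n lab ar pay k cont ihp ihc => simp [rsubst, WFAt, ihp, ihc]

@[simp] theorem wf_rsubst (S : SType) (σ : ℕ → RoleE) : (S.rsubst σ).WF ↔ S.WF :=
  wfAt_rsubst S 0 σ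

theorem headVar_tshift (S : SType) (c : ℕ) :
    (S.tshift c).headVar = S.headVar.map (fun t => if t < c then t else t + 1) := by
  induction S generalizing c with
  | mu S ih =>
    simp only [tshift, headVar, ih]
    rcases S.headVar with _ | _ | t
    · rfl
    · simp
    · simp only [Option.map_some, add_lt_add_iff_right]
      by_cases h : t < c <;> simp [h]
  | _ => simp [tshift, headVar]

theorem WFAt.tshift {S : SType} {d : ℕ} (h : S.WFAt d) (c : ℕ) : (S.tshift c).WFAt (d + 1) := by
  induction S generalizing c d with
  | fin => trivial
  | tvar t =>
    simp only [SType.tshift, WFAt] at h ⊢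
    split <;> omega
  | mu S ih =>
    refine ⟨?_, ih h.2 _⟩
    rw [headVar_tshift]
    have := h.1
    rcases hS : S.headVar with _ | _ | t
    · simp
    · exact absurd hS this
    · simp only [Option.map_some, ne_eq, Option.some.injEq]
      split <;> omega
  | sel n tgt lab ar pay rol cont ihp ihc =>
    exact ⟨h.1, fun i j => ihp i j (h.2.1 i j) c, fun i => ihc i (h.2.2 i) c⟩
  | bra ρ n lab ar pay k cont ihp ihc =>
    exact ⟨h.1, h.2.1, fun i j => ihp i j (h.2.2.1 i j) c, fun i => ihc i (h.2.2.2 i) c⟩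
  | rep r n lab ar pay k cont ihp ihc =>
    exact ⟨h.1, h.2.1, fun i j => ihp i j (h.2.2.1 i j) c, fun i => ihc i (h.2.2.2 i) c⟩

/-- Only the substitute at the unguarded position of `S` can leave a variable unguarded in the
result. -/
theorem headVar_tsubst (S : SType) (τ : ℕ → SType) :
    (S.tsubst τ).headVar = S.headVar.bind (fun t => (τ t).headVar) := by
  induction S generalizing τ with
  | mu S ih =>
    simp only [tsubst, headVar, ih]
    rcases S.headVar with _ | _ | t
    · rfl
    · rfl
    · simp only [Option.bind_some, headVar_tshift]
      rcases (τ t).headVar with _ | t <;> rfl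
  | _ => simp [tsubst, headVar]

theorem WFAt.tsubst {S : SType} {d d' : ℕ} {τ : ℕ → SType} (h : S.WFAt d)
    (hτ : ∀ t, t < d → (τ t).WFAt d') : (S.tsubst τ).WFAt d' := by
  induction S generalizing d d' τ with
  | fin => trivial
  | tvar t => exact hτ t h
  | mu S ih =>
    refine ⟨?_, ih h.2 ?_⟩
    · rw [headVar_tsubst]
      have := h.1
      rcases hS : S.headVar with _ | _ | t
      · simp
      · exact absurd hS this
      -- Below the binder the substitutes are weakened, so their unguarded variable, if any, is not
      -- the bound one.
      · simp only [Option.bind_some, headVar_tshift]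
        rcases (τ t).headVar with _ | t <;> simp
    · intro t ht
      cases t with
      | zero => exact Nat.succ_pos d'
      | succ t => exact (hτ t (by omega)).tshift 0
  | sel n tgt lab ar pay rol cont ihp ihc =>
    exact ⟨h.1, fun i j => ihp i j (h.2.1 i j) hτ, fun i => ihc i (h.2.2 i) hτ⟩
  | bra ρ n lab ar pay k cont ihp ihc =>
    exact ⟨h.1, h.2.1, fun i j => ihp i j (h.2.2.1 i j) fun t ht => (wfAt_rsubst _ _ _).2 (hτ t ht),
      fun i => ihc i (h.2.2.2 i) fun t ht => (wfAt_rsubst _ _ _).2 (hτ t ht)⟩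
  | rep r n lab ar pay k cont ihp ihc =>
    exact ⟨h.1, h.2.1, fun i j => ihp i j (h.2.2.1 i j) fun t ht => (wfAt_rsubst _ _ _).2 (hτ t ht),
      fun i => ihc i (h.2.2.2 i) fun t ht => (wfAt_rsubst _ _ _).2 (hτ t ht)⟩

theorem WF.unfold {S : SType} (h : (mu S).WF) : S.unfold.WF := by
  refine WFAt.tsubst h.2 ?_
  intro t ht
  cases t with
  | zero => exact h
  | succ t => omega

/-! ### Head normal forms -/

/-- The number of leading recursion binders. -/
def muDepth : SType → ℕ
  | mu S => S.muDepth + 1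
  | _ => 0

/-- Unfold the outermost recursion, if there is one. -/
def unfoldHead : SType → SType
  | mu S => S.unfold
  | S => S

@[simp] theorem muDepth_rsubst (S : SType) (σ : ℕ → RoleE) : (S.rsubst σ).muDepth = S.muDepth := by
  induction S generalizing σ with
  | mu S ih => simp [rsubst, muDepth, ih]
  | _ => simp [rsubst, muDepth]

@[simp] theorem muDepth_tshift (S : SType) (c : ℕ) : (S.tshift c).muDepth = S.muDepth := by
  induction S generalizing c with
  | mu S ih => simp [tshift, muDepth, ih]
  | _ => simp [tshift, muDepth]

theorem muDepth_tsubst (S : SType) (τ : ℕ → SType)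
    (h : ∀ t, S.headVar = some t → (τ t).muDepth = 0) : (S.tsubst τ).muDepth = S.muDepth := by
  induction S generalizing τ with
  | tvar t => exact h t rfl
  | mu S ih =>
    simp only [tsubst, muDepth, Nat.add_right_cancel_iff]
    refine ih _ ?_
    intro t ht
    cases t with
    | zero => rfl
    | succ t =>
      simp only [muDepth_tshift]
      exact h t (by simp [headVar, ht])
  | _ => simp [tsubst, muDepth]

/-- By guardedness the recursive type is not substituted at the head, so unfolding removes exactly
one leading binder. This is the measure by which head normal forms are reached. -/
theorem muDepth_unfold {S : SType} (h : (mu S).WF) : S.unfold.muDepth = S.muDepth := by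
  refine muDepth_tsubst _ _ ?_
  intro t ht
  cases t with
  | zero => exact absurd ht h.1
  | succ t => rfl

open Classical in
/-- The head normal form of a well-formed type; an ill-formed type is left as it is. -/
noncomputable def nf (S : SType) : SType :=
  if S.WF then unfoldHead^[S.muDepth] S else S

theorem nf_of_muDepth {S : SType} (h : S.muDepth = 0) : S.nf = S := by
  simp [nf, h]

@[simp] theorem nf_fin : fin.nf = fin := nf_of_muDepth rfl

theorem nf_mu {S : SType} (h : (mu S).WF) : (mu S).nf = S.unfold.nf := by
  simp [nf, h, WF.unfold h, muDepth, muDepth_unfold h, unfoldHead]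

/-- Induction along the unfolding of the leading recursion binders. -/
theorem WF.unfold_induction {p : SType → Prop} (base : ∀ S, S.WF → S.muDepth = 0 → p S)
    (step : ∀ S, (mu S).WF → p S.unfold → p (mu S)) {S : SType} (h : S.WF) : p S := by
  generalize hn : S.muDepth = n
  induction n generalizing S with
  | zero => exact base S h hn
  | succ n ih =>
    cases S with
    | mu S =>
      exact step S h (ih (WF.unfold h) ((muDepth_unfold h).trans (Nat.succ.inj hn)))
    | _ => simp [muDepth] at hn

theorem WF.muDepth_nf {S : SType} (h : S.WF) : S.nf.muDepth = 0 := by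
  refine WF.unfold_induction (p := fun S => S.nf.muDepth = 0) ?_ ?_ h
  · intro S _ h0; rw [nf_of_muDepth h0, h0]
  · intro S hS ih; rw [nf_mu hS]; exact ih

theorem WF.nf {S : SType} (h : S.WF) : S.nf.WF := by
  refine WF.unfold_induction (p := fun S => S.nf.WF) ?_ ?_ h
  · intro S h h0; rwa [nf_of_muDepth h0]
  · intro S hS ih; rw [nf_mu hS]; exact ih

theorem nf_wf_iff (S : SType) : S.nf.WF ↔ S.WF := by
  refine ⟨fun h => ?_, WF.nf⟩
  by_contra h'
  simp only [SType.nf, h', if_false] at h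

/-- Each unfolding commutes with `σ`, and an ill-formed type stays ill-formed and is left alone on
both sides; so no well-formedness is required. -/
theorem nf_rsubst (S : SType) (σ : ℕ → RoleE) : (S.rsubst σ).nf = S.nf.rsubst σ := by
  by_cases h : S.WF
  · refine WF.unfold_induction (p := fun S => (S.rsubst σ).nf = S.nf.rsubst σ) ?_ ?_ h
    · intro S h h0
      rw [nf_of_muDepth h0, nf_of_muDepth (by simpa using h0)]
    · intro S hS ih
      have : ((mu S).rsubst σ).nf = (S.rsubst σ).unfold.nf :=
        nf_mu ((wf_rsubst (mu S) σ).2 hS)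
      rw [this, nf_mu hS, ← unfold_rsubst, ih]
  · simp [nf, h]

/-- Well-formed head normal forms other than `end`. -/
def Nrm (S : SType) : Prop := S.WF ∧ S.muDepth = 0 ∧ S ≠ fin

theorem Nrm.nf_eq {S : SType} (h : S.Nrm) : S.nf = S := nf_of_muDepth h.2.1

@[simp] theorem rsubst_eq_fin (S : SType) (σ : ℕ → RoleE) : S.rsubst σ = fin ↔ S = fin := by
  cases S <;> simp [rsubst]

@[simp] theorem nrm_rsubst (S : SType) (σ : ℕ → RoleE) : (S.rsubst σ).Nrm ↔ S.Nrm := by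
  simp [Nrm]

theorem WF.nrm_nf {S : SType} (h : S.WF) (h' : S.nf ≠ fin) : S.nf.Nrm := ⟨h.nf, h.muDepth_nf, h'⟩

/-! ### Subtyping -/

theorem SubRule.mono {R R' : SType → SType → Prop} (h : ∀ A B, R A B → R' A B) {A B : SType}
    (hr : SubRule R A B) : SubRule R' A B := by
  cases hr with
  | refl => exact .refl _
  | bra hi =>
    refine .bra fun i => ?_
    obtain ⟨j, h1, h2, h3, h4⟩ := hi i
    exact ⟨j, h1, h2, h3.imp (fun _ _ => h _ _), h _ _ h4⟩
  | rep hi =>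
    refine .rep fun i => ?_
    obtain ⟨j, h1, h2, h3, h4⟩ := hi i
    exact ⟨j, h1, h2, h3.imp (fun _ _ => h _ _), h _ _ h4⟩
  | sel hi =>
    refine .sel fun i => ?_
    obtain ⟨j, h0, h1, h2, h3, h4⟩ := hi i
    exact ⟨j, h0, h1, h2, h3.imp (fun _ _ => h _ _), h _ _ h4⟩
  | unfoldL hr => exact .unfoldL (h _ _ hr)
  | unfoldR hr => exact .unfoldR (h _ _ hr)

theorem Sub.rule {A B : SType} (h : A.Sub B) : SubRule Sub A B := by
  obtain ⟨R, hAB, hR⟩ := h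
  exact (hR A B hAB).mono fun A B h => ⟨R, h, hR⟩

/-- Coinduction up to subtyping. -/
theorem Sub.coind {R : SType → SType → Prop}
    (hR : ∀ A B, R A B → SubRule (fun A B => R A B ∨ A.Sub B) A B) {A B : SType} (h : R A B) :
    A.Sub B := by
  refine ⟨fun A B => R A B ∨ A.Sub B, Or.inl h, ?_⟩
  rintro A B (h | h)
  · exact hR A B h
  · exact h.rule.mono fun _ _ => Or.inr

theorem Sub.of_rule {A B : SType} (h : SubRule Sub A B) : A.Sub B :=
  Sub.coind (R := fun A' B' => A' = A ∧ B' = B)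
    (by rintro _ _ ⟨rfl, rfl⟩; exact h.mono fun _ _ => Or.inr) ⟨rfl, rfl⟩

theorem Sub.refl (A : SType) : A.Sub A := .of_rule (.refl A)

/-- The rule at the root may unfold the right side instead. Coinduction on the pairs of `A.unfold`
with some `B'` above `mu A` moves the left unfolding past such rules. -/
theorem Sub.mu_left {A B : SType} : (mu A).Sub B ↔ A.unfold.Sub B := by
  refine ⟨fun h => ?_, fun h => .of_rule (.unfoldL h)⟩
  refine Sub.coind (R := fun A' B' => A' = A.unfold ∧ (mu A).Sub B') ?_ ⟨rfl, h⟩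
  rintro A' B' ⟨rfl, h⟩
  have h' := h.rule
  generalize hM : mu A = M at h'
  cases h' with
  | refl => subst hM; exact .unfoldR (Or.inr (.refl _))
  | unfoldL hr => cases hM; exact hr.rule.mono fun _ _ => Or.inr
  | unfoldR hr => subst hM; exact .unfoldR (Or.inl ⟨rfl, hr⟩)
  | _ => cases hM

theorem Sub.mu_right {A B : SType} : A.Sub (mu B) ↔ A.Sub B.unfold := by
  refine ⟨fun h => ?_, fun h => .of_rule (.unfoldR h)⟩
  refine Sub.coind (R := fun A' B' => B' = B.unfold ∧ A'.Sub (mu B)) ?_ ⟨rfl, h⟩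
  rintro A' B' ⟨rfl, h⟩
  have h' := h.rule
  generalize hM : mu B = M at h'
  cases h' with
  | refl => subst hM; exact .unfoldL (Or.inr (.refl _))
  | unfoldR hr => cases hM; exact hr.rule.mono fun _ _ => Or.inr
  | unfoldL hr => subst hM; exact .unfoldL (Or.inl ⟨rfl, hr⟩)
  | _ => cases hM

theorem sub_nf_left {A B : SType} (hA : A.WF) : A.nf.Sub B ↔ A.Sub B := by
  refine WF.unfold_induction (p := fun A => A.nf.Sub B ↔ A.Sub B) ?_ ?_ hA
  · intro S _ h0; rw [nf_of_muDepth h0]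
  · intro S hS ih; rw [nf_mu hS, Sub.mu_left, ih]

theorem sub_nf_right {A B : SType} (hB : B.WF) : A.Sub B.nf ↔ A.Sub B := by
  refine WF.unfold_induction (p := fun B => A.Sub B.nf ↔ A.Sub B) ?_ ?_ hB
  · intro S _ h0; rw [nf_of_muDepth h0]
  · intro S hS ih; rw [nf_mu hS, Sub.mu_right, ih]

theorem forall₂_map_ofFn {R R' : SType → SType → Prop} {m n : ℕ} {f : Fin m → SType}
    {g : Fin n → SType} {F : SType → SType} (hR : ∀ A B, R A B → R' (F A) (F B))
    (h : List.Forall₂ R (List.ofFn f) (List.ofFn g)) :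
    List.Forall₂ R' (List.ofFn fun i => F (f i)) (List.ofFn fun i => F (g i)) := by
  have hf : (List.ofFn fun i => F (f i)) = (List.ofFn f).map F := by rw [List.map_ofFn]; rfl
  have hg : (List.ofFn fun i => F (g i)) = (List.ofFn g).map F := by rw [List.map_ofFn]; rfl
  rw [hf, hg, List.forall₂_map_left_iff, List.forall₂_map_right_iff]
  exact h.imp hR

/-- The substitution varies in the coinduction because it is lifted under the role binders of a
branch. -/
theorem Sub.rsubst {A B : SType} (h : A.Sub B) (σ : ℕ → RoleE) :
    (A.rsubst σ).Sub (B.rsubst σ) := by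
  refine Sub.coind (R := fun A' B' => ∃ σ A B, A' = A.rsubst σ ∧ B' = B.rsubst σ ∧ A.Sub B) ?_
    ⟨σ, A, B, rfl, rfl, h⟩
  rintro _ _ ⟨σ, A, B, rfl, rfl, h⟩
  have key' : ∀ σ (A B : SType), A.Sub B →
      ((∃ (σ' : ℕ → RoleE) (A' B' : SType), A.rsubst σ = A'.rsubst σ' ∧
        B.rsubst σ = B'.rsubst σ' ∧ A'.Sub B') ∨
        (A.rsubst σ).Sub (B.rsubst σ)) := fun σ A B h => Or.inl ⟨σ, A, B, rfl, rfl, h⟩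
  cases h.rule with
  | refl => exact .refl _
  | bra hi =>
    refine .bra fun i => ?_
    obtain ⟨j, h1, h2, h3, h4⟩ := hi i
    refine ⟨j, h1, h2, ?_, ?_⟩
    -- Matching branches bind equally many roles, so `σ` is lifted in the same way on both sides.
    · rw [h2]; exact forall₂_map_ofFn (key' _) h3
    · rw [h2]; exact key' _ _ _ h4
  | rep hi =>
    refine .rep fun i => ?_
    obtain ⟨j, h1, h2, h3, h4⟩ := hi i
    refine ⟨j, h1, h2, ?_, ?_⟩
    · rw [h2]; exact forall₂_map_ofFn (key' _) h3
    · rw [h2]; exact key' _ _ _ h4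
  | sel hi =>
    refine .sel fun i => ?_
    obtain ⟨j, h0, h1, h2, h3, h4⟩ := hi i
    exact ⟨j, by rw [h0], h1, by rw [h2], forall₂_map_ofFn (key' _) h3, key' _ _ _ h4⟩
  | unfoldL hr =>
    refine .unfoldL ?_
    rw [← unfold_rsubst]; exact key' _ _ _ hr
  | unfoldR hr =>
    refine .unfoldR ?_
    rw [← unfold_rsubst]; exact key' _ _ _ hr

theorem Sub.rshift {A B : SType} (h : A.Sub B) (k : ℕ) : (A.rshift k).Sub (B.rshift k) :=
  h.rsubst _

theorem forall₂_ofFn_trans {R R' R'' : SType → SType → Prop} {l n : ℕ} {p : SType → Prop}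
    (hR : ∀ A B C, p B → R A B → R' B C → R'' A C) {m : ℕ} {f : Fin l → SType}
    {g : Fin m → SType} {e : Fin n → SType} (hg : ∀ i, p (g i))
    (h : List.Forall₂ R (List.ofFn f) (List.ofFn g))
    (h' : List.Forall₂ R' (List.ofFn g) (List.ofFn e)) :
    List.Forall₂ R'' (List.ofFn f) (List.ofFn e) := by
  have hl : l = m := by simpa using h.length_eq
  have hl' : m = n := by simpa using h'.length_eq
  subst hl hl'
  rw [List.forall₂_iff_get] at h h' ⊢
  refine ⟨by simp, fun i h1 h2 => ?_⟩
  have e1 := h.2 i (by simpa using h1) (by simpa using h1)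
  have e2 := h'.2 i (by simpa using h1) (by simpa using h1)
  simp only [List.get_ofFn] at e1 e2 ⊢
  exact hR _ _ _ (hg _) e1 e2

/-- The middle type is replaced by its head normal form, so that neither derivation can unfold it
and their rules match. Well-formedness of `B` is essential: the unguarded type `μt.t` is below and
above every type, since it can be unfolded forever. -/
theorem Sub.trans {A B C : SType} (hB : B.WF) (h : A.Sub B) (h' : B.Sub C) : A.Sub C := by
  refine Sub.coind (R := fun A C => ∃ B : SType, B.WF ∧ A.Sub B ∧ B.Sub C) ?_ ⟨B, hB, h, h'⟩
  rintro A C ⟨B, hB, h, h'⟩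
  rw [← sub_nf_left hB] at h'
  rw [← sub_nf_right hB] at h
  replace hB : B.nf.WF ∧ B.nf.muDepth = 0 := ⟨hB.nf, hB.muDepth_nf⟩
  generalize B.nf = B at h h' hB
  obtain ⟨hB, hd⟩ := hB
  have key : ∀ A B C : SType, B.WF → A.Sub B → B.Sub C →
    (∃ B : SType, B.WF ∧ A.Sub B ∧ B.Sub C) ∨ A.Sub C := fun A B C h1 h2 h3 => Or.inl ⟨B, h1, h2, h3⟩
  have key' : ∀ C B A : SType, B.WF → C.Sub B → B.Sub A →
    (∃ B : SType, B.WF ∧ C.Sub B ∧ B.Sub A) ∨ C.Sub A := fun A B C h1 h2 h3 => Or.inl ⟨B, h1, h2, h3⟩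
  cases h.rule with
  | refl => exact h'.rule.mono fun _ _ => Or.inr
  | unfoldL hr => exact .unfoldL (Or.inl ⟨B, hB, hr, h'⟩)
  | unfoldR hr => simp [muDepth] at hd
  | bra hi =>
    cases h'.rule with
    | refl => exact h.rule.mono fun _ _ => Or.inr
    | unfoldR hr => exact .unfoldR (Or.inl ⟨_, hB, h, hr⟩)
    | bra hj =>
      refine .bra fun i => ?_
      obtain ⟨j, h1, h2, h3, h4⟩ := hi i
      obtain ⟨l, h1', h2', h3', h4'⟩ := hj j
      exact ⟨l, h1.trans h1', h2.trans h2', forall₂_ofFn_trans key (hB.2.2.1 j) h3 h3',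
        key _ _ _ (hB.2.2.2 j) h4 h4'⟩
  | rep hi =>
    cases h'.rule with
    | refl => exact h.rule.mono fun _ _ => Or.inr
    | unfoldR hr => exact .unfoldR (Or.inl ⟨_, hB, h, hr⟩)
    | rep hj =>
      refine .rep fun i => ?_
      obtain ⟨j, h1, h2, h3, h4⟩ := hi i
      obtain ⟨l, h1', h2', h3', h4'⟩ := hj j
      exact ⟨l, h1.trans h1', h2.trans h2', forall₂_ofFn_trans key (hB.2.2.1 j) h3 h3',
        key _ _ _ (hB.2.2.2 j) h4 h4'⟩
  | sel hi =>
    cases h'.rule with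
    | refl => exact h.rule.mono fun _ _ => Or.inr
    | unfoldR hr => exact .unfoldR (Or.inl ⟨_, hB, h, hr⟩)
    | sel hj =>
      refine .sel fun i => ?_
      obtain ⟨j, h0, h1, h2, h3, h4⟩ := hj i
      obtain ⟨l, h0', h1', h2', h3', h4'⟩ := hi j
      exact ⟨l, h0'.trans h0, h1'.trans h1, h2'.trans h2,
        forall₂_ofFn_trans key' (hB.2.1 j) h3 h3', key _ _ _ (hB.2.2 j) h4' h4⟩

theorem Sub.fin_right {A : SType} (h : A.Sub fin) (hA : A.muDepth = 0) : A = fin := by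
  cases h.rule with
  | refl => rfl
  | unfoldL => simp [muDepth] at hA

theorem Sub.fin_left {B : SType} (h : fin.Sub B) (hB : B.muDepth = 0) : B = fin := by
  cases h.rule with
  | refl => rfl
  | unfoldR => simp [muDepth] at hB

theorem Sub.nf {A B : SType} (h : A.Sub B) (hA : A.WF) (hB : B.WF) : A.nf.Sub B.nf :=
  (sub_nf_left hA).2 ((sub_nf_right hB).2 h)

/-- Passing to a subtype can therefore neither create nor lose a component of a linear context. -/
theorem Sub.nf_eq_fin_iff {A B : SType} (h : A.Sub B) (hA : A.WF) (hB : B.WF) :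
    A.nf = fin ↔ B.nf = fin := by
  have h' := h.nf hA hB
  constructor
  · intro e; rw [e] at h'; exact h'.fin_left hB.muDepth_nf
  · intro e; rw [e] at h'; exact h'.fin_right hA.muDepth_nf

end SType

/-! ### Inversion of subtyping at head normal forms -/

namespace SType

theorem forall₂_ofFn_iff {R : SType → SType → Prop} {n : ℕ} {f g : Fin n → SType} :
    List.Forall₂ R (List.ofFn f) (List.ofFn g) ↔ ∀ i, R (f i) (g i) := by
  rw [List.forall₂_iff_get]
  constructor
  · intro h i
    have := h.2 i (by simp) (by simp)
    simp only [List.get_ofFn] at this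
    exact this
  · intro h
    refine ⟨by simp, fun i h1 h2 => ?_⟩
    simp only [List.get_ofFn]
    exact h _

/-- A head normal form has nothing to unfold, so only reflexivity and the branching rule apply;
reflexivity is a branching rule with identical premises. -/
theorem Sub.bra_right {A : SType} {ρ : RoleE} {n : ℕ} {lab : Fin n → Label} {ar : Fin n → ℕ}
    {pay : (i : Fin n) → Fin (ar i) → SType} {k : Fin n → ℕ} {cont : Fin n → SType}
    (h : A.Sub (bra ρ n lab ar pay k cont)) (hA : A.muDepth = 0) :
    ∃ (n' : ℕ) (lab' : Fin n' → Label) (ar' : Fin n' → ℕ)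
      (pay' : (i : Fin n') → Fin (ar' i) → SType) (k' : Fin n' → ℕ) (cont' : Fin n' → SType),
      A = bra ρ n' lab' ar' pay' k' cont' ∧ ∀ i, ∃ j, lab' i = lab j ∧ k' i = k j ∧
        List.Forall₂ Sub (List.ofFn (pay' i)) (List.ofFn (pay j)) ∧ (cont' i).Sub (cont j) := by
  cases h.rule with
  | refl =>
    exact ⟨_, _, _, _, _, _, rfl, fun i => ⟨i, rfl, rfl, forall₂_ofFn_iff.2 fun _ => .refl _,
      .refl _⟩⟩
  | unfoldL => simp [muDepth] at hA
  | bra hi => exact ⟨_, _, _, _, _, _, rfl, hi⟩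

theorem Sub.rep_right {A : SType} {r : Option Role} {n : ℕ} {lab : Fin n → Label} {ar : Fin n → ℕ}
    {pay : (i : Fin n) → Fin (ar i) → SType} {k : Fin n → ℕ} {cont : Fin n → SType}
    (h : A.Sub (rep r n lab ar pay k cont)) (hA : A.muDepth = 0) :
    ∃ (n' : ℕ) (lab' : Fin n' → Label) (ar' : Fin n' → ℕ)
      (pay' : (i : Fin n') → Fin (ar' i) → SType) (k' : Fin n' → ℕ) (cont' : Fin n' → SType),
      A = rep r n' lab' ar' pay' k' cont' ∧ ∀ i, ∃ j, lab' i = lab j ∧ k' i = k j ∧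
        List.Forall₂ Sub (List.ofFn (pay' i)) (List.ofFn (pay j)) ∧ (cont' i).Sub (cont j) := by
  cases h.rule with
  | refl =>
    exact ⟨_, _, _, _, _, _, rfl, fun i => ⟨i, rfl, rfl, forall₂_ofFn_iff.2 fun _ => .refl _,
      .refl _⟩⟩
  | unfoldL => simp [muDepth] at hA
  | rep hi => exact ⟨_, _, _, _, _, _, rfl, hi⟩

theorem Sub.sel_right {A : SType} {n : ℕ} {tgt : Fin n → RoleE} {lab : Fin n → Label}
    {ar : Fin n → ℕ} {pay : (i : Fin n) → Fin (ar i) → SType} {rol : Fin n → List RoleE}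
    {cont : Fin n → SType} (h : A.Sub (sel n tgt lab ar pay rol cont)) (hA : A.muDepth = 0) :
    ∃ (n' : ℕ) (tgt' : Fin n' → RoleE) (lab' : Fin n' → Label) (ar' : Fin n' → ℕ)
      (pay' : (i : Fin n') → Fin (ar' i) → SType) (rol' : Fin n' → List RoleE)
      (cont' : Fin n' → SType),
      A = sel n' tgt' lab' ar' pay' rol' cont' ∧ ∀ j, ∃ i, tgt' i = tgt j ∧ lab' i = lab j ∧
        rol' i = rol j ∧ List.Forall₂ Sub (List.ofFn (pay j)) (List.ofFn (pay' i)) ∧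
        (cont' i).Sub (cont j) := by
  cases h.rule with
  | refl =>
    exact ⟨_, _, _, _, _, _, _, rfl, fun i => ⟨i, rfl, rfl, rfl,
      forall₂_ofFn_iff.2 fun _ => .refl _, .refl _⟩⟩
  | unfoldL => simp [muDepth] at hA
  | sel hi => exact ⟨_, _, _, _, _, _, _, rfl, hi⟩

end SType

/-! ### Runtime types as multisets of head normal forms -/

open Classical in
/-- The multiset with the head normal form of `S`, unless this is `end`. -/
noncomputable def SType.comp (S : SType) : Multiset SType := if S.nf = .fin then 0 else {S.nf}

theorem SType.comp_of_fin {S : SType} (h : S.nf = .fin) : S.comp = 0 := if_pos h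

theorem SType.comp_of_ne {S : SType} (h : S.nf ≠ .fin) : S.comp = {S.nf} := if_neg h

@[simp] theorem SType.comp_fin : SType.fin.comp = 0 := comp_of_fin nf_fin

theorem SType.Nrm.comp_eq {S : SType} (h : S.Nrm) : S.comp = {S} := by
  have := comp_of_ne (S := S) (by rw [h.nf_eq]; exact h.2.2)
  rwa [h.nf_eq] at this

theorem SType.comp_mu {S : SType} (h : (mu S).WF) : (mu S).comp = S.unfold.comp := by
  unfold comp
  rw [nf_mu h]

theorem SType.comp_rsubst (S : SType) (σ : ℕ → RoleE) :
    (S.rsubst σ).comp = S.comp.map (SType.rsubst σ) := by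
  by_cases h : S.nf = .fin
  · rw [comp_of_fin h, comp_of_fin (by rw [nf_rsubst, h]; rfl)]; rfl
  · rw [comp_of_ne h, comp_of_ne (by rwa [nf_rsubst, ne_eq, rsubst_eq_fin]), nf_rsubst]; rfl

theorem SType.mem_comp {S A : SType} : A ∈ S.comp ↔ A = S.nf ∧ A ≠ .fin := by
  by_cases h : S.nf = .fin
  · rw [comp_of_fin h, h]; simp
  · rw [comp_of_ne h, Multiset.mem_singleton]
    constructor
    · rintro rfl; exact ⟨rfl, h⟩
    · exact And.left

namespace RType

/-- The components of a runtime type. -/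
noncomputable def comps : RType → Multiset SType
  | one S => S.comp
  | par U V => U.comps + V.comps

theorem comps_rsubst (U : RType) (σ : ℕ → RoleE) :
    (U.rsubst σ).comps = U.comps.map (SType.rsubst σ) := by
  induction U with
  | one S => exact S.comp_rsubst σ
  | par U V ihU ihV => simp [rsubst, comps, ihU, ihV]

theorem wf_iff_comps (U : RType) : U.WF ↔ ∀ S ∈ U.comps, S.WF := by
  induction U with
  | one S =>
    simp only [WF, comps, SType.mem_comp]
    constructor
    · rintro h _ ⟨rfl, -⟩; exact h.nf
    · intro h
      by_cases hf : S.nf = .fin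
      · rw [← SType.nf_wf_iff, hf]; trivial
      · exact (SType.nf_wf_iff S).1 (h _ ⟨rfl, hf⟩)
  | par U V ihU ihV =>
    simp only [WF, comps, Multiset.mem_add, ihU, ihV]
    constructor
    · rintro ⟨h, h'⟩ S (hS | hS)
      exacts [h S hS, h' S hS]
    · exact fun h => ⟨fun S hS => h S (Or.inl hS), fun S hS => h S (Or.inr hS)⟩

/-- The laws of parallel composition become those of multiset addition with zero, and a well-formed
recursive type has the head normal form of its unfolding. -/
theorem Cong.comps_eq {U V : RType} (h : Cong U V) : U.comps = V.comps := by
  induction h with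
  | refl => rfl
  | symm _ ih => exact ih.symm
  | trans _ _ ih ih' => exact ih.trans ih'
  | congr _ _ ih ih' => simp [comps, ih, ih']
  | comm => exact add_comm _ _
  | assoc => exact add_assoc _ _ _
  | unit => simp [comps]
  | unfold S h => exact SType.comp_mu h

/-- The parallel composition of a list of session types. -/
def ofList : List SType → RType
  | [] => one .fin
  | S :: l => par (one S) (ofList l)

theorem cong_nf (S : SType) : Cong (one S) (one S.nf) := by
  by_cases h : S.WF
  · refine SType.WF.unfold_induction (p := fun S => Cong (one S) (one S.nf)) ?_ ?_ h
    · intro S _ h0; rw [SType.nf_of_muDepth h0]; exact .refl _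
    · intro S hS ih; rw [SType.nf_mu hS]; exact (Cong.unfold S hS).trans ih
  · rw [SType.nf, if_neg h]; exact .refl _

theorem ofList_append (l l' : List SType) :
    Cong (ofList (l ++ l')) (par (ofList l) (ofList l')) := by
  induction l with
  | nil => exact ((Cong.comm _ _).trans (.unit _)).symm
  | cons S l ih => exact (Cong.congr (.refl _) ih).trans (Cong.assoc _ _ _).symm

theorem ofList_perm {l l' : List SType} (h : l.Perm l') : Cong (ofList l) (ofList l') := by
  induction h with
  | nil => exact .refl _
  | cons S _ ih => exact .congr (.refl _) ih
  | swap S T l =>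
    exact ((Cong.assoc _ _ _).symm.trans (.congr (.comm _ _) (.refl _))).trans (.assoc _ _ _)
  | trans _ _ ih ih' => exact ih.trans ih'

theorem exists_cong_ofList (U : RType) : ∃ l : List SType, ↑l = U.comps ∧ Cong U (ofList l) := by
  induction U with
  | one S =>
    by_cases h : S.nf = .fin
    · refine ⟨[], (SType.comp_of_fin h).symm, ?_⟩
      have := cong_nf S
      rwa [h] at this
    · exact ⟨[S.nf], (SType.comp_of_ne h).symm, (cong_nf S).trans (Cong.unit _).symm⟩
  | par U V ihU ihV =>
    obtain ⟨l, hl, hU⟩ := ihU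
    obtain ⟨l', hl', hV⟩ := ihV
    refine ⟨l ++ l', ?_, (hU.congr hV).trans (ofList_append l l').symm⟩
    rw [← Multiset.coe_add, hl, hl']; rfl

/-- Every runtime type is congruent to the parallel composition of a list of its components, and two
lists with the same multiset are permutations of each other. -/
theorem cong_iff (U V : RType) : Cong U V ↔ U.comps = V.comps := by
  refine ⟨Cong.comps_eq, fun h => ?_⟩
  obtain ⟨l, hl, hU⟩ := exists_cong_ofList U
  obtain ⟨l', hl', hV⟩ := exists_cong_ofList V
  have : l.Perm l' := Multiset.coe_eq_coe.1 (hl.trans (h.trans hl'.symm))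
  exact (hU.trans (ofList_perm this)).trans hV.symm

theorem cong_fin_iff (U : RType) : Cong U (one .fin) ↔ U.comps = 0 := by
  rw [cong_iff]; simp [comps]

/-- The condition is weaker than `Nrm`: an ill-formed type equals its own `nf`. It is exactly what
holds of all components, by `nf_of_mem_comps`. -/
theorem exists_comps_eq (m : Multiset SType) (h : ∀ S ∈ m, S.nf = S ∧ S ≠ .fin) :
    ∃ U : RType, U.comps = m := by
  induction m using Multiset.induction with
  | empty => exact ⟨one .fin, SType.comp_fin⟩
  | cons S m ih =>
    obtain ⟨U, hU⟩ := ih fun S hS => h S (Multiset.mem_cons_of_mem hS)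
    have hS := h S (Multiset.mem_cons_self S m)
    refine ⟨par (one S) U, ?_⟩
    rw [comps, comps, SType.comp_of_ne (by rw [hS.1]; exact hS.2), hS.1, hU]; rfl

theorem nf_of_mem_comps {U : RType} {S : SType} (h : S ∈ U.comps) : S.nf = S ∧ S ≠ .fin := by
  induction U with
  | one T =>
    obtain ⟨rfl, h'⟩ := SType.mem_comp.1 h
    refine ⟨?_, h'⟩
    by_cases hT : T.WF
    · exact SType.nf_of_muDepth hT.muDepth_nf
    · have : T.nf = T := if_neg hT
      rw [this, this]
  | par U V ihU ihV =>
    rcases Multiset.mem_add.1 h with h | h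
    exacts [ihU h, ihV h]

end RType

/-! ### Linear contexts -/

/-- The components of the entry of a channel. -/
noncomputable def entComps : Option RType → Multiset SType
  | none => 0
  | some U => U.comps

@[simp] theorem entComps_parEntry (u v : Option RType) :
    entComps (parEntry u v) = entComps u + entComps v := by
  cases u <;> cases v <;> simp [parEntry, entComps, RType.comps]

theorem entComps_map_rsubst (u : Option RType) (σ : ℕ → RoleE) :
    entComps (u.map (RType.rsubst σ)) = (entComps u).map (SType.rsubst σ) := by
  cases u
  · rfl
  · exact RType.comps_rsubst _ σ

/-- An entry of type `end` and an absent entry have the same components, so presence must be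
recorded separately. This is why domains accompany linear contexts. -/
theorem congEntry_iff (u v : Option RType) :
    CongEntry u v ↔ (u = none ↔ v = none) ∧ entComps u = entComps v := by
  cases u <;> cases v <;> simp [CongEntry, entComps, RType.cong_iff]

/-- Linear contexts: the components of the types of the channels. -/
abbrev LCtx := Multiset (Chan × SType)

namespace LCtx

open Classical in
/-- The components of the type of a channel. -/
noncomputable def at' (L : LCtx) (c : Chan) : Multiset SType :=
  (L.filter (fun x => x.1 = c)).map Prod.snd

@[simp] theorem at_zero (c : Chan) : at' 0 c = 0 := rfl

@[simp] theorem at_add (L L' : LCtx) (c : Chan) : at' (L + L') c = L.at' c + L'.at' c := by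
  simp [at']

open Classical in
theorem at_cons (x : Chan × SType) (L : LCtx) (c : Chan) :
    at' (x ::ₘ L) c = (if x.1 = c then {x.2} else 0) + L.at' c := by
  by_cases h : x.1 = c <;> simp [at', h]

theorem at_sum {ι : Type} (s : Finset ι) (L : ι → LCtx) (c : Chan) :
    at' (∑ i ∈ s, L i) c = ∑ i ∈ s, (L i).at' c := by
  classical
  induction s using Finset.induction with
  | empty => simp
  | insert i s hi ih => simp [Finset.sum_insert hi, ih]

theorem mem_at {L : LCtx} {c : Chan} {S : SType} : S ∈ L.at' c ↔ (c, S) ∈ L := by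
  simp [at']

theorem ext_at {L L' : LCtx} (h : ∀ c, L.at' c = L'.at' c) : L = L' := by
  classical
  have key : ∀ (L : LCtx) c S, L.count (c, S) = (L.at' c).count S := by
    intro L c S
    induction L using Multiset.induction with
    | empty => rfl
    | cons x L ih =>
      obtain ⟨c', S'⟩ := x
      rw [at_cons, Multiset.count_add, Multiset.count_cons, ih, add_comm]
      by_cases hc : c' = c
      · subst hc; by_cases hS : S' = S
        · subst hS; simp
        · simp [Ne.symm hS]
      · simp [hc, Ne.symm hc]
  ext ⟨c, S⟩
  rw [key, key, h]

theorem at_map {f : Chan → Chan} (hf : Function.Injective f) (g : SType → SType) (L : LCtx)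
    (c : Chan) : at' (L.map (Prod.map f g)) (f c) = (L.at' c).map g := by
  classical
  induction L using Multiset.induction with
  | empty => rfl
  | cons x L ih =>
    rw [Multiset.map_cons, at_cons, at_cons, ih, Multiset.map_add]
    by_cases h : x.1 = c
    · simp [h]
    · have : f x.1 ≠ f c := fun e => h (hf e)
      simp [h, this]

theorem at_map_of_notMem {f : Chan → Chan} (g : SType → SType) (L : LCtx) {c : Chan}
    (hc : c ∉ Set.range f) : at' (L.map (Prod.map f g)) c = 0 := by
  rw [Multiset.eq_zero_iff_forall_notMem]
  intro S hS
  rw [mem_at, Multiset.mem_map] at hS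
  obtain ⟨x, -, hx⟩ := hS
  exact hc ⟨x.1, congrArg Prod.fst hx⟩

open Classical in
theorem at_map_mk (m : Multiset SType) (c c' : Chan) :
    at' (m.map (Prod.mk c)) c' = if c = c' then m else 0 := by
  induction m using Multiset.induction with
  | empty => simp
  | cons S m ih =>
    rw [Multiset.map_cons, at_cons, ih]
    by_cases h : c = c' <;> simp [h]

/-- The linear context `c : S`. -/
noncomputable def ent (c : Chan) (S : SType) : LCtx := S.comp.map (Prod.mk c)

open Classical in
theorem at_ent (c c' : Chan) (S : SType) : at' (ent c S) c' = if c = c' then S.comp else 0 :=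
  at_map_mk _ _ _

theorem ent_map (c : Chan) (S : SType) (f : Chan → Chan) (σ : ℕ → RoleE) :
    (ent c S).map (Prod.map f (SType.rsubst σ)) = ent (f c) (S.rsubst σ) := by
  simp [ent, SType.comp_rsubst, Multiset.map_map]

/-- The linear context of the innermost channel variables. -/
noncomputable def entFn {n : ℕ} (S : Fin n → SType) : LCtx := ∑ j : Fin n, ent (.var j) (S j)

end LCtx

namespace Ctx

@[ext] theorem ext {Γ Δ : Ctx} (h : ∀ c, Γ.ch c = Δ.ch c) (h' : Γ.ro = Δ.ro) : Γ = Δ := by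
  cases Γ; cases Δ
  simp only [mk.injEq] at *
  exact ⟨funext h, h'⟩

/-- The channels of a context. -/
def dom (Γ : Ctx) : Set Chan := {c | Γ.ch c ≠ none}

theorem mem_dom {Γ : Ctx} {c : Chan} : c ∈ Γ.dom ↔ Γ.ch c ≠ none := Iff.rfl

@[simp] theorem dom_add (Γ Δ : Ctx) : (Γ.add Δ).dom = Γ.dom ∪ Δ.dom := by
  ext c
  simp only [mem_dom, add, Set.mem_union]
  cases Γ.ch c <;> cases Δ.ch c <;> simp [parEntry]

/-- `L` lists the components of the types of the context. -/
def Lists (Γ : Ctx) (L : LCtx) : Prop := ∀ c, L.at' c = entComps (Γ.ch c)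

theorem Lists.unique {Γ : Ctx} {L L' : LCtx} (h : Γ.Lists L) (h' : Γ.Lists L') : L = L' :=
  LCtx.ext_at fun c => (h c).trans (h' c).symm

theorem Lists.add {Γ Γ' : Ctx} {L L' : LCtx} (h : Γ.Lists L) (h' : Γ'.Lists L') :
    (Γ.add Γ').Lists (L + L') := fun c => by
  rw [LCtx.at_add, h c, h' c]; exact (entComps_parEntry _ _).symm

theorem cong_iff (Γ Δ : Ctx) :
    Γ.Cong Δ ↔ Γ.ro = Δ.ro ∧ Γ.dom = Δ.dom ∧ ∀ c, entComps (Γ.ch c) = entComps (Δ.ch c) := by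
  simp only [Cong, congEntry_iff, forall_and, Set.ext_iff, mem_dom, not_iff_not, ne_eq]

theorem Cong.lists {Γ Δ : Ctx} (h : Γ.Cong Δ) {L : LCtx} (hL : Δ.Lists L) : Γ.Lists L := fun c =>
  (hL c).trans (((cong_iff Γ Δ).1 h).2.2 c).symm

theorem Cong.lists' {Γ Δ : Ctx} (h : Γ.Cong Δ) {L : LCtx} (hL : Γ.Lists L) : Δ.Lists L := fun c =>
  (hL c).trans (((cong_iff Γ Δ).1 h).2.2 c)

theorem Lists.cong {Γ Δ : Ctx} {L : LCtx} (h : Γ.Lists L) (h' : Δ.Lists L) (hr : Γ.ro = Δ.ro)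
    (hd : Γ.dom = Δ.dom) : Γ.Cong Δ :=
  (cong_iff Γ Δ).2 ⟨hr, hd, fun c => (h c).symm.trans (h' c)⟩

theorem end_iff_lists (Γ : Ctx) : Γ.End ↔ Γ.Lists 0 := by
  constructor
  · intro h c
    rcases hc : Γ.ch c with _ | U
    · rfl
    · exact ((RType.cong_fin_iff U).1 (h c U hc)).symm
  · intro h c U hc
    have := h c
    rw [hc] at this
    exact (RType.cong_fin_iff U).2 this.symm

theorem exists_lists {Γ : Ctx} (h : Γ.dom.Finite) : ∃ L, Γ.Lists L := by
  classical
  refine ⟨∑ c ∈ h.toFinset, (entComps (Γ.ch c)).map (Prod.mk c), fun c => ?_⟩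
  rw [LCtx.at_sum]
  simp only [LCtx.at_map_mk, Finset.sum_ite_eq', Set.Finite.mem_toFinset, mem_dom]
  split
  · rfl
  · rename_i hc
    rw [not_not.1 hc]; rfl

theorem wf_iff {Γ : Ctx} {L : LCtx} (hL : Γ.Lists L) :
    Γ.WF ↔ Γ.dom.Finite ∧ ∀ x ∈ L, x.2.WF := by
  have key : (∀ c U, Γ.ch c = some U → U.WF) ↔ ∀ x ∈ L, x.2.WF := by
    constructor
    · rintro h ⟨c, S⟩ hx
      rw [← LCtx.mem_at, hL c] at hx
      rcases hc : Γ.ch c with _ | U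
      · rw [hc] at hx; simp [entComps] at hx
      · rw [hc] at hx; exact (RType.wf_iff_comps U).1 (h c U hc) S hx
    · intro h c U hc
      rw [RType.wf_iff_comps]
      intro S hS
      refine h (c, S) ?_
      rw [← LCtx.mem_at, hL c, hc]
      exact hS
  unfold WF
  rw [key]; rfl

/-- Linear contexts that list the components of some context with domain `D`. -/
def _root_.MPSTBang.LCtx.Over (D : Set Chan) (L : LCtx) : Prop :=
  ∀ x ∈ L, x.1 ∈ D ∧ x.2.nf = x.2 ∧ x.2 ≠ .fin

theorem Lists.over {Γ : Ctx} {L : LCtx} (h : Γ.Lists L) : L.Over Γ.dom := by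
  rintro ⟨c, S⟩ hx
  rw [← LCtx.mem_at, h c] at hx
  rcases hc : Γ.ch c with _ | U
  · rw [hc] at hx; simp [entComps] at hx
  · rw [hc] at hx
    exact ⟨by simp [mem_dom, hc], RType.nf_of_mem_comps hx⟩

/-- A channel of `D` on which `L` has no component receives a type without components, that is, one
congruent to `end`. -/
theorem exists_of_over (A : Finset ℕ) {D : Set Chan} {L : LCtx} (h : L.Over D) :
    ∃ Γ : Ctx, Γ.ro = A ∧ Γ.dom = D ∧ Γ.Lists L := by
  classical
  have := fun c => RType.exists_comps_eq (L.at' c) fun S hS => (h _ (LCtx.mem_at.1 hS)).2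
  choose U hU using this
  refine ⟨⟨fun c => if c ∈ D then some (U c) else none, A⟩, rfl, ?_, ?_⟩
  · ext c; simp [mem_dom]
  · intro c
    by_cases hc : c ∈ D
    · simp [hc, entComps, hU]
    · simp only [hc, if_false, entComps]
      rw [Multiset.eq_zero_iff_forall_notMem]
      exact fun S hS => hc (h _ (LCtx.mem_at.1 hS)).1

/-- Listings are unique, so any listing of `Γ` is the sum of those of the parts. The domains of the
parts may be smaller, which `LTyped.mono` repairs later. -/
theorem Split.exists_lists {Γ Γ₁ Γ₂ : Ctx} (h : Γ.Split Γ₁ Γ₂) (hΓ : Γ.WF) :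
    Γ₁.WF ∧ Γ₂.WF ∧ Γ₁.dom ⊆ Γ.dom ∧ Γ₂.dom ⊆ Γ.dom ∧
      ∀ L, Γ.Lists L → ∃ L₁ L₂, Γ₁.Lists L₁ ∧ Γ₂.Lists L₂ ∧ L = L₁ + L₂ := by
  have hd := ((cong_iff _ _).1 h.2.2).2.1
  rw [dom_add] at hd
  have hs₁ : Γ₁.dom ⊆ Γ.dom := hd ▸ Set.subset_union_left
  have hs₂ : Γ₂.dom ⊆ Γ.dom := hd ▸ Set.subset_union_right
  have hf₁ := Set.Finite.subset hΓ.1 hs₁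
  have hf₂ := Set.Finite.subset hΓ.1 hs₂
  obtain ⟨L₁, h₁⟩ := Ctx.exists_lists hf₁
  obtain ⟨L₂, h₂⟩ := Ctx.exists_lists hf₂
  have hl := h.2.2.lists (h₁.add h₂)
  have hw := ((wf_iff hl).1 hΓ).2
  refine ⟨(wf_iff h₁).2 ⟨hf₁, fun x hx => hw x (by simp [hx])⟩,
    (wf_iff h₂).2 ⟨hf₂, fun x hx => hw x (by simp [hx])⟩, hs₁, hs₂, fun L hL => ?_⟩
  exact ⟨L₁, L₂, h₁, h₂, hL.unique hl⟩

theorem Lists.split {Γ Γ₁ Γ₂ : Ctx} {L₁ L₂ : LCtx} (h : Γ.Lists (L₁ + L₂)) (h₁ : Γ₁.Lists L₁)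
    (h₂ : Γ₂.Lists L₂) (hd : Γ.dom = Γ₁.dom ∪ Γ₂.dom) (hr₁ : Γ₁.ro = Γ.ro) (hr₂ : Γ₂.ro = Γ.ro) :
    Γ.Split Γ₁ Γ₂ :=
  ⟨hr₁, hr₂, h.cong (h₁.add h₂) (by simp only [Ctx.add, hr₁, hr₂, Finset.union_self])
    (by rw [hd, dom_add])⟩

/-- Both parts can be padded with `end` entries to the full domain. Hence linear typing may keep the
channels in scope fixed when it divides a multiset. -/
theorem Lists.exists_split {Γ : Ctx} {L₁ L₂ : LCtx} (h : Γ.Lists (L₁ + L₂)) :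
    ∃ Γ₁ Γ₂ : Ctx, Γ.Split Γ₁ Γ₂ ∧ Γ₁.Lists L₁ ∧ Γ₂.Lists L₂ ∧ Γ₁.dom = Γ.dom ∧
      Γ₂.dom = Γ.dom := by
  obtain ⟨Γ₁, hr₁, hd₁, h₁⟩ := exists_of_over Γ.ro (D := Γ.dom) (L := L₁)
    fun x hx => h.over x (by simp [hx])
  obtain ⟨Γ₂, hr₂, hd₂, h₂⟩ := exists_of_over Γ.ro (D := Γ.dom) (L := L₂)
    fun x hx => h.over x (by simp [hx])
  exact ⟨Γ₁, Γ₂, h.split h₁ h₂ (by rw [hd₁, hd₂, Set.union_self]) hr₁ hr₂, h₁, h₂, hd₁, hd₂⟩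

/-! ### Domains and components of the operations on contexts -/

theorem lists_of_none {Γ : Ctx} (h : ∀ c, Γ.ch c = none) : Γ.Lists 0 := fun c => by
  rw [h c]; rfl

theorem entry_ch (c c' : Chan) (S : SType) (A : Finset ℕ) [Decidable (c = c')] :
    (entry c S A).ch c' = if c = c' then some (.one S) else none := by
  cases c <;> cases c' <;> simp [entry]

theorem entry_lists (c : Chan) (S : SType) (A : Finset ℕ) : (entry c S A).Lists (LCtx.ent c S) := by
  classical
  intro c'
  rw [LCtx.at_ent, entry_ch]
  by_cases h : c = c' <;> simp [h, entComps, RType.comps]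

@[simp] theorem dom_entry (c : Chan) (S : SType) (A : Finset ℕ) : (entry c S A).dom = {c} := by
  classical
  ext c'
  rw [mem_dom, entry_ch]
  by_cases h : c = c'
  · simp [h]
  · simp [h, Ne.symm h]

theorem single_lists (c : Chan) (S : SType) : (single c S).Lists (LCtx.ent c S) :=
  entry_lists c S ∅

@[simp] theorem dom_single (c : Chan) (S : SType) : (single c S).dom = {c} := dom_entry c S ∅

theorem binders_lists {n : ℕ} (S : Fin n → SType) : (binders S).Lists (LCtx.entFn S) := by
  classical
  intro c
  unfold LCtx.entFn
  rw [LCtx.at_sum]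
  simp only [LCtx.at_ent]
  cases c with
  | ep s q => simp [binders, entComps]
  | var x =>
    by_cases h : x < n
    · have : ∀ j : Fin n, (Chan.var j = Chan.var x) ↔ (j = ⟨x, h⟩) := fun j => by
        simp [Fin.ext_iff]
      simp [this, binders, h, entComps, RType.comps]
    · have : ∀ j : Fin n, ¬ (Chan.var j = Chan.var x) := fun j e => by
        have := j.2; simp at e; omega
      simp [this, binders, h, entComps]

theorem dom_binders {n : ℕ} (S : Fin n → SType) :
    (binders S).dom = {c | ∃ x < n, c = .var x} := by
  ext c
  cases c with
  | ep s q => simp [mem_dom, binders]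
  | var x => simp [mem_dom, binders]

theorem roles_lists (k : ℕ) : (roles k).Lists 0 := lists_of_none fun _ => rfl

@[simp] theorem dom_roles (k : ℕ) : (roles k).dom = ∅ := by
  ext c; simp [mem_dom, roles]

/-- Injectivity of `f` keeps the components of distinct channels apart. Weakening by variables, by
roles or by a session, and instantiation of roles, are all of this form. -/
theorem Lists.map {Γ Γ' : Ctx} {L : LCtx} (h : Γ.Lists L) {f : Chan → Chan}
    (hf : Function.Injective f) (σ : ℕ → RoleE)
    (h₁ : ∀ c, Γ'.ch (f c) = (Γ.ch c).map (RType.rsubst σ))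
    (h₂ : ∀ c, c ∉ Set.range f → Γ'.ch c = none) :
    Γ'.Lists (L.map (Prod.map f (SType.rsubst σ))) := by
  intro c
  by_cases hc : c ∈ Set.range f
  · obtain ⟨c, rfl⟩ := hc
    rw [LCtx.at_map hf, h c, h₁, entComps_map_rsubst]
  · rw [LCtx.at_map_of_notMem _ _ hc, h₂ c hc]; rfl

end Ctx

/-! ### Weakening of contexts and scopes under binders -/

@[simp] theorem RType.rsubst_var (U : RType) : U.rsubst .var = U := by
  induction U with
  | one S => simp [rsubst]
  | par U V ihU ihV => simp [rsubst, ihU, ihV]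

theorem Chan.shift_injective (n : ℕ) : Function.Injective (Chan.shift n) := by
  intro c c' h
  cases c <;> cases c' <;> simp_all [Chan.shift]

theorem Chan.renSess_injective {f : ℕ → ℕ} (hf : Function.Injective f) :
    Function.Injective (Chan.renSess f) := by
  intro c c' h
  cases c <;> cases c' <;> simp_all [Chan.renSess, hf.eq_iff]

/-- Weakening of a linear context by `n` channel variables and `k` role variables. -/
def LCtx.up (n k : ℕ) (L : LCtx) : LCtx := L.map (Prod.map (Chan.shift n) (SType.rshift k))

/-- Renaming of the sessions of a linear context. -/
def LCtx.renSess (f : ℕ → ℕ) (L : LCtx) : LCtx := L.map (Prod.map (Chan.renSess f) id)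

theorem Ctx.lift_ch_shift (Γ : Ctx) (n k : ℕ) (c : Chan) :
    (Γ.lift n k).ch (c.shift n) = (Γ.ch c).map (RType.rshift k) := by
  cases c <;> simp [Ctx.lift, Chan.shift]

theorem Ctx.lift_ch_of_notMem (Γ : Ctx) (n k : ℕ) (c : Chan) (hc : c ∉ Set.range (Chan.shift n)) :
    (Γ.lift n k).ch c = none := by
  cases c with
  | ep s q => exact absurd ⟨.ep s q, rfl⟩ hc
  | var x =>
    by_cases hx : x < n
    · simp [Ctx.lift, hx]
    · refine absurd ⟨.var (x - n), ?_⟩ hc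
      simp only [Chan.shift, Chan.var.injEq]; omega

theorem Ctx.Lists.lift {Γ : Ctx} {L : LCtx} (h : Γ.Lists L) (n k : ℕ) :
    (Γ.lift n k).Lists (L.up n k) :=
  h.map (Chan.shift_injective n) _ (Γ.lift_ch_shift n k) (Γ.lift_ch_of_notMem n k)

theorem Ctx.Lists.liftSess {Γ : Ctx} {L : LCtx} (h : Γ.Lists L) :
    Γ.liftSess.Lists (L.renSess (· + 1)) := by
  have := h.map (Γ' := Γ.liftSess) (Chan.renSess_injective (add_left_injective 1)) RoleE.var
    (fun c => by
      have : RType.rsubst RoleE.var = id := funext RType.rsubst_var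
      cases c <;> simp [Ctx.liftSess, Chan.renSess, this])
    (fun c hc => by
      cases c with
      | var x => exact absurd ⟨.var x, rfl⟩ hc
      | ep s q =>
        cases s with
        | zero => rfl
        | succ s => exact absurd ⟨.ep s q, rfl⟩ hc)
  have e : SType.rsubst RoleE.var = id := funext SType.rsubst_var
  rwa [e] at this

/-- The channels in scope under `n` channel binders. -/
def upDom (n : ℕ) (D : Set Chan) : Set Chan :=
  {c | match c with
    | .ep s q => Chan.ep s q ∈ D
    | .var x => x < n ∨ Chan.var (x - n) ∈ D}

/-- The role variables in scope under `k` role binders. -/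
def upRoles (k : ℕ) (A : Set ℕ) : Set ℕ := {a | a < k ∨ a - k ∈ A}

/-- The channels in scope under a session binder. -/
def nuDom (Ψ : Protocol) (D : Set Chan) : Set Chan :=
  {c | match c with
    | .ep 0 q => Ψ q ≠ none
    | .ep (s + 1) q => Chan.ep s q ∈ D
    | .var x => Chan.var x ∈ D}

theorem shift_mem_upDom {n : ℕ} {D : Set Chan} {c : Chan} : c.shift n ∈ upDom n D ↔ c ∈ D := by
  cases c <;> simp [upDom, Chan.shift]

theorem Ctx.dom_lift_union (Γ : Ctx) (n k : ℕ) :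
    (Γ.lift n k).dom ∪ {c | ∃ x < n, c = .var x} = upDom n Γ.dom := by
  ext c
  cases c with
  | ep s q => simp [Ctx.mem_dom, Ctx.lift, upDom]
  | var x =>
    by_cases h : x < n <;> simp [Ctx.mem_dom, Ctx.lift, upDom, h]

theorem Ctx.dom_liftSess_add (Γ : Ctx) (Ψ : Protocol) :
    (Γ.liftSess.add Ψ.assoc).dom = nuDom Ψ Γ.dom := by
  rw [Ctx.dom_add]
  ext c
  rcases c with ⟨_ | s, q⟩ | x <;>
    simp [Ctx.mem_dom, Ctx.liftSess, Protocol.assoc, nuDom]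

theorem upDom_mono {n : ℕ} {D D' : Set Chan} (h : D ⊆ D') : upDom n D ⊆ upDom n D' := by
  rintro (⟨s, q⟩ | x) hc
  · exact h hc
  · exact hc.imp id fun hc => h hc

theorem upRoles_coe (A : Finset ℕ) (k : ℕ) :
    (↑(A.image (· + k) ∪ Finset.range k) : Set ℕ) = upRoles k ↑A := by
  ext a
  simp only [Finset.coe_union, Finset.coe_image, Finset.coe_range, Set.mem_union, Set.mem_image,
    SetLike.mem_coe, Set.mem_Iio, upRoles, Set.mem_ofPred_eq]
  constructor
  · rintro (⟨b, hb, rfl⟩ | h)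
    · right; simpa using hb
    · exact Or.inl h
  · rintro (h | h)
    · exact Or.inr h
    · by_cases h' : a < k
      · exact Or.inr h'
      · exact Or.inl ⟨a - k, h, by omega⟩

/-! ### Typing with linear contexts -/

/-- All role variables of `ρ` belong to `A`. -/
def RoleE.In (A : Set ℕ) (ρ : RoleE) : Prop := ∀ a, ρ = .var a → a ∈ A

/-- Typing of a channel: `L` holds its only component, or nothing if it is typed by `end`. -/
def ChanTyped (D : Set Chan) (L : LCtx) (c : Chan) (S : SType) : Prop :=
  c ∈ D ∧ S.WF ∧ ((∃ S', S'.Nrm ∧ S'.Sub S ∧ L = {(c, S')}) ∨ S.nf = .fin ∧ L = 0)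

/-- Typing of a list of channels, using up the linear context. -/
inductive ChansTyped (D : Set Chan) : LCtx → List Chan → List SType → Prop
  | nil : ChansTyped D 0 [] []
  | cons {L₁ L₂ : LCtx} {c : Chan} {S : SType} {cs : List Chan} {Ss : List SType} :
      ChanTyped D L₁ c S → ChansTyped D L₂ cs Ss → ChansTyped D (L₁ + L₂) (c :: cs) (S :: Ss)

/-- Typing of processes by a linear context, given the role variables `A` and the channels `D` in
scope. -/
def LTyped : Proc → PCtx → Set ℕ → Set Chan → LCtx → Prop
  | .nil, _, _, _, L => L = 0
  | .par P Q, Θ, A, D, L => ∃ L₁ L₂, L = L₁ + L₂ ∧ LTyped P Θ A D L₁ ∧ LTyped Q Θ A D L₂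
  | .nu P, Θ, A, D, L => ∃ (Ψ : Protocol) (φ : Ctx → Prop) (K : LCtx),
      Ψ.WF ∧ IsSafety φ ∧ φ Ψ.assoc ∧ Ψ.assoc.Lists K ∧
        LTyped P Θ A (nuDom Ψ D) (L.renSess (· + 1) + K)
  | .sum n c ρ m V W P, Θ, A, D, L => 0 < n ∧ ∀ i, ∃ (L₀ L₁ L₂ : LCtx) (a : ℕ)
      (pay : Fin a → SType) (S : SType), L = L₀ + L₁ + L₂ ∧
        ChansTyped D L₁ (V i) (List.ofFn pay) ∧ (∀ ρ' ∈ W i, ρ'.In A) ∧ (ρ i).In A ∧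
        ChanTyped D L₂ (c i) (.sel 1 (fun _ => ρ i) (fun _ => m i) (fun _ => a) (fun _ => pay)
          (fun _ => W i) (fun _ => S)) ∧
        LTyped (P i) Θ A D (L₀ + LCtx.ent (c i) S)
  | .rcv c ρ n m nx k P, Θ, A, D, L => ∃ (L₀ L₁ : LCtx) (pay : (i : Fin n) → Fin (nx i) → SType)
      (S : Fin n → SType), L = L₀ + L₁ ∧ ChanTyped D L₁ c (.bra ρ n m nx pay k S) ∧ ρ.In A ∧
        ∀ i, LTyped (P i) (Θ.rshift (k i)) (upRoles (k i) A) (upDom (nx i) D)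
          (L₀.up (nx i) (k i) + LCtx.ent (c.shift (nx i)) (S i) + LCtx.entFn (pay i))
  | .rep c r n m nx k P, Θ, A, D, L => ∃ (pay : (i : Fin n) → Fin (nx i) → SType)
      (S : Fin n → SType), ChanTyped D L c (.rep r n m nx pay k S) ∧
        ∀ i, LTyped (P i) (Θ.rshift (repDepth r (k i))) (upRoles (repDepth r (k i)) A)
          (upDom (nx i) D) (LCtx.ent (c.shift (nx i)) (S i) + LCtx.entFn (pay i))
  | .defn k P Q, Θ, A, D, L => ∃ S : Fin k → SType, (∀ i, (S i).WF) ∧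
      LTyped P (Θ.cons (List.ofFn S)) A (upDom k D) (LCtx.entFn S) ∧
      LTyped Q (Θ.cons (List.ofFn S)) A D L
  | .call X c, Θ, _, D, L => ∃ Ss, Θ X = some Ss ∧ ChansTyped D L c Ss

/-! ### Instances of linear contexts -/

/-- `L'` is the image of `L` under the substitution, up to subtyping. -/
def LCtx.Inst (σ : Subst) : LCtx → LCtx → Prop :=
  Multiset.Rel fun x y => x.1 = y.1.subst σ ∧ (y.2.Nrm → x.2.Nrm) ∧ x.2.Sub (y.2.rsubst σ.ro)

namespace LCtx

theorem Inst.add {σ : Subst} {L₁ L₂ L₁' L₂' : LCtx} (h : Inst σ L₁' L₁) (h' : Inst σ L₂' L₂) :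
    Inst σ (L₁' + L₂') (L₁ + L₂) := Multiset.Rel.add h h'

theorem Inst.exists_add {σ : Subst} {L' L₁ L₂ : LCtx} (h : Inst σ L' (L₁ + L₂)) :
    ∃ L₁' L₂', L' = L₁' + L₂' ∧ Inst σ L₁' L₁ ∧ Inst σ L₂' L₂ := by
  obtain ⟨L₁', L₂', h₁, h₂, e⟩ := Multiset.rel_add_right.1 h
  exact ⟨L₁', L₂', e, h₁, h₂⟩

theorem Inst.zero (σ : Subst) : Inst σ 0 0 := Multiset.Rel.zero

theorem Inst.eq_zero {σ : Subst} {L' : LCtx} (h : Inst σ L' 0) : L' = 0 :=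
  Multiset.rel_zero_right.1 h

theorem inst_map (σ : Subst) (L : LCtx) :
    Inst σ (L.map (Prod.map (Chan.subst σ) (SType.rsubst σ.ro))) L := by
  refine Multiset.rel_map_left.2 (Multiset.rel_refl_of_refl_on fun x _ => ?_)
  exact ⟨rfl, fun h => (SType.nrm_rsubst _ _).2 h, .refl _⟩

theorem inst_ent (σ : Subst) (c : Chan) (S : SType) :
    Inst σ (ent (c.subst σ) (S.rsubst σ.ro)) (ent c S) := by
  rw [← ent_map]; exact inst_map σ _

/-- By `Sub.nf_eq_fin_iff` both entries are empty or both have one component, and in the latter case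
the head normal forms are again related. -/
theorem inst_ent_sub {σ : Subst} (c : Chan) {S S' : SType} (hS : S.WF) (hS' : S'.WF)
    (h : S'.Sub (S.rsubst σ.ro)) : Inst σ (ent (c.subst σ) S') (ent c S) := by
  have hw : (S.rsubst σ.ro).WF := (SType.wf_rsubst _ _).2 hS
  have hf := h.nf_eq_fin_iff hS' hw
  rw [SType.nf_rsubst, SType.rsubst_eq_fin] at hf
  by_cases e : S.nf = .fin
  · rw [ent, ent, SType.comp_of_fin e, SType.comp_of_fin (hf.2 e)]
    exact Inst.zero σ
  · have e' : S'.nf ≠ .fin := fun h => e (hf.1 h)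
    rw [ent, ent, SType.comp_of_ne e, SType.comp_of_ne e', Multiset.map_singleton,
      Multiset.map_singleton]
    have h' := h.nf hS' hw
    rw [SType.nf_rsubst] at h'
    exact Multiset.Rel.cons ⟨rfl, fun _ => hS'.nrm_nf e', h'⟩ .zero

theorem Inst.map {σ σ' : Subst} {L L' : LCtx} (h : Inst σ L' L) {f : Chan → Chan}
    {g : SType → SType} (hf : ∀ c, (f c).subst σ' = f (c.subst σ))
    (hn : ∀ S, (g S).Nrm ↔ S.Nrm) (hg : ∀ S S' : SType, S'.Sub (S.rsubst σ.ro) →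
      (g S').Sub ((g S).rsubst σ'.ro)) :
    Inst σ' (L'.map (Prod.map f g)) (L.map (Prod.map f g)) := by
  refine Multiset.rel_map.2 (h.mono ?_)
  rintro ⟨c', S'⟩ - ⟨c, S⟩ - ⟨h₁, h₂, h₃⟩
  simp only at h₁ h₂ h₃
  exact ⟨by simp [h₁, hf], by simpa [hn] using h₂, hg _ _ h₃⟩

end LCtx

theorem Chan.shift_subst_lift (c : Chan) (σ : Subst) (n k : ℕ) :
    (c.shift n).subst (σ.lift n k) = (c.subst σ).shift n := by
  cases c with
  | ep s q => rfl
  | var x => simp [Chan.shift, Chan.subst, Subst.lift]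

theorem Chan.renSess_subst_liftSess (c : Chan) (σ : Subst) :
    (c.renSess (· + 1)).subst σ.liftSess = (c.subst σ).renSess (· + 1) := by
  cases c with
  | ep s q => simp [Chan.renSess, Chan.subst, Subst.liftSess, liftIdx]
  | var x => rfl

theorem LCtx.Inst.up {σ : Subst} {L L' : LCtx} (h : LCtx.Inst σ L' L) (n k : ℕ) :
    LCtx.Inst (σ.lift n k) (L'.up n k) (L.up n k) := by
  refine h.map (fun c => c.shift_subst_lift σ n k) (fun S => SType.nrm_rsubst S _) ?_
  intro S S' hS
  have := hS.rshift k
  rwa [← SType.rshift_rsubst_liftRo] at this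

theorem LCtx.Inst.renSess_succ {σ : Subst} {L L' : LCtx} (h : LCtx.Inst σ L' L) :
    LCtx.Inst σ.liftSess (L'.renSess (· + 1)) (L.renSess (· + 1)) :=
  h.map (fun c => c.renSess_subst_liftSess σ) (fun _ => Iff.rfl) fun _ _ hS => hS

/-- The new component is below the image of the old one, which is below the image of `S`. The middle
type of this transitivity is well-formed because components that type a channel satisfy `Nrm`. -/
theorem LCtx.Inst.chanTyped {σ : Subst} {D D' : Set Chan} {L L' : LCtx} {c : Chan} {S : SType}
    (h : LCtx.Inst σ L' L) (hD : ∀ c ∈ D, c.subst σ ∈ D') (hc : ChanTyped D L c S) :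
    ChanTyped D' L' (c.subst σ) (S.rsubst σ.ro) := by
  obtain ⟨hcD, hw, ⟨S₀, hn, hs, rfl⟩ | ⟨hf, rfl⟩⟩ := hc
  · refine ⟨hD c hcD, (SType.wf_rsubst _ _).2 hw, Or.inl ?_⟩
    obtain ⟨⟨c', S'⟩, L₀, ⟨h₁, h₂, h₃⟩, h₀, rfl⟩ := Multiset.rel_cons_right.1 h
    simp only at h₁ h₂ h₃
    rw [Multiset.rel_zero_right] at h₀
    subst h₀ h₁
    exact ⟨S', h₂ hn, h₃.trans ((SType.wf_rsubst _ _).2 hn.1) (hs.rsubst _), rfl⟩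
  · refine ⟨hD c hcD, (SType.wf_rsubst _ _).2 hw, Or.inr ⟨?_, h.eq_zero⟩⟩
    rw [SType.nf_rsubst, hf]; rfl

theorem LCtx.Inst.chansTyped {σ : Subst} {D D' : Set Chan} {L : LCtx} {cs : List Chan}
    {Ss : List SType} (hD : ∀ c ∈ D, c.subst σ ∈ D') (hc : ChansTyped D L cs Ss) {L' : LCtx}
    (h : LCtx.Inst σ L' L) :
    ChansTyped D' L' (cs.map (Chan.subst σ)) (Ss.map (SType.rsubst σ.ro)) := by
  induction hc generalizing L' with
  | nil => rw [h.eq_zero]; exact .nil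
  | cons h₁ _ ih =>
    obtain ⟨L₁', L₂', rfl, hi₁, hi₂⟩ := h.exists_add
    exact .cons (hi₁.chanTyped hD h₁) (ih hi₂)

theorem LCtx.inst_entFn_lift (σ : Subst) (k : ℕ) {n : ℕ} (S : Fin n → SType) :
    LCtx.Inst (σ.lift n k) (LCtx.entFn fun j => (S j).rsubst (liftRo σ.ro k)) (LCtx.entFn S) := by
  unfold LCtx.entFn
  have : ∀ s : Finset (Fin n), LCtx.Inst (σ.lift n k)
      (∑ j ∈ s, LCtx.ent (.var j) ((S j).rsubst (liftRo σ.ro k)))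
      (∑ j ∈ s, LCtx.ent (.var j) (S j)) := by
    classical
    intro s
    induction s using Finset.induction with
    | empty => exact .zero _
    | insert j s hj ih =>
      rw [Finset.sum_insert hj, Finset.sum_insert hj]
      refine LCtx.Inst.add ?_ ih
      have := LCtx.inst_ent (σ.lift n k) (.var j) (S j)
      have e : (Chan.var j).subst (σ.lift n k) = .var j := by simp [Chan.subst, Subst.lift]
      rwa [e] at this
  exact this _

/-! ### The substitution lemma -/

/-- A substitution that maps well-scoped objects to well-scoped objects. -/
structure Subst.Maps (σ : Subst) (Θ Θ' : PCtx) (A A' : Set ℕ) (D D' : Set Chan) : Prop where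
  pv : ∀ X Ss, Θ X = some Ss → Θ' (σ.pv X) = some (Ss.map (SType.rsubst σ.ro))
  ro : ∀ a ∈ A, (σ.ro a).In A'
  ch : ∀ c ∈ D, c.subst σ ∈ D'

theorem RoleE.In.shift {A : Set ℕ} {ρ : RoleE} (h : ρ.In A) (k : ℕ) :
    (ρ.shift k).In (upRoles k A) := by
  intro a e
  cases ρ with
  | name q => cases e
  | var b =>
    simp only [RoleE.shift, RoleE.var.injEq] at e
    subst e
    right
    simpa using h b rfl

theorem RoleE.In.subst {A A' : Set ℕ} {ρ : RoleE} {σ : ℕ → RoleE} (h : ρ.In A)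
    (hσ : ∀ a ∈ A, (σ a).In A') : (ρ.subst σ).In A' := by
  cases ρ with
  | name q => intro a e; cases e
  | var b => exact hσ b (h b rfl)

theorem renSess_mem_nuDom {Ψ : Protocol} {D : Set Chan} {c : Chan} :
    c.renSess (· + 1) ∈ nuDom Ψ D ↔ c ∈ D := by
  cases c <;> rfl

namespace Subst.Maps

variable {σ : Subst} {Θ Θ' : PCtx} {A A' : Set ℕ} {D D' : Set Chan}

theorem lift_ch (h : ∀ c ∈ D, c.subst σ ∈ D') (n k : ℕ) :
    ∀ c ∈ upDom n D, c.subst (σ.lift n k) ∈ upDom n D' := by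
  rintro (⟨s, q⟩ | x) hc
  · exact h _ hc
  · by_cases hx : x < n
    · have : (Chan.var x).subst (σ.lift n k) = .var x := by simp [Chan.subst, Subst.lift, hx]
      rw [this]; exact Or.inl hx
    · have : (Chan.var x).subst (σ.lift n k) = ((Chan.var (x - n)).subst σ).shift n := by
        simp [Chan.subst, Subst.lift, hx]
      rw [this, shift_mem_upDom]
      exact h _ (hc.resolve_left hx)

theorem lift (h : σ.Maps Θ Θ' A A' D D') (n k : ℕ) :
    (σ.lift n k).Maps (Θ.rshift k) (Θ'.rshift k) (upRoles k A) (upRoles k A') (upDom n D)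
      (upDom n D') where
  pv X Ss hX := by
    simp only [PCtx.rshift, Option.map_eq_some_iff] at hX
    obtain ⟨Ss, hX, rfl⟩ := hX
    have e : (σ.lift n k).pv X = σ.pv X := rfl
    simp only [PCtx.rshift, e, h.pv X Ss hX, Option.map_some, List.map_map, Option.some.injEq,
      List.map_inj_left, Function.comp_def]
    intro S _
    exact (S.rshift_rsubst_liftRo σ.ro k).symm
  ro a ha := by
    show (liftRo σ.ro k a).In _
    unfold liftRo
    split
    · rename_i hk
      rintro b ⟨⟩; exact Or.inl hk
    · rename_i hk
      exact (h.ro _ (ha.resolve_left hk)).shift k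
  ch := lift_ch h.ch n k

theorem liftSess (h : σ.Maps Θ Θ' A A' D D') (Ψ : Protocol) :
    σ.liftSess.Maps Θ Θ' A A' (nuDom Ψ D) (nuDom Ψ D') where
  pv := h.pv
  ro := h.ro
  ch := by
    rintro (⟨_ | s, q⟩ | x) hc
    · exact hc
    · have := (Chan.ep s q).renSess_subst_liftSess σ
      simp only [Chan.renSess] at this
      rw [this]
      exact renSess_mem_nuDom.2 (h.ch _ hc)
    · exact renSess_mem_nuDom.2 (h.ch (.var x) hc)

theorem liftPv (h : σ.Maps Θ Θ' A A' D D') (Ss : List SType) :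
    σ.liftPv.Maps (Θ.cons Ss) (Θ'.cons (Ss.map (SType.rsubst σ.ro))) A A' D D' where
  pv X Ss' hX := by
    cases X with
    | zero => cases hX; rfl
    | succ X =>
      have e : liftIdx σ.pv 1 (X + 1) = σ.pv X + 1 := by simp [liftIdx]
      show (Θ'.cons _) (liftIdx σ.pv 1 (X + 1)) = _
      rw [e]
      exact h.pv X Ss' hX
  ro := h.ro
  ch c hc := by
    have : c.subst σ.liftPv = c.subst σ := by cases c <;> rfl
    rw [this]; exact h.ch c hc

end Subst.Maps

theorem Chan.subst_liftPv (c : Chan) (σ : Subst) : c.subst σ.liftPv = c.subst σ := by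
  cases c <;> rfl

theorem LCtx.inst_liftPv (σ : Subst) (L L' : LCtx) :
    LCtx.Inst σ.liftPv L' L ↔ LCtx.Inst σ L' L := by
  unfold LCtx.Inst
  simp only [Chan.subst_liftPv]; rfl

theorem SType.rsubst_of_rscoped {S : SType} {A : Set ℕ} {σ : ℕ → RoleE} (h : S.RScoped A)
    (hσ : ∀ a ∈ A, σ a = .var a) : S.rsubst σ = S := by
  have hlift : ∀ (A : Set ℕ) (σ : ℕ → RoleE) k, (∀ a ∈ A, σ a = .var a) →
      ∀ a ∈ {a | k ≤ a → a - k ∈ A}, liftRo σ k a = .var a := by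
    intro A σ k hσ a ha
    unfold liftRo
    split
    · rfl
    · have ha' : k ≤ a := by omega
      rw [hσ _ (ha ha')]
      simp [RoleE.shift, ha']
  have hro : ∀ (A : Set ℕ) (σ : ℕ → RoleE), (∀ a ∈ A, σ a = .var a) → ∀ ρ : RoleE,
      (∀ a, ρ = .var a → a ∈ A) → ρ.subst σ = ρ := by
    intro A σ hσ ρ h
    cases ρ with
    | name q => rfl
    | var a => exact hσ a (h a rfl)
  induction S generalizing A σ with
  | fin => rfl
  | tvar t => rfl
  | mu S ih => simp only [rsubst, ih h hσ]
  | sel n tgt lab ar pay rol cont ihp ihc =>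
    simp only [rsubst, sel.injEq, heq_eq_eq, true_and]
    refine ⟨funext fun i => hro A σ hσ _ (h.1 i), funext fun i => funext fun j =>
      ihp i j (h.2.2.1 i j) hσ, funext fun i => ?_, funext fun i => ihc i (h.2.2.2 i) hσ⟩
    conv_rhs => rw [← List.map_id (rol i)]
    refine List.map_congr_left fun ρ hρ => hro A σ hσ ρ ?_
    rintro a rfl
    exact h.2.1 i a hρ
  | bra ρ n lab ar pay k cont ihp ihc =>
    simp only [rsubst, bra.injEq, heq_eq_eq, true_and]
    exact ⟨hro A σ hσ ρ h.1, funext fun i => funext fun j => ihp i j (h.2.1 i j) (hlift _ _ _ hσ),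
      funext fun i => ihc i (h.2.2 i) (hlift _ _ _ hσ)⟩
  | rep r n lab ar pay k cont ihp ihc =>
    simp only [rsubst, rep.injEq, heq_eq_eq, true_and]
    exact ⟨funext fun i => funext fun j => ihp i j (h.1 i j) (hlift _ _ _ hσ),
      funext fun i => ihc i (h.2 i) (hlift _ _ _ hσ)⟩

theorem RType.rsubst_of_rscoped {U : RType} {A : Set ℕ} {σ : ℕ → RoleE} (h : U.RScoped A)
    (hσ : ∀ a ∈ A, σ a = .var a) : U.rsubst σ = U := by
  induction U with
  | one S => exact congrArg one (SType.rsubst_of_rscoped h hσ)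
  | par U V ihU ihV => simp only [rsubst, ihU h.1, ihV h.2]

/-- All channels of the linear context are endpoints of the innermost session. -/
def LCtx.Innermost (K : LCtx) : Prop := ∀ x ∈ K, ∃ q, x.1 = .ep 0 q

theorem Protocol.innermost {Ψ : Protocol} {K : LCtx} (h : Ψ.assoc.Lists K) : K.Innermost := by
  intro x hx
  have := (h.over x hx).1
  rcases x with ⟨⟨_ | s, q⟩ | x, S⟩
  · exact ⟨q, rfl⟩
  · exact absurd rfl this
  · exact absurd rfl this

theorem LCtx.Innermost.map_eq {K : LCtx} (h : K.Innermost) {f : Chan → Chan}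
    (hf : ∀ q, f (.ep 0 q) = .ep 0 q) (g : SType → SType) :
    K.map (Prod.map f g) = K.map (Prod.map id g) := by
  refine Multiset.map_congr rfl fun x hx => ?_
  obtain ⟨q, hq⟩ := h x hx
  rcases x with ⟨c, S⟩
  simp only at hq
  subst hq
  simp [hf]

/-- The context of a protocol binds no role variable, so closedness leaves none free in its types.
-/
theorem Protocol.map_rsubst {Ψ : Protocol} {K : LCtx} (h : Ψ.assoc.Lists K)
    (hc : Ψ.assoc.RClosed) (σ : ℕ → RoleE) : K.map (Prod.map id (SType.rsubst σ)) = K := by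
  refine Ctx.Lists.unique (Γ := Ψ.assoc) ?_ h
  refine h.map Function.injective_id σ ?_ ?_
  · intro c
    rcases e : Ψ.assoc.ch c with _ | U
    · exact e
    · rw [id, e, Option.map_some, RType.rsubst_of_rscoped (hc c U e)]
      intro a ha
      simp [Protocol.assoc] at ha
  · intro c hc; exact absurd ⟨c, rfl⟩ hc

/-- The lifted substitution fixes the endpoints of the innermost session as well as closed types. A
substitution can thus pass under a restriction with the protocol, and its safety property,
unchanged. -/
theorem Protocol.inst_liftSess {Ψ : Protocol} {K : LCtx} (h : Ψ.assoc.Lists K)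
    (hc : Ψ.assoc.RClosed) (σ : Subst) : LCtx.Inst σ.liftSess K K := by
  have := LCtx.inst_map σ.liftSess K
  rwa [(Protocol.innermost h).map_eq (by intro q; simp [Chan.subst, Subst.liftSess, liftIdx]),
    Protocol.map_rsubst h hc] at this

/-- Typing is preserved by well-scoped substitutions and by narrowing. -/
theorem LTyped.subst {P : Proc} {Θ Θ' : PCtx} {A A' : Set ℕ} {D D' : Set Chan} {L L' : LCtx}
    {σ : Subst} (h : LTyped P Θ A D L) (hσ : σ.Maps Θ Θ' A A' D D') (hL : LCtx.Inst σ L' L) :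
    LTyped (P.subst σ) Θ' A' D' L' := by
  induction P generalizing Θ Θ' A A' D D' L L' σ with
  | nil =>
    have h : L = 0 := h
    subst h
    exact hL.eq_zero
  | par P Q ihP ihQ =>
    obtain ⟨L₁, L₂, rfl, h₁, h₂⟩ := h
    obtain ⟨L₁', L₂', rfl, hi₁, hi₂⟩ := hL.exists_add
    exact ⟨L₁', L₂', rfl, ihP h₁ hσ hi₁, ihQ h₂ hσ hi₂⟩
  | nu P ih =>
    obtain ⟨Ψ, φ, K, hw, hs, hφ, hK, h⟩ := h
    exact ⟨Ψ, φ, K, hw, hs, hφ, hK, ih h (hσ.liftSess Ψ)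
      (hL.renSess_succ.add (Protocol.inst_liftSess hK (hs.closed _ hφ) σ))⟩
  | sum n c ρ m V W P ih =>
    refine ⟨h.1, fun i => ?_⟩
    obtain ⟨L₀, L₁, L₂, a, pay, S, rfl, h₁, h₂, h₃, h₄, h₅⟩ := h.2 i
    obtain ⟨L', L₂', rfl, hi, hi₂⟩ := hL.exists_add
    obtain ⟨L₀', L₁', rfl, hi₀, hi₁⟩ := hi.exists_add
    refine ⟨L₀', L₁', L₂', a, fun j => (pay j).rsubst σ.ro, S.rsubst σ.ro, rfl, ?_, ?_,
      h₃.subst hσ.ro, hi₂.chanTyped hσ.ch h₄, ih i h₅ hσ (hi₀.add (LCtx.inst_ent σ _ _))⟩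
    · have := LCtx.Inst.chansTyped hσ.ch h₁ hi₁
      rwa [List.map_ofFn] at this
    · intro ρ' hρ'
      obtain ⟨ρ₀, hρ₀, rfl⟩ := List.mem_map.1 hρ'
      exact (h₂ ρ₀ hρ₀).subst hσ.ro
  | rcv c ρ n m nx k P ih =>
    obtain ⟨L₀, L₁, pay, S, rfl, h₁, h₂, h₃⟩ := h
    obtain ⟨L₀', L₁', rfl, hi₀, hi₁⟩ := hL.exists_add
    refine ⟨L₀', L₁', _, _, rfl, hi₁.chanTyped hσ.ch h₁, h₂.subst hσ.ro, fun i => ?_⟩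
    refine ih i (h₃ i) (hσ.lift _ _)
      (((hi₀.up _ _).add ?_).add (LCtx.inst_entFn_lift σ (k i) (pay i)))
    have := LCtx.inst_ent (σ.lift (nx i) (k i)) (c.shift (nx i)) (S i)
    rwa [Chan.shift_subst_lift] at this
  | rep c r n m nx k P ih =>
    obtain ⟨pay, S, h₁, h₂⟩ := h
    refine ⟨_, _, hL.chanTyped hσ.ch h₁, fun i => ?_⟩
    refine ih i (h₂ i) (hσ.lift _ _)
      (LCtx.Inst.add ?_ (LCtx.inst_entFn_lift σ (repDepth r (k i)) (pay i)))
    have := LCtx.inst_ent (σ.lift (nx i) (repDepth r (k i))) (c.shift (nx i)) (S i)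
    rwa [Chan.shift_subst_lift] at this
  | defn k P Q ihP ihQ =>
    obtain ⟨S, hS, h₁, h₂⟩ := h
    have hm : σ.liftPv.Maps (Θ.cons (List.ofFn S))
        (Θ'.cons (List.ofFn fun j => (S j).rsubst σ.ro)) A A' D D' := by
      have := hσ.liftPv (List.ofFn S)
      rwa [List.map_ofFn] at this
    refine ⟨fun j => (S j).rsubst σ.ro, fun j => (SType.wf_rsubst _ _).2 (hS j), ?_,
      ihQ h₂ hm ((LCtx.inst_liftPv _ _ _).2 hL)⟩
    have e : liftRo σ.ro 0 = σ.ro := by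
      funext a
      simp only [liftRo, Nat.not_lt_zero, if_false, Nat.sub_zero]
      cases σ.ro a <;> rfl
    have hi := LCtx.inst_entFn_lift σ 0 S
    rw [e] at hi
    -- The body binds no role variable. The fields are given by hand because `Subst.Maps.lift` would
    -- produce weakenings by zero roles, which are not syntactically trivial.
    refine ihP h₁ ⟨?_, ?_, ?_⟩ ((LCtx.inst_liftPv _ _ _).2 hi)
    · intro X Ss hX
      have := hm.pv X Ss hX
      simp only [Subst.liftPv, Subst.lift, e] at this ⊢
      exact this
    · intro a ha
      simp only [Subst.liftPv, Subst.lift, e]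
      exact hσ.ro a ha
    · intro c hc
      rw [Chan.subst_liftPv]
      exact Subst.Maps.lift_ch hσ.ch k 0 c hc
  | call X c =>
    obtain ⟨Ss, hX, h⟩ := h
    exact ⟨_, hσ.pv X Ss hX, LCtx.Inst.chansTyped hσ.ch h hL⟩

/-! ### Renamings -/

/-- A renaming of sessions and process variables, as a substitution. -/
def Subst.ren (g h : ℕ → ℕ) : Subst := ⟨g, .var, .var, h⟩

theorem Subst.ren_lift (g h : ℕ → ℕ) (n k : ℕ) : (ren g h).lift n k = ren g h := by
  have : (fun x => if x < n then Chan.var x else (Chan.var (x - n)).shift n) = Chan.var := by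
    funext x
    split
    · rfl
    · simp only [Chan.shift, Chan.var.injEq]; omega
  simp only [ren, lift, liftRo_var, this]

theorem Subst.ren_liftSess (g h : ℕ → ℕ) : (ren g h).liftSess = ren (liftIdx g 1) h := rfl

theorem Subst.ren_liftPv (g h : ℕ → ℕ) : (ren g h).liftPv = ren g (liftIdx h 1) := rfl

theorem Chan.subst_ren (g h : ℕ → ℕ) : Chan.subst (Subst.ren g h) = Chan.renSess g := by
  funext c; cases c <;> rfl

theorem liftIdx_id (k : ℕ) : liftIdx (fun i => i) k = fun i => i := by
  funext i
  unfold liftIdx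
  split
  · rfl
  · show i - k + k = i
    omega

theorem Chan.renSess_id (c : Chan) : c.renSess (fun s => s) = c := by cases c <;> rfl

theorem RoleE.subst_var_eq : RoleE.subst RoleE.var = id := funext RoleE.subst_var

theorem SType.rsubst_var_eq : SType.rsubst RoleE.var = id := funext SType.rsubst_var

theorem Proc.subst_id (P : Proc) : P.subst .id = P := by
  have e : Subst.id = Subst.ren (fun s => s) (fun X => X) := rfl
  have e' : Chan.subst Subst.id = id := by
    rw [e, Chan.subst_ren]; exact funext Chan.renSess_id
  have h₁ : ∀ n k, Subst.id.lift n k = Subst.id := fun n k => by rw [e, Subst.ren_lift]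
  have h₂ : Subst.id.liftSess = Subst.id := by rw [e, Subst.ren_liftSess, liftIdx_id]
  have h₃ : Subst.id.liftPv = Subst.id := by rw [e, Subst.ren_liftPv, liftIdx_id]
  have e'' : RoleE.subst Subst.id.ro = id := RoleE.subst_var_eq
  induction P with
  | nil => rfl
  | par P Q ihP ihQ => simp [subst, ihP, ihQ]
  | nu P ih => simp [subst, h₂, ih]
  | sum n c ρ m V W P ih => simp [subst, ih, e', e'']
  | rcv c ρ n m nx k P ih => simp [subst, ih, e', e'', h₁]
  | rep c r n m nx k P ih => simp [subst, ih, e', h₁]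
  | defn k P Q ihP ihQ => simp [subst, ihP, ihQ, h₁, h₃]
  | call X c => simp [subst, e']; rfl

namespace LCtx

theorem renSess_add (g : ℕ → ℕ) (L L' : LCtx) :
    (L + L').renSess g = L.renSess g + L'.renSess g := Multiset.map_add _ _ _

theorem renSess_injective {g : ℕ → ℕ} (hg : Function.Injective g) :
    Function.Injective (LCtx.renSess g) :=
  Multiset.map_injective ((Chan.renSess_injective hg).prodMap Function.injective_id)

theorem renSess_renSess (g g' : ℕ → ℕ) (L : LCtx) :
    (L.renSess g).renSess g' = L.renSess (g' ∘ g) := by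
  unfold renSess
  rw [Multiset.map_map]
  refine Multiset.map_congr rfl fun x _ => ?_
  rcases x with ⟨⟨s, q⟩ | x, S⟩ <;> rfl

theorem ent_renSess (g : ℕ → ℕ) (c : Chan) (S : SType) :
    (ent c S).renSess g = ent (c.renSess g) S := by
  simp [ent, renSess, Multiset.map_map]

theorem entFn_renSess (g : ℕ → ℕ) {n : ℕ} (S : Fin n → SType) :
    (entFn S).renSess g = entFn S := by
  unfold entFn
  have : ∀ s : Finset (Fin n), (∑ j ∈ s, ent (.var j) (S j)).renSess g =
      ∑ j ∈ s, ent (.var j) (S j) := by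
    classical
    intro s
    induction s using Finset.induction with
    | empty => rfl
    | insert j s hj ih => rw [Finset.sum_insert hj, renSess_add, ih, ent_renSess]; rfl
  exact this _

theorem up_renSess (g : ℕ → ℕ) (n k : ℕ) (L : LCtx) :
    (L.renSess g).up n k = (L.up n k).renSess g := by
  unfold renSess up
  rw [Multiset.map_map, Multiset.map_map]
  refine Multiset.map_congr rfl fun x _ => ?_
  rcases x with ⟨⟨s, q⟩ | x, S⟩ <;> rfl

theorem Innermost.renSess {K : LCtx} (h : K.Innermost) {g : ℕ → ℕ} (hg : g 0 = 0) :
    K.renSess g = K := by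
  have := h.map_eq (f := Chan.renSess g) (by simp [Chan.renSess, hg]) id
  rw [Prod.map_id, Multiset.map_id] at this
  exact this

theorem exists_renSess {g : ℕ → ℕ} {L : LCtx} (h : ∀ x ∈ L, ∃ c : Chan, c.renSess g = x.1) :
    ∃ L₀ : LCtx, L = L₀.renSess g := by
  induction L using Multiset.induction with
  | empty => exact ⟨0, rfl⟩
  | cons x L ih =>
    obtain ⟨L₀, rfl⟩ := ih fun x hx => h x (Multiset.mem_cons_of_mem hx)
    obtain ⟨c, hc⟩ := h x (Multiset.mem_cons_self _ _)
    refine ⟨(c, x.2) ::ₘ L₀, ?_⟩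
    simp [LCtx.renSess, hc]

theorem mem_renSess {g : ℕ → ℕ} {L : LCtx} {x : Chan × SType} (h : x ∈ L.renSess g) :
    ∃ c : Chan, c.renSess g = x.1 := by
  obtain ⟨y, -, rfl⟩ := Multiset.mem_map.1 h
  exact ⟨y.1, rfl⟩

end LCtx

theorem LTyped.ren {P : Proc} {Θ Θ' : PCtx} {A : Set ℕ} {D D' : Set Chan} {L : LCtx}
    (h : LTyped P Θ A D L) (g f : ℕ → ℕ) (hΘ : ∀ X, Θ' (f X) = Θ X)
    (hD : ∀ c ∈ D, c.renSess g ∈ D') :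
    LTyped (P.subst (.ren g f)) Θ' A D' (L.renSess g) := by
  refine h.subst ⟨fun X Ss hX => ?_, ?_, ?_⟩ ?_
  · show Θ' (f X) = some (Ss.map (SType.rsubst RoleE.var))
    rw [SType.rsubst_var_eq, List.map_id, hΘ, hX]
  · rintro a ha b ⟨⟩; exact ha
  · rw [Chan.subst_ren]; exact hD
  · have := LCtx.inst_map (.ren g f) L
    rw [Chan.subst_ren] at this
    simp only [Subst.ren, SType.rsubst_var_eq] at this
    exact this

/-- Weakening of the scopes is the substitution lemma for the identity. -/
theorem LTyped.mono {P : Proc} {Θ : PCtx} {A A' : Set ℕ} {D D' : Set Chan} {L : LCtx}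
    (h : LTyped P Θ A D L) (hA : A ⊆ A') (hD : D ⊆ D') : LTyped P Θ A' D' L := by
  have e : ∀ c : Chan, c.subst .id = c := by intro c; cases c <;> rfl
  have := h.subst (σ := .id) (Θ' := Θ) (A' := A') (D' := D') (L' := L)
    ⟨fun X Ss hX => by simp [Subst.id, SType.rsubst_var_eq, hX],
      fun a ha b hb => by cases hb; exact hA ha, fun c hc => by rw [e]; exact hD hc⟩ ?_
  · rwa [Proc.subst_id] at this
  · have := LCtx.inst_map .id L
    have e' : Chan.subst .id = id := funext e
    rw [e'] at this
    simp only [Subst.id, SType.rsubst_var_eq, Prod.map_id, Multiset.map_id] at this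
    exact this

theorem ChanTyped.of_renSess {g : ℕ → ℕ} {D : Set Chan} {L' : LCtx} {c : Chan} {S : SType}
    (h : ChanTyped D L' (c.renSess g) S) :
    ∃ L : LCtx, L' = L.renSess g ∧ ChanTyped {c | c.renSess g ∈ D} L c S := by
  obtain ⟨hc, hw, ⟨S', hn, hs, rfl⟩ | ⟨hf, rfl⟩⟩ := h
  · exact ⟨{(c, S')}, rfl, hc, hw, Or.inl ⟨S', hn, hs, rfl⟩⟩
  · exact ⟨0, rfl, hc, hw, Or.inr ⟨hf, rfl⟩⟩

theorem ChansTyped.of_renSess {g : ℕ → ℕ} {D : Set Chan} {L' : LCtx} {cs : List Chan}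
    {Ss : List SType} (h : ChansTyped D L' (cs.map (Chan.renSess g)) Ss) :
    ∃ L : LCtx, L' = L.renSess g ∧ ChansTyped {c | c.renSess g ∈ D} L cs Ss := by
  induction cs generalizing L' Ss with
  | nil => cases h; exact ⟨0, rfl, .nil⟩
  | cons c cs ih =>
    cases h with
    | cons h₁ h₂ =>
      obtain ⟨L₁, rfl, h₁'⟩ := h₁.of_renSess
      obtain ⟨L₂, rfl, h₂'⟩ := ih h₂
      exact ⟨L₁ + L₂, (LCtx.renSess_add _ _ _).symm, .cons h₁' h₂'⟩

theorem upDom_renSess (n : ℕ) (g : ℕ → ℕ) (D : Set Chan) :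
    {c : Chan | c.renSess g ∈ upDom n D} = upDom n {c | c.renSess g ∈ D} := by
  ext c; cases c <;> rfl

theorem nuDom_renSess (Ψ : Protocol) (g : ℕ → ℕ) (D : Set Chan) :
    {c : Chan | c.renSess (liftIdx g 1) ∈ nuDom Ψ D} = nuDom Ψ {c | c.renSess g ∈ D} := by
  ext c
  rcases c with ⟨_ | s, q⟩ | x
  · simp [Chan.renSess, nuDom, liftIdx]
  · simp [Chan.renSess, nuDom, liftIdx]
  · rfl

theorem liftIdx_injective {g : ℕ → ℕ} (hg : Function.Injective g) (k : ℕ) :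
    Function.Injective (liftIdx g k) := by
  intro i j h
  unfold liftIdx at h
  split at h <;> split at h <;> try omega
  have := hg (Nat.add_right_cancel h)
  omega

theorem Chan.shift_renSess (c : Chan) (n : ℕ) (g : ℕ → ℕ) :
    (c.renSess g).shift n = (c.shift n).renSess g := by cases c <;> rfl

theorem PCtx.cons_liftIdx (Θ : PCtx) (Ss : List SType) (f : ℕ → ℕ) :
    (fun X => (Θ.cons Ss) (liftIdx f 1 X)) = PCtx.cons Ss (fun X => Θ (f X)) := by
  funext X
  cases X with
  | zero => rfl
  | succ X => simp [liftIdx, PCtx.cons]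

/-- A renamed process only uses the renamed names. -/
theorem LTyped.of_ren {P : Proc} {Θ : PCtx} {A : Set ℕ} {D : Set Chan} {L' : LCtx}
    {g f : ℕ → ℕ} (hg : Function.Injective g) (H : LTyped (P.subst (.ren g f)) Θ A D L') :
    ∃ L : LCtx, L' = L.renSess g ∧
      LTyped P (fun X => Θ (f X)) A {c | c.renSess g ∈ D} L := by
  induction P generalizing Θ A D L' g f with
  | nil =>
    have H : L' = 0 := H
    subst H
    exact ⟨0, rfl, rfl⟩
  | par P Q ihP ihQ =>
    obtain ⟨L₁, L₂, rfl, h₁, h₂⟩ := H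
    obtain ⟨L₁, rfl, h₁'⟩ := ihP hg h₁
    obtain ⟨L₂, rfl, h₂'⟩ := ihQ hg h₂
    exact ⟨L₁ + L₂, (LCtx.renSess_add _ _ _).symm, L₁, L₂, rfl, h₁', h₂'⟩
  | nu P ih =>
    obtain ⟨Ψ, φ, K, hw, hs, hφ, hK, h⟩ := H
    rw [Subst.ren_liftSess] at h
    obtain ⟨M, e, h'⟩ := ih (liftIdx_injective hg 1) h
    -- A weakened endpoint has a positive session index, so its preimage under the lifted renaming
    -- is not of the innermost session and descends to a preimage under `g`.
    have hr : ∀ x ∈ L', ∃ c : Chan, c.renSess g = x.1 := by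
      rintro ⟨c, S⟩ hx
      have hx' : (c.renSess (· + 1), S) ∈ M.renSess (liftIdx g 1) := by
        rw [← e]
        exact Multiset.mem_add.2 (Or.inl (Multiset.mem_map_of_mem _ hx))
      obtain ⟨c', hc'⟩ := LCtx.mem_renSess hx'
      rcases c with ⟨s, q⟩ | x
      · rcases c' with ⟨_ | s', q'⟩ | x
        · simp [Chan.renSess, liftIdx] at hc'
        · simp [Chan.renSess, liftIdx] at hc'
          exact ⟨.ep s' q', by simp [Chan.renSess, hc']⟩
        · simp [Chan.renSess] at hc'
      · exact ⟨.var x, rfl⟩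
    obtain ⟨L, rfl⟩ := LCtx.exists_renSess hr
    refine ⟨L, rfl, Ψ, φ, K, hw, hs, hφ, hK, ?_⟩
    have : M = L.renSess (· + 1) + K := by
      refine LCtx.renSess_injective (liftIdx_injective hg 1) ?_
      rw [← e, LCtx.renSess_add, (Protocol.innermost hK).renSess (g := liftIdx g 1) rfl,
        LCtx.renSess_renSess, LCtx.renSess_renSess]
      congr 2
    rw [← this, ← nuDom_renSess]
    exact h'
  | sum n c ρ m V W P ih =>
    obtain ⟨hn, H⟩ := H
    have key : ∀ i, ∃ L : LCtx, L' = L.renSess g ∧ ∃ (L₀ L₁ L₂ : LCtx) (a : ℕ)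
      (pay : Fin a → SType) (S : SType), L = L₀ + L₁ + L₂ ∧
        ChansTyped {c | c.renSess g ∈ D} L₁ (V i) (List.ofFn pay) ∧ (∀ ρ' ∈ W i, ρ'.In A) ∧
        (ρ i).In A ∧
        ChanTyped {c | c.renSess g ∈ D} L₂ (c i) (.sel 1 (fun _ => ρ i) (fun _ => m i)
          (fun _ => a) (fun _ => pay) (fun _ => W i) (fun _ => S)) ∧
        LTyped (P i) (fun X => Θ (f X)) A {c | c.renSess g ∈ D} (L₀ + LCtx.ent (c i) S) := by
      intro i
      obtain ⟨L₀, L₁, L₂, a, pay, S, rfl, h₁, h₂, h₃, h₄, h₅⟩ := H i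
      rw [Chan.subst_ren] at h₁ h₄ h₅
      simp only [Subst.ren, RoleE.subst_var_eq, List.map_id, id] at h₂ h₃ h₄
      obtain ⟨L₁, rfl, h₁'⟩ := h₁.of_renSess
      obtain ⟨L₂, rfl, h₄'⟩ := h₄.of_renSess
      obtain ⟨M, e, h₅'⟩ := ih i hg h₅
      obtain ⟨L₀, rfl⟩ := LCtx.exists_renSess (L := L₀) (g := g) fun x hx =>
        LCtx.mem_renSess (L := M) (by rw [← e]; exact Multiset.mem_add.2 (Or.inl hx))
      refine ⟨L₀ + L₁ + L₂, by simp only [LCtx.renSess_add], L₀, L₁, L₂, a, pay, S, rfl, h₁', h₂, h₃,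
        h₄', ?_⟩
      have : M = L₀ + LCtx.ent (c i) S := LCtx.renSess_injective hg (by
        rw [← e, LCtx.renSess_add, LCtx.ent_renSess])
      rwa [← this]
    -- Each summand yields a preimage of the same linear context. One exists since the sum is not
    -- empty, and all agree by injectivity.
    obtain ⟨L, rfl, -⟩ := key ⟨0, hn⟩
    refine ⟨L, rfl, hn, fun i => ?_⟩
    obtain ⟨L₁, e, h⟩ := key i
    rw [LCtx.renSess_injective hg e]
    exact h
  | rcv c ρ n m nx k P ih =>
    obtain ⟨L₀, L₁, pay, S, rfl, h₁, h₂, h₃⟩ := H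
    rw [Chan.subst_ren] at h₁ h₃
    simp only [Subst.ren_lift] at h₃
    simp only [Subst.ren, RoleE.subst_var] at h₁ h₂
    -- The preimage of `L₀` is read off a branch, which exists because well-formed branchings are
    -- non-empty.
    have hn : 0 < n := h₁.2.1.1
    obtain ⟨L₁, rfl, h₁'⟩ := h₁.of_renSess
    have hr : ∀ x ∈ L₀, ∃ c : Chan, c.renSess g = x.1 := by
      rintro ⟨c', S'⟩ hx
      obtain ⟨M, e, -⟩ := ih ⟨0, hn⟩ hg (h₃ ⟨0, hn⟩)
      have hx' : (c'.shift (nx ⟨0, hn⟩), S'.rshift (k ⟨0, hn⟩)) ∈ M.renSess g := by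
        rw [← e]
        exact Multiset.mem_add.2 (Or.inl (Multiset.mem_add.2
          (Or.inl (Multiset.mem_map_of_mem _ hx))))
      obtain ⟨c'', hc''⟩ := LCtx.mem_renSess hx'
      rcases c' with ⟨s, q⟩ | x
      · exact ⟨c'', hc''⟩
      · exact ⟨.var x, rfl⟩
    obtain ⟨L₀, rfl⟩ := LCtx.exists_renSess hr
    refine ⟨L₀ + L₁, (LCtx.renSess_add _ _ _).symm, L₀, L₁, pay, S, rfl, h₁', h₂, fun i => ?_⟩
    obtain ⟨M, e, h⟩ := ih i hg (h₃ i)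
    have : M = L₀.up (nx i) (k i) + LCtx.ent (c.shift (nx i)) (S i) + LCtx.entFn (pay i) :=
      LCtx.renSess_injective hg (by
        simp only [← e, LCtx.renSess_add, LCtx.ent_renSess, LCtx.entFn_renSess, LCtx.up_renSess,
          Chan.shift_renSess])
    rw [← this, ← upDom_renSess]
    exact h
  | rep c r n m nx k P ih =>
    obtain ⟨pay, S, h₁, h₂⟩ := H
    rw [Chan.subst_ren] at h₁ h₂
    simp only [Subst.ren_lift] at h₂
    obtain ⟨L, rfl, h₁'⟩ := h₁.of_renSess
    refine ⟨L, rfl, pay, S, h₁', fun i => ?_⟩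
    obtain ⟨M, e, h⟩ := ih i hg (h₂ i)
    have : M = LCtx.ent (c.shift (nx i)) (S i) + LCtx.entFn (pay i) :=
      LCtx.renSess_injective hg (by
        simp only [← e, LCtx.renSess_add, LCtx.ent_renSess, LCtx.entFn_renSess,
          Chan.shift_renSess])
    rw [← this, ← upDom_renSess]
    exact h
  | defn k P Q ihP ihQ =>
    obtain ⟨S, hS, h₁, h₂⟩ := H
    rw [Subst.ren_lift, Subst.ren_liftPv] at h₁
    rw [Subst.ren_liftPv] at h₂
    obtain ⟨M, e, h₁'⟩ := ihP hg h₁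
    obtain ⟨L, rfl, h₂'⟩ := ihQ hg h₂
    rw [PCtx.cons_liftIdx] at h₁' h₂'
    refine ⟨L, rfl, S, hS, ?_, h₂'⟩
    have : M = LCtx.entFn S := LCtx.renSess_injective hg (by rw [← e, LCtx.entFn_renSess])
    rw [← this, ← upDom_renSess]
    exact h₁'
  | call X c =>
    obtain ⟨Ss, hX, h⟩ := H
    rw [Chan.subst_ren] at h
    obtain ⟨L, rfl, h'⟩ := h.of_renSess
    exact ⟨L, rfl, Ss, hX, h'⟩

/-! ### Structural congruence -/

theorem Ctx.Split.dom_eq {Γ Γ₁ Γ₂ : Ctx} (h : Γ.Split Γ₁ Γ₂) : Γ.dom = Γ₁.dom ∪ Γ₂.dom := by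
  rw [((Ctx.cong_iff _ _).1 h.2.2).2.1, Ctx.dom_add]

theorem Trans.dom_nonempty {Γ Γ' : Ctx} {γ : Act} (h : Trans Γ γ Γ') : Γ.dom.Nonempty := by
  induction h with
  | rcv | snd | bang => simp
  | role a _ ih => rw [Ctx.dom_add]; exact ih.inl
  | cong hs _ ih => rw [hs.dom_eq]; exact ih.inl
  | unfold hs _ _ _ => rw [hs.dom_eq]; simp
  | com₁ hs _ _ _ ih _ => rw [hs.dom_eq]; exact ih.inl
  | com₂ hs _ _ _ ih _ => rw [hs.dom_eq]; exact ih.inl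

/-- A context without channels can neither supply an entry nor reduce, so every clause is vacuous.
This property types a restriction newly introduced around the inactive process. -/
theorem isSafety_dom_empty : IsSafety fun Γ => Γ.dom = ∅ where
  com := by
    intro Δ Δ' Γ s p q n tgt lab ar pay rol cont n' lab' ar' pay' k' cont' h hs
    exact absurd h (Set.Nonempty.ne_empty (by rw [hs.dom_eq]; simp))
  bang := by
    intro Δ Δ' Γ s p q n tgt lab ar pay rol cont r n' lab' ar' pay' k' cont' h hs
    exact absurd h (Set.Nonempty.ne_empty (by rw [hs.dom_eq]; simp))
  unfold := by
    intro Δ Γ s q S h hs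
    exact absurd h (Set.Nonempty.ne_empty (by rw [hs.dom_eq]; simp))
  closed := by
    intro Γ h c U hc
    have : c ∈ Γ.dom := by simp [Ctx.mem_dom, hc]
    rw [h] at this; exact this.elim
  red := by
    rintro Γ Γ' h ⟨s, p, q, m, ht⟩
    exact absurd h ht.dom_nonempty.ne_empty

theorem nuDom_preimage (Ψ : Protocol) (D : Set Chan) :
    {c : Chan | c.renSess (· + 1) ∈ nuDom Ψ D} = D := by
  ext c; exact renSess_mem_nuDom

theorem nuDom_swap (Ψ Ψ' : Protocol) (D : Set Chan) (c : Chan) :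
    c.renSess swapIdx ∈ nuDom Ψ (nuDom Ψ' D) ↔ c ∈ nuDom Ψ' (nuDom Ψ D) := by
  rcases c with ⟨_ | _ | s, q⟩ | x <;> rfl

theorem swapIdx_injective : Function.Injective swapIdx := by
  rintro (_ | _ | i) (_ | _ | j) h <;> simp_all [swapIdx]

/-- The outer protocol is weakened past the inner binder and the inner one is not; the transposition
exchanges these positions and fixes the older sessions. -/
theorem LCtx.renSess_swap (L K K' : LCtx) (hK : K.Innermost) (hK' : K'.Innermost) :
    ((L.renSess (· + 1) + K).renSess (· + 1) + K').renSess swapIdx =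
      (L.renSess (· + 1) + K').renSess (· + 1) + K := by
  have h₁ : ∀ {K : LCtx}, K.Innermost →
      (K.renSess (· + 1)).renSess swapIdx = K := fun {K} h => by
    rw [LCtx.renSess_renSess]; exact h.renSess rfl
  have h₂ : ∀ {K : LCtx}, K.Innermost → K.renSess swapIdx = K.renSess (· + 1) := fun {K} h => by
    refine Multiset.map_congr rfl fun x hx => ?_
    obtain ⟨q, hq⟩ := h x hx
    rcases x with ⟨c, S⟩
    simp only at hq
    subst hq
    rfl
  simp only [LCtx.renSess_add]
  rw [h₁ hK, h₂ hK']
  have : ((L.renSess (· + 1)).renSess (· + 1)).renSess swapIdx =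
      (L.renSess (· + 1)).renSess (· + 1) := by
    simp only [LCtx.renSess_renSess]
    rfl
  rw [this, add_right_comm]

/-- A linear context without the innermost session can be split off. -/
theorem LCtx.exists_of_renSess_add {L L₁ L₂ K : LCtx} (hK : K.Innermost)
    (h : L.renSess (· + 1) + K = L₁.renSess (· + 1) + L₂) :
    ∃ L₃ : LCtx, L₂ = L₃.renSess (· + 1) + K ∧ L = L₁ + L₃ := by
  classical
  let p : Chan × SType → Prop := fun x => ∃ c : Chan, c.renSess (· + 1) = x.1
  have hL : ∀ L : LCtx, (L.renSess (· + 1)).filter p = L.renSess (· + 1) := fun L =>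
    Multiset.filter_eq_self.2 fun x hx => LCtx.mem_renSess hx
  have hK' : K.filter p = 0 := by
    refine Multiset.filter_eq_nil.2 ?_
    rintro x hx ⟨c, hc⟩
    obtain ⟨q, hq⟩ := hK x hx
    rw [hq] at hc
    cases c <;> simp [Chan.renSess] at hc
  have h₁ := congrArg (Multiset.filter p) h
  rw [Multiset.filter_add, Multiset.filter_add, hL, hL, hK', add_zero] at h₁
  obtain ⟨L₃, e⟩ := LCtx.exists_renSess (L := L₂.filter p) (g := (· + 1)) fun x hx =>
    (Multiset.mem_filter.1 hx).2
  rw [e, ← LCtx.renSess_add] at h₁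
  have h₂ := LCtx.renSess_injective (add_left_injective 1) h₁
  subst h₂
  refine ⟨L₃, ?_, rfl⟩
  rw [LCtx.renSess_add, add_assoc] at h
  exact (add_left_cancel h).symm

theorem PCtx.comp_succ (Θ : PCtx) (Ss : List SType) : (fun X => (Θ.cons Ss) (X + 1)) = Θ := rfl

theorem LTyped.renPv_iff {P : Proc} {Θ : PCtx} {A : Set ℕ} {D : Set Chan} {L : LCtx}
    (f : ℕ → ℕ) : LTyped (P.renPv f) Θ A D L ↔ LTyped P (fun X => Θ (f X)) A D L := by
  have hid : ∀ L : LCtx, L.renSess (fun s => s) = L := fun L => by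
    have : Prod.map (Chan.renSess fun s => s) (id : SType → SType) = id := by
      funext x; exact Prod.ext (Chan.renSess_id _) rfl
    rw [LCtx.renSess, this, Multiset.map_id]
  constructor
  · intro h
    obtain ⟨M, e, h'⟩ := LTyped.of_ren (g := fun s => s) (f := f) Function.injective_id h
    rw [hid] at e
    subst e
    simp only [Chan.renSess_id] at h'
    exact h'
  · intro h
    have := h.ren (fun s => s) f (Θ' := Θ) (fun _ => rfl)
      (D' := D) fun c hc => by rwa [Chan.renSess_id]
    rwa [hid] at this

theorem CongAx.ltyped {P Q : Proc} (h : CongAx P Q) {Θ : PCtx} {A : Set ℕ} {D : Set Chan}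
    {L : LCtx} : LTyped P Θ A D L ↔ LTyped Q Θ A D L := by
  cases h with
  | comm P Q =>
    constructor
    all_goals
      rintro ⟨L₁, L₂, rfl, h₁, h₂⟩
      exact ⟨L₂, L₁, add_comm _ _, h₂, h₁⟩
  | assoc P Q R =>
    constructor
    · rintro ⟨_, L₃, rfl, ⟨L₁, L₂, rfl, h₁, h₂⟩, h₃⟩
      exact ⟨L₁, _, add_assoc _ _ _, h₁, L₂, L₃, rfl, h₂, h₃⟩
    · rintro ⟨L₁, _, rfl, h₁, L₂, L₃, rfl, h₂, h₃⟩
      exact ⟨_, L₃, (add_assoc _ _ _).symm, ⟨L₁, L₂, rfl, h₁, h₂⟩, h₃⟩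
  | unit P =>
    constructor
    · rintro ⟨L₁, L₂, rfl, h₁, h₂⟩
      have h₂ : L₂ = 0 := h₂
      rw [h₂, add_zero]; exact h₁
    · intro h
      exact ⟨L, 0, (add_zero L).symm, h, rfl⟩
  | nuNil =>
    constructor
    · rintro ⟨Ψ, φ, K, -, -, -, -, h⟩
      have h : L.renSess (· + 1) + K = 0 := h
      exact Multiset.map_eq_zero.1 (add_eq_zero.1 h).1
    · intro h
      have h : L = 0 := h
      subst h
      -- The new session gets the empty protocol.
      refine ⟨fun _ => none, _, 0, ⟨by simp, by simp⟩, isSafety_dom_empty, ?_,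
        Ctx.lists_of_none ?_, rfl⟩
      · ext c
        rcases c with ⟨_ | s, q⟩ | x <;> simp [Ctx.mem_dom, Protocol.assoc]
      · rintro (⟨_ | s, q⟩ | x) <;> rfl
  | nuNu P =>
    constructor
    · rintro ⟨Ψ, φ, K, hw, hs, hφ, hK, Ψ', φ', K', hw', hs', hφ', hK', h⟩
      refine ⟨Ψ', φ', K', hw', hs', hφ', hK', Ψ, φ, K, hw, hs, hφ, hK, ?_⟩
      have := h.ren swapIdx (fun X => X) (Θ' := Θ) (fun _ => rfl)
        (fun c hc => (nuDom_swap Ψ Ψ' D c).2 hc)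
      rwa [LCtx.renSess_swap _ _ _ (Protocol.innermost hK) (Protocol.innermost hK')] at this
    · rintro ⟨Ψ, φ, K, hw, hs, hφ, hK, Ψ', φ', K', hw', hs', hφ', hK', h⟩
      refine ⟨Ψ', φ', K', hw', hs', hφ', hK', Ψ, φ, K, hw, hs, hφ, hK, ?_⟩
      obtain ⟨M, e, h⟩ := LTyped.of_ren (g := swapIdx) (f := fun X => X) swapIdx_injective h
      rw [← LCtx.renSess_swap _ _ _ (Protocol.innermost hK') (Protocol.innermost hK)] at e
      rw [← LCtx.renSess_injective swapIdx_injective e] at h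
      refine h.mono subset_rfl ?_
      intro c hc
      exact (nuDom_swap Ψ' Ψ D c).1 hc
  | nuPar P Q =>
    constructor
    · rintro ⟨Ψ, φ, K, hw, hs, hφ, hK, L₁, L₂, e, h₁, h₂⟩
      obtain ⟨L₁, rfl, h₁'⟩ :=
        LTyped.of_ren (g := (· + 1)) (f := fun X => X) (add_left_injective 1) h₁
      -- `P` does not use the restricted session, so the whole protocol goes to `Q`.
      obtain ⟨L₃, rfl, rfl⟩ := LCtx.exists_of_renSess_add (Protocol.innermost hK) e
      rw [nuDom_preimage] at h₁'
      exact ⟨L₁, L₃, rfl, h₁', Ψ, φ, K, hw, hs, hφ, hK, h₂⟩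
    · rintro ⟨L₁, L₂, rfl, h₁, Ψ, φ, K, hw, hs, hφ, hK, h₂⟩
      refine ⟨Ψ, φ, K, hw, hs, hφ, hK, _, _, ?_, h₁.ren (· + 1) (fun X => X) (fun _ => rfl)
        fun c hc => renSess_mem_nuDom.2 hc, h₂⟩
      rw [LCtx.renSess_add, add_assoc]
  | defNu k P Q =>
    constructor
    · rintro ⟨S, hS, h₁, Ψ, φ, K, hw, hs, hφ, hK, h₂⟩
      refine ⟨Ψ, φ, K, hw, hs, hφ, hK, S, hS, ?_, h₂⟩
      have := h₁.ren (· + 1) (fun X => X) (Θ' := Θ.cons (List.ofFn S)) (fun _ => rfl)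
        (D' := upDom k (nuDom Ψ D)) fun c hc => by
          rwa [← nuDom_preimage Ψ D, ← upDom_renSess] at hc
      rwa [LCtx.entFn_renSess] at this
    · rintro ⟨Ψ, φ, K, hw, hs, hφ, hK, S, hS, h₁, h₂⟩
      refine ⟨S, hS, ?_, Ψ, φ, K, hw, hs, hφ, hK, h₂⟩
      obtain ⟨M, e, h₁⟩ :=
        LTyped.of_ren (g := (· + 1)) (f := fun X => X) (add_left_injective 1) h₁
      rw [← LCtx.entFn_renSess (· + 1) S] at e
      rw [← LCtx.renSess_injective (add_left_injective 1) e, upDom_renSess, nuDom_preimage] at h₁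
      exact h₁
  | defPar k R P Q =>
    constructor
    · rintro ⟨S, hS, h₁, L₁, L₂, rfl, h₂, h₃⟩
      exact ⟨L₁, L₂, rfl, ⟨S, hS, h₁, h₂⟩, (LTyped.renPv_iff (Θ := Θ.cons (List.ofFn S)) (· + 1)).1 h₃⟩
    · rintro ⟨L₁, L₂, rfl, ⟨S, hS, h₁, h₂⟩, h₃⟩
      exact ⟨S, hS, h₁, L₁, L₂, rfl, h₂, (LTyped.renPv_iff (Θ := Θ.cons (List.ofFn S)) (· + 1)).2 h₃⟩
  | defDef k k' R R' P =>
    have hswap : ∀ S S' : List SType,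
        (fun X => ((Θ.cons S').cons S) (swapIdx X)) = (Θ.cons S).cons S' := by
      intro S S'; funext X; rcases X with _ | _ | X <;> rfl
    constructor
    · rintro ⟨S, hS, h₁, S', hS', h₂, h₃⟩
      rw [LTyped.renPv_iff, PCtx.cons_liftIdx, PCtx.comp_succ] at h₂
      refine ⟨S', hS', h₂, S, hS, ?_, ?_⟩
      · rwa [LTyped.renPv_iff, PCtx.cons_liftIdx, PCtx.comp_succ]
      · rwa [LTyped.renPv_iff, hswap]
    · rintro ⟨S', hS', h₂, S, hS, h₁, h₃⟩
      rw [LTyped.renPv_iff, PCtx.cons_liftIdx, PCtx.comp_succ] at h₁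
      rw [LTyped.renPv_iff, hswap] at h₃
      refine ⟨S, hS, h₁, S', hS', ?_, h₃⟩
      rwa [LTyped.renPv_iff, PCtx.cons_liftIdx, PCtx.comp_succ]

/-- Structural congruence preserves typing. -/
theorem SCong.ltyped {P Q : Proc} (h : SCong P Q) {Θ : PCtx} {A : Set ℕ} {D : Set Chan} {L : LCtx}
    (hP : LTyped P Θ A D L) : LTyped Q Θ A D L := by
  induction h generalizing Θ A D L with
  | refl => exact hP
  | trans _ _ ih ih' => exact ih' (ih hP)
  | ax h => exact h.ltyped.1 hP
  | ax_symm h => exact h.ltyped.2 hP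
  | defNil k R =>
    -- The typing of the discarded body is forgotten; conversely, an introduced body might have no
    -- typing.
    obtain ⟨_, _, _, h⟩ := hP
    exact h
  | par _ _ ih ih' =>
    obtain ⟨L₁, L₂, e, h₁, h₂⟩ := hP
    exact ⟨L₁, L₂, e, ih h₁, ih' h₂⟩
  | nu _ ih =>
    obtain ⟨Ψ, φ, K, hw, hs, hφ, hK, h⟩ := hP
    exact ⟨Ψ, φ, K, hw, hs, hφ, hK, ih h⟩
  | sum _ ih =>
    refine ⟨hP.1, fun i => ?_⟩
    obtain ⟨L₀, L₁, L₂, a, pay, S, e, h₁, h₂, h₃, h₄, h₅⟩ := hP.2 i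
    exact ⟨L₀, L₁, L₂, a, pay, S, e, h₁, h₂, h₃, h₄, ih i h₅⟩
  | rcv _ ih =>
    obtain ⟨L₀, L₁, pay, S, e, h₁, h₂, h₃⟩ := hP
    exact ⟨L₀, L₁, pay, S, e, h₁, h₂, fun i => ih i (h₃ i)⟩
  | rep _ ih =>
    obtain ⟨pay, S, h₁, h₂⟩ := hP
    exact ⟨pay, S, h₁, fun i => ih i (h₂ i)⟩
  | defn _ _ ih ih' =>
    obtain ⟨S, hS, h₁, h₂⟩ := hP
    exact ⟨S, hS, ih h₁, ih' h₂⟩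

/-! ### Reduction of linear contexts -/

/-- `Input S r m Ss k S' keep`: the type `S` inputs `m` from `r` with payloads `Ss` and `k` role
payloads; it continues as `S'`, in parallel with `keep`. -/
inductive Input : SType → Option Role → Label → List SType → ℕ → SType → Multiset SType → Prop
  | bra (q : Role) (n : ℕ) (lab : Fin n → Label) (ar : Fin n → ℕ)
      (pay : (i : Fin n) → Fin (ar i) → SType) (k : Fin n → ℕ) (cont : Fin n → SType) (i : Fin n) :
      Input (.bra (.name q) n lab ar pay k cont) (some q) (lab i) (List.ofFn (pay i)) (k i) (cont i)
        0
  | rep (r : Option Role) (n : ℕ) (lab : Fin n → Label) (ar : Fin n → ℕ)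
      (pay : (i : Fin n) → Fin (ar i) → SType) (k : Fin n → ℕ) (cont : Fin n → SType) (i : Fin n) :
      Input (.rep r n lab ar pay k cont) r (lab i) (List.ofFn (pay i)) (k i) (cont i)
        {.rep r n lab ar pay k cont}

/-- `React p q S₁ S₂ Y₁ Y₂`: communication from `p`, of type `S₁`, to `q`, of type `S₂`, leaves the
components `Y₁` and `Y₂`. -/
inductive React (p q : Role) : SType → SType → Multiset SType → Multiset SType → Prop
  | mk {n : ℕ} {tgt : Fin n → RoleE} {lab : Fin n → Label} {ar : Fin n → ℕ}
      {pay : (i : Fin n) → Fin (ar i) → SType} {rol : Fin n → List RoleE} {cont : Fin n → SType}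
      (i : Fin n) {S : SType} {r : Option Role} {Ss : List SType} {S' : SType}
      {keep : Multiset SType} (rs : List Role) :
      tgt i = .name q → rol i = rs.map .name → Input S r (lab i) Ss rs.length S' keep →
      (r = none ∨ r = some p) →
      List.Forall₂ SType.Sub ((List.ofFn (pay i)).map (SType.rshift (repDepth r rs.length))) Ss →
      React p q (.sel n tgt lab ar pay rol cont) S (cont i).comp
        (keep + (S'.rsubst (instRo (recvRoles r rs p))).comp)

/-- The receiver of type `S₂` at `q` offers all messages that the sender of type `S₁` at `p` may
select. -/
def Compat (p q : Role) (S₁ S₂ : SType) : Prop :=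
  ∀ {n : ℕ} {tgt : Fin n → RoleE} {lab : Fin n → Label} {ar : Fin n → ℕ}
    {pay : (i : Fin n) → Fin (ar i) → SType} {rol : Fin n → List RoleE} {cont : Fin n → SType},
    S₁ = .sel n tgt lab ar pay rol cont →
    ∀ r, (∃ m Ss k S' keep, Input S₂ r m Ss k S' keep) → (r = none ∨ r = some p) →
    ∀ i, tgt i = .name q → ∃ Ss S' keep, Input S₂ r (lab i) Ss (rol i).length S' keep ∧
      List.Forall₂ SType.Sub
        ((List.ofFn (pay i)).map (SType.rshift (repDepth r (rol i).length))) Ss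

namespace LCtx

/-- Reduction of linear contexts. -/
def Red (L L' : LCtx) : Prop :=
  ∃ (s : ℕ) (p q : Role) (S₁ S₂ : SType) (Y₁ Y₂ : Multiset SType) (L₀ : LCtx),
    React p q S₁ S₂ Y₁ Y₂ ∧ L = (.ep s p, S₁) ::ₘ (.ep s q, S₂) ::ₘ L₀ ∧
      L' = Y₁.map (Prod.mk (.ep s p)) + Y₂.map (Prod.mk (.ep s q)) + L₀

/-- The reflexive and transitive closure of reduction. -/
abbrev Reds : LCtx → LCtx → Prop := Relation.ReflTransGen Red

/-- Any two endpoints of the same session are compatible. -/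
def Compatible (L : LCtx) : Prop :=
  ∀ s p q S₁ S₂ L₀, L = (Chan.ep s p, S₁) ::ₘ (Chan.ep s q, S₂) ::ₘ L₀ → Compat p q S₁ S₂

/-- Compatibility is preserved by reduction. -/
def Safe (L : LCtx) : Prop := ∀ L', Reds L L' → L'.Compatible

theorem Red.add_right {L L' : LCtx} (h : Red L L') (K : LCtx) : Red (L + K) (L' + K) := by
  obtain ⟨s, p, q, S₁, S₂, Y₁, Y₂, L₀, hr, rfl, rfl⟩ := h
  exact ⟨s, p, q, S₁, S₂, Y₁, Y₂, L₀ + K, hr, by simp only [Multiset.cons_add],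
    by simp only [add_assoc]⟩

theorem Reds.add_right {L L' : LCtx} (h : Reds L L') (K : LCtx) : Reds (L + K) (L' + K) := by
  induction h with
  | refl => exact .refl
  | tail _ h ih => exact ih.tail (h.add_right K)

/-- Reductions of a part, and pairs of endpoints in its reducts, are also found in the whole. A
safety property itself need not hold of parts, hence the passage to `Safe`. -/
theorem Safe.left {L K : LCtx} (h : Safe (L + K)) : Safe L := fun _ hL s p q S₁ S₂ L₀ e =>
  h _ (hL.add_right K) s p q S₁ S₂ (L₀ + K) (by rw [e]; simp only [Multiset.cons_add])

theorem _root_.MPSTBang.SType.WF.of_mem_comp {S A : SType} (h : S.WF) (hA : A ∈ S.comp) : A.WF := by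
  obtain ⟨rfl, -⟩ := SType.mem_comp.1 hA
  exact h.nf

theorem _root_.MPSTBang.Input.wf {S S' : SType} {r : Option Role} {m : Label} {Ss : List SType}
    {k : ℕ} {keep : Multiset SType} (h : Input S r m Ss k S' keep) (hS : S.WF) :
    S'.WF ∧ (∀ A ∈ Ss, A.WF) ∧ ∀ A ∈ keep, A.WF := by
  cases h with
  | bra q n lab ar pay k cont i =>
    refine ⟨hS.2.2.2 i, fun A hA => ?_, by simp⟩
    obtain ⟨j, rfl⟩ := (List.mem_ofFn' _ _).1 hA
    exact hS.2.2.1 i j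
  | rep q n lab ar pay k cont i =>
    refine ⟨hS.2.2.2 i, fun A hA => ?_, by simpa using hS⟩
    obtain ⟨j, rfl⟩ := (List.mem_ofFn' _ _).1 hA
    exact hS.2.2.1 i j

theorem Red.wf {L L' : LCtx} (h : Red L L') (hL : ∀ x ∈ L, x.2.WF) : ∀ x ∈ L', x.2.WF := by
  obtain ⟨s, p, q, S₁, S₂, Y₁, Y₂, L₀, hr, rfl, rfl⟩ := h
  have h₁ : S₁.WF := hL (.ep s p, S₁) (by simp)
  have h₂ : S₂.WF := hL (.ep s q, S₂) (by simp)
  intro x hx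
  rcases Multiset.mem_add.1 hx with hx | hx
  · cases hr with
    | mk i rs h₃ h₄ h₅ h₆ h₇ =>
      rcases Multiset.mem_add.1 hx with hx | hx
      · obtain ⟨A, hA, rfl⟩ := Multiset.mem_map.1 hx
        exact SType.WF.of_mem_comp (h₁.2.2 i) hA
      · obtain ⟨A, hA, rfl⟩ := Multiset.mem_map.1 hx
        rcases Multiset.mem_add.1 hA with hA | hA
        · exact (h₅.wf h₂).2.2 A hA
        · exact SType.WF.of_mem_comp ((SType.wf_rsubst _ _).2 (h₅.wf h₂).1) hA
  · exact hL x (by simp [hx])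

theorem Reds.wf {L L' : LCtx} (h : Reds L L') (hL : ∀ x ∈ L, x.2.WF) : ∀ x ∈ L', x.2.WF := by
  induction h with
  | refl => exact hL
  | tail _ h ih => exact h.wf ih

/-- Two endpoints of the same session belong to the same part of a context. -/
theorem pair_of_renSess_add {L K L₀ : LCtx} (hK : K.Innermost) {s : ℕ} {p q : Role}
    {S₁ S₂ : SType} (e : L.renSess (· + 1) + K = (.ep s p, S₁) ::ₘ (.ep s q, S₂) ::ₘ L₀) :
    (∃ t M, s = t + 1 ∧ L = (.ep t p, S₁) ::ₘ (.ep t q, S₂) ::ₘ M ∧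
      L₀ = LCtx.renSess (· + 1) M + K) ∨
    ∃ M, s = 0 ∧ K = (.ep s p, S₁) ::ₘ (.ep s q, S₂) ::ₘ M ∧ L₀ = L.renSess (· + 1) + M := by
  classical
  -- `f` selects the components outside the innermost session. It separates the two summands, and it
  -- depends only on the session of an endpoint, so it treats the two given components alike.
  let f : Chan × SType → Prop := fun x => ∃ c : Chan, c.renSess (· + 1) = x.1
  let f' : Chan × SType → Prop := fun x => ¬ f x
  have hL : (L.renSess (· + 1)).filter f = L.renSess (· + 1) :=
    Multiset.filter_eq_self.2 fun x hx => LCtx.mem_renSess hx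
  have hL' : (L.renSess (· + 1)).filter f' = 0 :=
    Multiset.filter_eq_nil.2 fun x hx => not_not.2 (LCtx.mem_renSess hx)
  have hKf : ∀ x ∈ K, ¬ f x := by
    rintro x hx ⟨c, hc⟩
    obtain ⟨q, hq⟩ := hK x hx
    rw [hq] at hc
    cases c <;> simp [Chan.renSess] at hc
  have hK₁ : K.filter f = 0 := Multiset.filter_eq_nil.2 hKf
  have hK₂ : K.filter f' = K := Multiset.filter_eq_self.2 hKf
  have e₁ := congrArg (Multiset.filter f) e
  have e₂ := congrArg (Multiset.filter f') e
  rw [Multiset.filter_add, hL, hK₁, add_zero] at e₁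
  rw [Multiset.filter_add, hL', hK₂, zero_add] at e₂
  have hL₀ : L₀.filter f + L₀.filter f' = L₀ := Multiset.filter_add_not f L₀
  cases s with
  | zero =>
    have hf : ∀ p S, f' (.ep 0 p, S) := by
      rintro p S ⟨c, hc⟩
      cases c <;> simp [Chan.renSess] at hc
    right
    rw [Multiset.filter_cons_of_neg _ (hf _ _), Multiset.filter_cons_of_neg _ (hf _ _)] at e₁
    rw [Multiset.filter_cons_of_pos _ (hf _ _), Multiset.filter_cons_of_pos _ (hf _ _)] at e₂
    exact ⟨_, rfl, e₂, by rw [e₁, hL₀]⟩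
  | succ s =>
    have hf : ∀ p S, f (.ep (s + 1) p, S) := fun p S => ⟨.ep s p, rfl⟩
    have hf' : ∀ p S, ¬ f' (.ep (s + 1) p, S) := fun p S => not_not.2 (hf p S)
    left
    rw [Multiset.filter_cons_of_pos _ (hf _ _), Multiset.filter_cons_of_pos _ (hf _ _)] at e₁
    rw [Multiset.filter_cons_of_neg _ (hf' _ _), Multiset.filter_cons_of_neg _ (hf' _ _)] at e₂
    obtain ⟨M, hM⟩ := exists_renSess (L := L₀.filter f) (g := (· + 1)) fun x hx =>
      (Multiset.mem_filter.1 hx).2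
    refine ⟨s, M, rfl, ?_, by rw [← hM, e₂, hL₀]⟩
    refine renSess_injective (add_left_injective 1) ?_
    rw [e₁, hM]
    simp [LCtx.renSess, Chan.renSess]

/-- Sessions reduce independently. -/
theorem Red.of_renSess_add {L K X : LCtx} (hK : K.Innermost)
    (h : Red (L.renSess (· + 1) + K) X) :
    (∃ L', X = L'.renSess (· + 1) + K ∧ Red L L') ∨
      ∃ K' : LCtx, X = L.renSess (· + 1) + K' ∧ Red K K' ∧ K'.Innermost := by
  obtain ⟨s, p, q, S₁, S₂, Y₁, Y₂, L₀, hr, e, rfl⟩ := h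
  rcases pair_of_renSess_add hK e with ⟨t, M, rfl, rfl, rfl⟩ | ⟨M, rfl, rfl, rfl⟩
  · left
    have hmap : ∀ (p : Role) (Y : Multiset SType),
        LCtx.renSess (· + 1) (Y.map (Prod.mk (Chan.ep t p))) = Y.map (Prod.mk (.ep (t + 1) p)) := by
      intro p Y
      unfold LCtx.renSess
      rw [Multiset.map_map]; rfl
    refine ⟨_, ?_, ⟨t, p, q, S₁, S₂, Y₁, Y₂, M, hr, rfl, rfl⟩⟩
    rw [renSess_add, renSess_add, hmap, hmap, add_assoc _ _ K]
  · right
    refine ⟨_, ?_, ⟨0, p, q, S₁, S₂, Y₁, Y₂, M, hr, rfl, rfl⟩, ?_⟩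
    · exact add_left_comm _ _ _
    · intro x hx
      rcases Multiset.mem_add.1 hx with hx | hx
      · rcases Multiset.mem_add.1 hx with hx | hx
        all_goals
          obtain ⟨A, -, rfl⟩ := Multiset.mem_map.1 hx
          exact ⟨_, rfl⟩
      · exact hK x (by simp [hx])

/-- The reduct of `K` stays within the innermost session; carrying this along lets the one-step
statement apply again. -/
theorem Reds.of_renSess_add {L K X : LCtx} (hK : K.Innermost)
    (h : Reds (L.renSess (· + 1) + K) X) :
    ∃ L' K' : LCtx, X = L'.renSess (· + 1) + K' ∧ Reds L L' ∧ Reds K K' ∧ K'.Innermost := by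
  induction h with
  | refl => exact ⟨L, K, rfl, .refl, .refl, hK⟩
  | tail _ h ih =>
    obtain ⟨L', K', rfl, h₁, h₂, h₃⟩ := ih
    rcases h.of_renSess_add h₃ with ⟨L'', rfl, h₄⟩ | ⟨K'', rfl, h₄, h₅⟩
    · exact ⟨L'', K', rfl, h₁.tail h₄, h₂, h₃⟩
    · exact ⟨L', K'', rfl, h₁, h₂.tail h₄, h₅⟩

/-- Every reduct is a sum of reducts of the two parts, and compatibility concerns pairs within one
session, which lie in the same part. -/
theorem Safe.renSess_add {L K : LCtx} (hK : K.Innermost) (h₁ : L.Safe) (h₂ : K.Safe) :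
    (L.renSess (· + 1) + K).Safe := by
  intro X hX s p q S₁ S₂ L₀ e
  obtain ⟨L', K', rfl, hL, hK', hi⟩ := Reds.of_renSess_add hK hX
  rcases pair_of_renSess_add hi e with ⟨t, M, -, e', -⟩ | ⟨M, -, e', -⟩
  · exact h₁ _ hL t p q S₁ S₂ M e'
  · exact h₂ _ hK' s p q S₁ S₂ M e'

end LCtx

/-! ### Simulation by context reduction -/

namespace Ctx

/-- Add role variables to a context. -/
theorem _root_.MPSTBang.Trans.add_roles {Γ Γ' : Ctx} {γ : Act} (h : Trans Γ γ Γ') (A : Finset ℕ) :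
    Trans (Γ.add ⟨fun _ => none, A⟩) γ (Γ'.add ⟨fun _ => none, A.image (· + γ.depth)⟩) := by
  induction A using Finset.induction with
  | empty =>
    have e : ∀ Γ : Ctx, Γ.add ⟨fun _ => none, ∅⟩ = Γ := fun Γ => by
      ext c <;> simp [Ctx.add]
      cases Γ.ch c <;> simp [parEntry]
    simpa [e] using h
  | insert a A ha ih =>
    have e : ∀ (Γ : Ctx) (a : ℕ) (A : Finset ℕ), Γ.add ⟨fun _ => none, insert a A⟩ =
        (Γ.add ⟨fun _ => none, A⟩).add (.role a) := fun Γ a A => by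
      ext c
      · simp only [Ctx.add, Ctx.role]
        cases Γ.ch c <;> simp [parEntry]
      · simp only [Ctx.add, Ctx.role, Finset.mem_union, Finset.mem_insert, Finset.mem_singleton]
        tauto
    rw [Finset.image_insert, e, e]
    exact ih.role a

theorem add_roles_single (c : Chan) (S : SType) (A : Finset ℕ) :
    (single c S).add ⟨fun _ => none, A⟩ = entry c S A := by
  ext c'
  · simp only [add, single]
    have : ((entry c S A).ch c') = ((entry c S ∅).ch c') := rfl
    rw [this]
    cases (entry c S ∅).ch c' <;> rfl
  · simp [add, single, entry]

theorem Lists.inst {Γ : Ctx} {L : LCtx} (h : Γ.Lists L) (rs : List Role) :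
    (Γ.inst rs).Lists (L.map (Prod.map id (SType.rsubst (instRo rs)))) :=
  h.map Function.injective_id _ (fun _ => rfl) fun c hc => absurd ⟨c, rfl⟩ hc

@[simp] theorem dom_inst (Γ : Ctx) (rs : List Role) : (Γ.inst rs).dom = Γ.dom := by
  ext c; simp [mem_dom, inst]

@[simp] theorem dom_lift_zero (Γ : Ctx) (k : ℕ) : (Γ.lift 0 k).dom = Γ.dom := by
  ext c; cases c <;> simp [mem_dom, lift]

theorem lists_add_roles {Γ : Ctx} {L : LCtx} (h : Γ.Lists L) (A : Finset ℕ) :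
    (Γ.add ⟨fun _ => none, A⟩).Lists L := by
  have := h.add (lists_of_none (Γ := ⟨fun _ => none, A⟩) fun _ => rfl)
  rwa [add_zero] at this

theorem dom_add_roles (Γ : Ctx) (A : Finset ℕ) : (Γ.add ⟨fun _ => none, A⟩).dom = Γ.dom := by
  rw [dom_add]
  have : (⟨fun _ => none, A⟩ : Ctx).dom = ∅ := by ext c; simp [mem_dom]
  rw [this, Set.union_empty]

end Ctx

theorem SType.comp_of_nf {S : SType} (h : S.nf = S ∧ S ≠ .fin) : S.comp = {S} := by
  have := SType.comp_of_ne (S := S) (by rw [h.1]; exact h.2)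
  rwa [h.1] at this

theorem LCtx.ent_of_nf (c : Chan) {S : SType} (h : S.nf = S ∧ S ≠ .fin) : ent c S = {(c, S)} := by
  rw [ent, SType.comp_of_nf h]; rfl

/-- After an input the context is in the scope of the bound roles, which is why the component kept
by a replicated receive appears weakened. -/
theorem Input.trans {S S' : SType} {r : Option Role} {m : Label} {Ss : List SType} {k : ℕ}
    {keep : Multiset SType} (h : Input S r m Ss k S' keep) (hS : S.nf = S ∧ S ≠ .fin) (s : ℕ)
    (q : Role) :
    ∃ Γ : Ctx, Trans (.single (.ep s q) S) (.inp s q r m Ss k) Γ ∧ Γ.ro = ∅ ∧ Γ.dom = {.ep s q} ∧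
      Γ.Lists ((keep.map (SType.rshift (repDepth r k))).map (Prod.mk (.ep s q)) +
        LCtx.ent (.ep s q) S') := by
  cases h with
  | bra q' n lab ar pay k cont i =>
    exact ⟨_, .rcv s q q' n lab ar pay k cont i, rfl, by simp, by
      simpa using Ctx.single_lists _ _⟩
  | rep r n lab ar pay k cont i =>
    refine ⟨_, .bang s q r n lab ar pay k cont i, rfl, by simp, ?_⟩
    refine Ctx.Lists.add ?_ (Ctx.single_lists _ _)
    have := Ctx.single_lists (.ep s q) ((SType.rep r n lab ar pay k cont).rshift (repDepth r (k i)))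
    rwa [LCtx.ent, SType.rshift, SType.comp_rsubst, SType.comp_of_nf hS] at this

theorem Ctx.inst_ro_image (A : Finset ℕ) (rs : List Role) :
    ((A.image (· + rs.length)).filter (rs.length ≤ ·)).image (· - rs.length) = A := by
  ext a
  simp only [Finset.mem_image, Finset.mem_filter]
  constructor
  · rintro ⟨_, ⟨⟨b, hb, rfl⟩, -⟩, rfl⟩
    simpa using hb
  · intro ha
    exact ⟨a + rs.length, ⟨⟨a, ha, rfl⟩, by omega⟩, by omega⟩

theorem LCtx.map_rshift_instRo (m : Multiset SType) (rs : List Role) :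
    (m.map (SType.rshift rs.length)).map (SType.rsubst (instRo rs)) = m := by
  rw [Multiset.map_map]
  simp

/-- The frame of a receiver is weakened by the input and restored by the communication. -/
theorem LCtx.up_zero_instRo (L : LCtx) (rs : List Role) :
    (L.up 0 rs.length).map (Prod.map id (SType.rsubst (instRo rs))) = L := by
  unfold LCtx.up
  rw [Multiset.map_map]
  conv_rhs => rw [← Multiset.map_id L]
  refine Multiset.map_congr rfl fun x _ => ?_
  rcases x with ⟨⟨s, q⟩ | x, S⟩ <;> simp [Chan.shift]

/-- Contexts simulate the reductions of their linear contexts. -/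
theorem LCtx.Red.simulate {Γ : Ctx} {L L' : LCtx} (h : LCtx.Red L L') (hL : Γ.Lists L) :
    ∃ Γ' : Ctx, Γ.Red Γ' ∧ Γ'.ro = Γ.ro ∧ Γ'.dom = Γ.dom ∧ Γ'.Lists L' := by
  obtain ⟨s, p, q, S₁, S₂, Y₁, Y₂, L₀, hr, rfl, rfl⟩ := h
  have hp := hL.over (.ep s p, S₁) (by simp)
  have hq := hL.over (.ep s q, S₂) (by simp)
  -- `Γ₂` holds the receiver together with the frame `Γ₀`, and the sender stands alone. The full
  -- domain is given to both `Γ₂` and `Γ₀`, so the reduct loses no channel.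
  obtain ⟨Γ₂, hro₂, hd₂, hl₂⟩ := Ctx.exists_of_over Γ.ro (D := Γ.dom)
    (L := (.ep s q, S₂) ::ₘ L₀) fun x hx => hL.over x (Multiset.mem_cons_of_mem hx)
  obtain ⟨Γ₀, hro₀, hd₀, hl₀⟩ := Ctx.exists_of_over Γ.ro (D := Γ.dom)
    (L := L₀) fun x hx => hL.over x (Multiset.mem_cons_of_mem (Multiset.mem_cons_of_mem hx))
  have hl₁ : (Ctx.entry (.ep s p) S₁ Γ.ro).Lists {(.ep s p, S₁)} := by
    rw [← LCtx.ent_of_nf _ hp.2]; exact Ctx.entry_lists _ _ _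
  have hl₃ : (Ctx.entry (.ep s q) S₂ Γ.ro).Lists {(.ep s q, S₂)} := by
    rw [← LCtx.ent_of_nf _ hq.2]; exact Ctx.entry_lists _ _ _
  have hs₁ : Γ.Split (.entry (.ep s p) S₁ Γ.ro) Γ₂ :=
    Ctx.Lists.split (L₁ := {(.ep s p, S₁)}) hL hl₁ hl₂
      (by rw [hd₂, Ctx.dom_entry, Set.union_eq_self_of_subset_left]; simpa using hp.1) rfl hro₂
  have hs₂ : Γ₂.Split (.entry (.ep s q) S₂ Γ.ro) Γ₀ :=
    Ctx.Lists.split (L₁ := {(.ep s q, S₂)}) hl₂ hl₃ hl₀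
      (by rw [hd₂, hd₀, Ctx.dom_entry, Set.union_eq_self_of_subset_left]; simpa using hq.1)
      hro₂.symm (hro₀.trans hro₂.symm)
  cases hr with
  | @mk n tgt lab ar pay rol cont i _ r Ss S' keep rs htgt hrol hin hfrom hpay =>
    have ht₁ := (Trans.snd s p q n tgt lab ar pay rol cont i htgt).add_roles Γ.ro
    rw [Ctx.add_roles_single, hrol] at ht₁
    obtain ⟨Γ₃, ht, hro₃, hd₃, hl₃⟩ := hin.trans hq.2 s q
    have ht₂ := ht.add_roles Γ.ro
    rw [Ctx.add_roles_single] at ht₂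
    have ht₂ := Trans.cong hs₂ ht₂
    have hlen := length_recvRoles r rs p
    refine ⟨((Ctx.single (.ep s p) (cont i)).add ⟨fun _ => none, Γ.ro.image (· + 0)⟩).add
        (((Γ₃.add ⟨fun _ => none, Γ.ro.image (· + repDepth r rs.length)⟩).add
          (Γ₀.lift 0 (repDepth r rs.length))).inst (recvRoles r rs p)),
      ⟨s, p, q, lab i, ?_⟩, ?_, ?_, ?_⟩
    -- `recvRoles` unfolds to the list that each of the two communication rules instantiates; a
    -- universal receive adds the sender.
    · rcases hfrom with rfl | rfl
      · exact Trans.com₂ hs₁ ht₁ ht₂ hpay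
      · exact Trans.com₁ hs₁ ht₁ ht₂ hpay
    · have e : ((Γ₃.add ⟨fun _ => none, Γ.ro.image (· + repDepth r rs.length)⟩).add
          (Γ₀.lift 0 (repDepth r rs.length))).ro =
            Γ.ro.image (· + (recvRoles r rs p).length) := by
        simp [Ctx.add, Ctx.lift, hro₃, hro₀, hlen]
      show (∅ ∪ Γ.ro.image (· + 0)) ∪ ((_ : Ctx).ro.filter _).image _ = _
      rw [e, Ctx.inst_ro_image]
      simp
    · rw [Ctx.dom_add, Ctx.dom_add_roles, Ctx.dom_inst, Ctx.dom_add, Ctx.dom_add_roles, hd₃,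
        Ctx.dom_lift_zero, hd₀, Ctx.dom_single, Set.singleton_union, Set.singleton_union,
        Set.insert_eq_of_mem hq.1, Set.insert_eq_of_mem hp.1]
    · have h₁ := Ctx.lists_add_roles (Ctx.single_lists (.ep s p) (cont i)) (Γ.ro.image (· + 0))
      have h₂ := ((Ctx.lists_add_roles hl₃ (Γ.ro.image (· + repDepth r rs.length))).add
        (hl₀.lift 0 (repDepth r rs.length))).inst (recvRoles r rs p)
      have h₃ := h₁.add h₂
      rw [Multiset.map_add, Multiset.map_add, LCtx.ent_map, ← hlen, LCtx.up_zero_instRo,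
        Multiset.map_map] at h₃
      -- Weakening and instantiation cancel on the component of a replicated receiver.
      have e : (keep.map (SType.rshift (recvRoles r rs p).length)).map
          (Prod.map id (SType.rsubst (instRo (recvRoles r rs p))) ∘ Prod.mk (Chan.ep s q)) =
          keep.map (Prod.mk (Chan.ep s q)) := by
        conv_rhs => rw [← LCtx.map_rshift_instRo keep (recvRoles r rs p), Multiset.map_map]
        rfl
      rw [e] at h₃
      simp only [Multiset.map_add, add_assoc, hlen] at h₃ ⊢
      exact h₃

theorem LCtx.Reds.simulate {Γ : Ctx} {L L' : LCtx} (h : LCtx.Reds L L') (hL : Γ.Lists L) :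
    ∃ Γ' : Ctx, Γ.Reds Γ' ∧ Γ'.ro = Γ.ro ∧ Γ'.dom = Γ.dom ∧ Γ'.Lists L' := by
  induction h with
  | refl => exact ⟨Γ, .refl, rfl, rfl, hL⟩
  | tail _ h ih =>
    obtain ⟨Γ', hr, h₁, h₂, h₃⟩ := ih
    obtain ⟨Γ'', hr', h₁', h₂', h₃'⟩ := h.simulate h₃
    exact ⟨Γ'', hr.tail hr', h₁'.trans h₁, h₂'.trans h₂, h₃'⟩

theorem IsSafety.reds {φ : Ctx → Prop} (hφ : IsSafety φ) {Γ Γ' : Ctx} (h : φ Γ)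
    (hr : Γ.Reds Γ') : φ Γ' := by
  induction hr with
  | refl => exact h
  | tail _ hr ih => exact hφ.red _ _ ih hr

/-- The clauses of safety refer to explicit entries. As splits are up to congruence, the two
components can be split off as such entries in their head normal forms. -/
theorem IsSafety.compatible {φ : Ctx → Prop} (hφ : IsSafety φ) {Γ : Ctx} (h : φ Γ) {L : LCtx}
    (hL : Γ.Lists L) : L.Compatible := by
  rintro s p q S₁ S₂ L₀ rfl n tgt lab ar pay rol cont rfl r ⟨m, Ss, k, S', keep, hin⟩ hr i hi
  have hp := hL.over (.ep s p, _) (Multiset.mem_cons_self _ _)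
  have hq := hL.over (.ep s q, S₂) (by simp)
  obtain ⟨Γ₁, hro₁, hd₁, hl₁⟩ := Ctx.exists_of_over Γ.ro (D := Γ.dom)
    (L := (.ep s p, _) ::ₘ L₀) fun x hx => hL.over x (by
      rcases Multiset.mem_cons.1 hx with rfl | hx
      · exact Multiset.mem_cons_self _ _
      · exact Multiset.mem_cons_of_mem (Multiset.mem_cons_of_mem hx))
  obtain ⟨Γ₀, hro₀, hd₀, hl₀⟩ := Ctx.exists_of_over Γ.ro (D := Γ.dom)
    (L := L₀) fun x hx => hL.over x (Multiset.mem_cons_of_mem (Multiset.mem_cons_of_mem hx))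
  have hlp := Ctx.entry_lists (.ep s p) (SType.sel n tgt lab ar pay rol cont) Γ.ro
  rw [LCtx.ent_of_nf _ hp.2] at hlp
  have hlq := Ctx.entry_lists (.ep s q) S₂ Γ.ro
  rw [LCtx.ent_of_nf _ hq.2] at hlq
  have hs₁ : Γ.Split Γ₁ (.entry (.ep s q) S₂ Γ.ro) := by
    refine Ctx.Lists.split ?_ hl₁ hlq (by
      rw [hd₁, Ctx.dom_entry, Set.union_eq_self_of_subset_right]; simpa using hq.1) hro₁ rfl
    rw [← Multiset.singleton_add, ← Multiset.singleton_add] at hL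
    rw [← Multiset.singleton_add]
    convert hL using 1
    abel
  have hs₂ : Γ₁.Split Γ₀ (.entry (.ep s p) (.sel n tgt lab ar pay rol cont) Γ.ro) := by
    refine Ctx.Lists.split ?_ hl₀ hlp (by
      rw [hd₁, hd₀, Ctx.dom_entry, Set.union_eq_self_of_subset_right]; simpa using hp.1)
      (hro₀.trans hro₁.symm) hro₁.symm
    rw [add_comm, Multiset.singleton_add]
    exact hl₁
  cases hin with
  | bra q' n' lab' ar' pay' k' cont' i' =>
    obtain rfl : q' = p := by simpa using hr
    obtain ⟨j, h₁, h₂, h₃⟩ := hφ.com _ _ _ _ _ _ _ _ _ _ _ _ _ _ _ _ _ _ _ h hs₁ hs₂ i hi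
    exact ⟨_, cont' j, 0, by rw [h₁, h₂]; exact .bra .., by rw [h₂]; exact h₃⟩
  | rep r n' lab' ar' pay' k' cont' i' =>
    obtain ⟨j, h₁, h₂, h₃⟩ := hφ.bang _ _ _ _ _ _ _ _ _ _ _ _ _ _ _ _ _ _ _ _ h hs₁ hs₂ hr i hi
    exact ⟨_, cont' j, {.rep r n' lab' ar' pay' k' cont'}, by rw [h₁, h₂]; exact .rep ..,
      by rw [h₂]; exact h₃⟩

/-- Each linear reduct is listed by a context reduct, where the safety property still holds. -/
theorem IsSafety.safe {φ : Ctx → Prop} (hφ : IsSafety φ) {Γ : Ctx} (h : φ Γ) {L : LCtx}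
    (hL : Γ.Lists L) : L.Safe := by
  intro L' hr
  obtain ⟨Γ', hr', -, -, hL'⟩ := hr.simulate hL
  exact hφ.compatible (hφ.reds h hr') hL'

/-! ### From typing to linear typing -/

theorem ChanTyped.mono {D D' : Set Chan} {L : LCtx} {c : Chan} {S : SType}
    (h : ChanTyped D L c S) (hD : D ⊆ D') : ChanTyped D' L c S := ⟨hD h.1, h.2⟩

theorem ChansTyped.mono {D D' : Set Chan} {L : LCtx} {cs : List Chan} {Ss : List SType}
    (h : ChansTyped D L cs Ss) (hD : D ⊆ D') : ChansTyped D' L cs Ss := by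
  induction h with
  | nil => exact .nil
  | cons h _ ih => exact .cons (h.mono hD) ih

theorem Ctx.Cong.lists_left {Γ Γ₁ Γ₂ : Ctx} (h : Γ.Cong (Γ₁.add Γ₂)) (h₂ : Γ₂.End) {L : LCtx}
    (hL : Γ.Lists L) : Γ₁.Lists L := fun c => by
  have e := h.lists' hL c
  have e' : entComps (Γ₂.ch c) = 0 := ((Ctx.end_iff_lists _).1 h₂ c).symm
  rw [e]
  exact (entComps_parEntry _ _).trans (by rw [e', add_zero])

/-- Weakening by an end-typed context enlarges the domain but adds no component, so everything is
decided at the subtyping axiom. -/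
theorem ValTyped.chan_inv {Γ : Ctx} {c : Chan} {T : Ty} (h : ValTyped Γ (.chan c) T) :
    ∃ S, T = .sess S ∧ ∀ L, Γ.Lists L → ChanTyped Γ.dom L c S := by
  generalize hV : Val.chan c = V at h
  induction h with
  | wkn hc _ hE ih =>
    obtain ⟨S, rfl, h⟩ := ih hV
    refine ⟨S, rfl, fun L hL => (h L (hc.lists_left hE hL)).mono ?_⟩
    rw [((Ctx.cong_iff _ _).1 hc).2.1, Ctx.dom_add]
    exact Set.subset_union_left
  | @sub c' S S' hS hS' h =>
    cases hV
    refine ⟨_, rfl, fun L hL => ?_⟩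
    rw [hL.unique (Ctx.single_lists _ _)]
    refine ⟨by simp, hS', ?_⟩
    by_cases e : S.nf = .fin
    · right
      exact ⟨(h.nf_eq_fin_iff hS hS').1 e, by rw [LCtx.ent, SType.comp_of_fin e]; rfl⟩
    · left
      exact ⟨_, hS.nrm_nf e, (SType.sub_nf_left hS).2 h, by
        rw [LCtx.ent, SType.comp_of_ne e]; rfl⟩
  | roleName => cases hV
  | roleVar => cases hV

theorem ValTyped.role_inv {Γ : Ctx} {ρ : RoleE} {T : Ty} (h : ValTyped Γ (.role ρ) T) :
    T = .role ρ ∧ ρ.In ↑Γ.ro ∧ Γ.Lists 0 := by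
  generalize hV : Val.role ρ = V at h
  induction h with
  | wkn hc _ hE ih =>
    obtain ⟨rfl, h, hl⟩ := ih hV
    refine ⟨rfl, ?_, ?_⟩
    · intro a ha
      rw [hc.1]
      exact Finset.mem_coe.2 (Finset.mem_union_left _ (h a ha))
    · have := hl.add ((Ctx.end_iff_lists _).1 hE)
      rw [add_zero] at this
      exact hc.lists this
  | sub => cases hV
  | roleName =>
    cases hV
    exact ⟨rfl, (fun a ha => by cases ha), Ctx.lists_of_none (Γ := .empty) fun _ => rfl⟩
  | roleVar a =>
    cases hV
    exact ⟨rfl, (fun a ha => by cases ha; simp [Ctx.role]),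
      Ctx.lists_of_none (Γ := .role a) fun _ => rfl⟩

/-- Role values consume no components, so the whole of `L` is passed on. -/
theorem ValsTyped.roles_inv {Γ Γ₀ : Ctx} {W : List RoleE} {Ts : List Ty}
    (h : ValsTyped Γ Γ₀ (W.map .role) Ts) (hw : Γ.WF) {L : LCtx} (hL : Γ.Lists L) :
    Ts = W.map .role ∧ (∀ ρ ∈ W, ρ.In ↑Γ.ro) ∧ Γ₀.Lists L ∧ Γ₀.ro = Γ.ro ∧ Γ₀.dom ⊆ Γ.dom ∧
      Γ₀.WF := by
  induction W generalizing Γ Ts L with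
  | nil => cases h; exact ⟨rfl, by simp, hL, rfl, subset_rfl, hw⟩
  | cons ρ W ih =>
    cases h with
    | cons hs hv h =>
      obtain ⟨rfl, hρ, h₀⟩ := hv.role_inv
      obtain ⟨hw₁, hw₂, hd₁, hd₂, hl⟩ := hs.exists_lists hw
      obtain ⟨L₁, L₂, h₁, h₂, rfl⟩ := hl L hL
      obtain rfl := h₂.unique h₀
      rw [add_zero]
      obtain ⟨rfl, hW, hl₀, hr, hd, hw₀⟩ := ih h hw₁ h₁
      refine ⟨rfl, ?_, hl₀, hr.trans hs.1, hd.trans hd₁, hw₀⟩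
      intro ρ' hρ'
      rcases List.mem_cons.1 hρ' with rfl | hρ'
      · rw [← hs.2.1]; exact hρ
      · rw [← hs.1]; exact hW ρ' hρ'

theorem ValsTyped.inv {Γ Γ₀ : Ctx} {V : List Chan} {W rs : List RoleE} {Ss : List SType}
    (h : ValsTyped Γ Γ₀ (V.map .chan ++ W.map .role) (Ss.map .sess ++ rs.map .role)) (hw : Γ.WF)
    {L : LCtx} (hL : Γ.Lists L) :
    rs = W ∧ (∀ ρ ∈ W, ρ.In ↑Γ.ro) ∧ Γ₀.ro = Γ.ro ∧ Γ₀.dom ⊆ Γ.dom ∧ Γ₀.WF ∧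
      ∃ L₀ L₁, L = L₀ + L₁ ∧ Γ₀.Lists L₀ ∧ ChansTyped Γ.dom L₁ V Ss := by
  induction V generalizing Γ Ss L with
  | nil =>
    obtain ⟨e, hW, hl, hr, hd, hw₀⟩ := ValsTyped.roles_inv h hw hL
    have hS : Ss = [] := by
      cases Ss with
      | nil => rfl
      | cons S Ss => cases W <;> simp at e
    subst hS
    have : rs = W := List.map_injective_iff.2 (fun _ _ h => by cases h; rfl) e
    exact ⟨this, hW, hr, hd, hw₀, L, 0, (add_zero L).symm, hl, .nil⟩
  | cons c V ih =>
    -- Session and role payloads are concatenated in one list, so the boundary between them must be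
    -- shown to agree for values and types.
    cases Ss with
    | nil =>
      cases rs with
      | nil => cases h
      | cons ρ rs =>
        cases h with
        | cons _ hv _ =>
          obtain ⟨S, e, -⟩ := hv.chan_inv
          cases e
    | cons S Ss =>
      cases h with
      | cons hs hv h =>
        obtain ⟨S, e, hc⟩ := hv.chan_inv
        cases e
        obtain ⟨hw₁, hw₂, hd₁, hd₂, hl⟩ := hs.exists_lists hw
        obtain ⟨L₁, L₂, h₁, h₂, rfl⟩ := hl L hL
        obtain ⟨rfl, hW, hr, hd, hw₀, M₀, M₁, rfl, hM, hcs⟩ := ih h hw₁ h₁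
        rw [hs.1] at hW hr
        exact ⟨rfl, hW, hr, hd.trans hd₁, hw₀, M₀, L₂ + M₁, by rw [add_assoc, add_comm M₁], hM,
          .cons ((hc L₂ h₂).mono hd₂) (hcs.mono hd₁)⟩

/-! ### Well-formedness and finiteness of the contexts under binders -/

/-- All types of the linear context are well-formed. -/
def LCtx.WF (L : LCtx) : Prop := ∀ x ∈ L, x.2.WF

theorem LCtx.WF.add {L L' : LCtx} (h : L.WF) (h' : L'.WF) : (L + L').WF := fun x hx =>
  (Multiset.mem_add.1 hx).elim (h x) (h' x)

theorem LCtx.wf_ent {S : SType} (h : S.WF) (c : Chan) : (ent c S).WF := by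
  intro x hx
  obtain ⟨A, hA, rfl⟩ := Multiset.mem_map.1 hx
  exact h.of_mem_comp hA

theorem LCtx.wf_entFn {n : ℕ} {S : Fin n → SType} (h : ∀ i, (S i).WF) : (entFn S).WF := by
  intro x hx
  obtain ⟨i, -, hi⟩ := Multiset.mem_sum.1 hx
  exact wf_ent (h i) _ x hi

theorem LCtx.WF.up {L : LCtx} (h : L.WF) (n k : ℕ) : (L.up n k).WF := by
  intro x hx
  obtain ⟨y, hy, rfl⟩ := Multiset.mem_map.1 hx
  exact (SType.wf_rsubst _ _).2 (h y hy)

theorem LCtx.WF.renSess {L : LCtx} (h : L.WF) (g : ℕ → ℕ) : (L.renSess g).WF := by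
  intro x hx
  obtain ⟨y, hy, rfl⟩ := Multiset.mem_map.1 hx
  exact h y hy

theorem Ctx.WF.lctx {Γ : Ctx} (h : Γ.WF) {L : LCtx} (hL : Γ.Lists L) : L.WF :=
  ((Ctx.wf_iff hL).1 h).2

theorem upDom_finite {D : Set Chan} (h : D.Finite) (n : ℕ) : (upDom n D).Finite := by
  refine ((h.image (Chan.shift n)).union ((Set.finite_lt_nat n).image Chan.var)).subset ?_
  rintro (⟨s, q⟩ | x) hc
  · exact Or.inl ⟨_, hc, rfl⟩
  · by_cases hx : x < n
    · exact Or.inr ⟨x, hx, rfl⟩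
    · refine Or.inl ⟨_, hc.resolve_left hx, ?_⟩
      simp only [Chan.shift, Chan.var.injEq]; omega

theorem nuDom_finite {D : Set Chan} (h : D.Finite) {Ψ : Protocol} (hΨ : {q | Ψ q ≠ none}.Finite) :
    (nuDom Ψ D).Finite := by
  refine ((h.image (Chan.renSess (· + 1))).union (hΨ.image (Chan.ep 0))).subset ?_
  rintro (⟨_ | s, q⟩ | x) hc
  · exact Or.inr ⟨q, hc, rfl⟩
  · exact Or.inl ⟨.ep s q, hc, rfl⟩
  · exact Or.inl ⟨.var x, hc, rfl⟩

theorem Protocol.WF.lctx {Ψ : Protocol} (h : Ψ.WF) {K : LCtx} (hK : Ψ.assoc.Lists K) : K.WF := by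
  refine Ctx.WF.lctx (Γ := Ψ.assoc) ⟨?_, ?_⟩ hK
  · refine (h.1.image (Chan.ep 0)).subset ?_
    rintro (⟨_ | s, q⟩ | x) hc
    · exact ⟨q, hc, rfl⟩
    · exact absurd rfl hc
    · exact absurd rfl hc
  · rintro (⟨_ | s, q⟩ | x) U hc
    · exact h.2 q U hc
    · cases hc
    · cases hc

theorem Protocol.exists_lists {Ψ : Protocol} (h : Ψ.WF) : ∃ K, Ψ.assoc.Lists K := by
  refine Ctx.exists_lists ((h.1.image (Chan.ep 0)).subset ?_)
  rintro (⟨_ | s, q⟩ | x) hc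
  · exact ⟨q, hc, rfl⟩
  · exact absurd rfl hc
  · exact absurd rfl hc

/-- The context of a branch of a receive. -/
def Ctx.branch (Γ : Ctx) (c : Chan) (S : SType) {n : ℕ} (pay : Fin n → SType) (k : ℕ) : Ctx :=
  (((Γ.lift n k).add (.single (c.shift n) S)).add (.binders pay)).add (.roles k)

theorem Ctx.Lists.branch {Γ : Ctx} {L : LCtx} (h : Γ.Lists L) (c : Chan) (S : SType) {n : ℕ}
    (pay : Fin n → SType) (k : ℕ) :
    (Γ.branch c S pay k).Lists (L.up n k + LCtx.ent (c.shift n) S + LCtx.entFn pay) := by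
  have := (((h.lift n k).add (Ctx.single_lists (c.shift n) S)).add (Ctx.binders_lists pay)).add
    (Ctx.roles_lists k)
  rwa [add_zero] at this

theorem Ctx.dom_branch (Γ : Ctx) (c : Chan) (S : SType) {n : ℕ} (pay : Fin n → SType) (k : ℕ) :
    (Γ.branch c S pay k).dom = upDom n Γ.dom ∪ {c.shift n} := by
  simp only [Ctx.branch, Ctx.dom_add, Ctx.dom_single, Ctx.dom_roles, Ctx.dom_binders,
    Set.union_empty]
  rw [Set.union_right_comm, Ctx.dom_lift_union]

theorem Ctx.ro_branch (Γ : Ctx) (c : Chan) (S : SType) {n : ℕ} (pay : Fin n → SType) (k : ℕ) :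
    (↑(Γ.branch c S pay k).ro : Set ℕ) = upRoles k ↑Γ.ro := by
  rw [← upRoles_coe]
  simp [Ctx.branch, Ctx.add, Ctx.lift, Ctx.single, Ctx.entry, Ctx.binders, Ctx.roles]

theorem Ctx.dom_lift_add_binders (Γ : Ctx) (k : ℕ) {n : ℕ} (S : Fin n → SType) :
    ((Γ.lift n k).add (.binders S)).dom = upDom n Γ.dom := by
  rw [Ctx.dom_add, Ctx.dom_binders, Ctx.dom_lift_union]

theorem Ctx.ro_lift_zero_add_binders (Γ : Ctx) {n : ℕ} (S : Fin n → SType) :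
    ((Γ.lift n 0).add (.binders S)).ro = Γ.ro := by
  simp [Ctx.add, Ctx.lift, Ctx.binders]

theorem LCtx.up_zero_left (n k : ℕ) : LCtx.up n k 0 = 0 := rfl

/-- Typing implies linear typing. -/
theorem Typed.ltyped {Θ : PCtx} {Γ : Ctx} {P : Proc} (h : Typed Θ Γ P) (hw : Γ.WF) {L : LCtx}
    (hL : Γ.Lists L) : LTyped P Θ ↑Γ.ro Γ.dom L := by
  induction h generalizing L with
  | nil h => exact hL.unique ((Ctx.end_iff_lists _).1 h)
  | par hs _ _ ih₁ ih₂ =>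
    obtain ⟨hw₁, hw₂, hd₁, hd₂, hl⟩ := hs.exists_lists hw
    obtain ⟨L₁, L₂, h₁, h₂, rfl⟩ := hl L hL
    have k₁ := ih₁ hw₁ h₁
    have k₂ := ih₂ hw₂ h₂
    rw [hs.1] at k₁
    rw [hs.2.1] at k₂
    exact ⟨L₁, L₂, rfl, k₁.mono subset_rfl hd₁, k₂.mono subset_rfl hd₂⟩
  | @nu Θ Γ P Ψ φ hΨ hφ hs _ ih =>
    obtain ⟨K, hK⟩ := Protocol.exists_lists hΨ
    refine ⟨Ψ, φ, K, hΨ, hφ, hs, hK, ?_⟩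
    have hl := hL.liftSess.add hK
    have := ih ((Ctx.wf_iff hl).2 ⟨?_, ((hw.lctx hL).renSess _).add (hΨ.lctx hK)⟩) hl
    · rw [Ctx.dom_liftSess_add] at this
      refine this.mono ?_ subset_rfl
      simp [Ctx.add, Ctx.liftSess, Protocol.assoc]
    · rw [Ctx.dom_liftSess_add]
      exact nuDom_finite hw.1 hΨ.1
  -- A single send is a sum with one summand, whose linear typing is the one required.
  | sum hn _ ih => exact ⟨hn, fun i => (ih i hw hL).2 0⟩
  | @snd Θ Δ Δ' Δ'' Γ Γs Γr c ρ m V W P a pay rs S hv hs₁ hs₂ hc hρ _ ih =>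
    obtain ⟨rfl, hW, hr, hd, hw', L₀, L₁, rfl, h₀, hcs⟩ := hv.inv hw hL
    obtain ⟨hw₁, -, hd₁, -, hl₁⟩ := hs₁.exists_lists hw'
    obtain ⟨M₁, M₂, hM₁, hM₂, rfl⟩ := hl₁ L₀ h₀
    obtain ⟨-, hρ, hρ₀⟩ := hρ.role_inv
    obtain rfl := hM₂.unique hρ₀
    obtain ⟨hw₂, hw₃, hd₂, hd₃, hl₂⟩ := hs₂.exists_lists hw₁
    obtain ⟨N₁, N₂, hN₁, hN₂, rfl⟩ := hl₂ M₁ hM₁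
    obtain ⟨_, e, hc⟩ := hc.chan_inv
    cases e
    have hc := (hc N₂ hN₂).mono (hd₃.trans (hd₁.trans hd))
    have hSw : S.WF := hc.2.1.2.2 0
    have hl := hN₁.add (Ctx.single_lists c S)
    -- The channel of the send is already in scope, so the entry of its continuation adds nothing to
    -- the domain.
    have hdom : (Γ.add (.single c S)).dom ⊆ Δ.dom := by
      rw [Ctx.dom_add, Ctx.dom_single, Set.union_subset_iff, Set.singleton_subset_iff]
      exact ⟨hd₂.trans (hd₁.trans hd), hc.1⟩
    have := ih ((Ctx.wf_iff hl).2 ⟨hw.1.subset hdom, (hw₂.lctx hN₁).add (LCtx.wf_ent hSw c)⟩) hl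
    refine ⟨Nat.one_pos, fun _ => ⟨N₁, L₁, N₂, a, pay, S, by rw [add_zero, add_right_comm], hcs, hW,
      ?_, hc, this.mono ?_ hdom⟩⟩
    · rw [← hr, ← hs₁.2.1]; exact hρ
    · simp [Ctx.add, Ctx.single, Ctx.entry, hs₂.1, hs₁.1, hr]
  | @rcv Θ Δ Δ' Γ Γs Γr c ρ n m nx k P pay S hs₁ hs₂ hc hρ _ ih =>
    obtain ⟨hw₁, -, hd₁, -, hl₁⟩ := hs₁.exists_lists hw
    obtain ⟨M₁, M₂, hM₁, hM₂, rfl⟩ := hl₁ L hL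
    obtain ⟨-, hρ, hρ₀⟩ := hρ.role_inv
    obtain rfl := hM₂.unique hρ₀
    obtain ⟨hw₂, hw₃, hd₂, hd₃, hl₂⟩ := hs₂.exists_lists hw₁
    obtain ⟨N₁, N₂, hN₁, hN₂, rfl⟩ := hl₂ M₁ hM₁
    obtain ⟨_, e, hc⟩ := hc.chan_inv
    cases e
    have hc := (hc N₂ hN₂).mono (hd₃.trans hd₁)
    have hBw := hc.2.1
    refine ⟨N₁, N₂, pay, S, by rw [add_zero], hc, ?_, fun i => ?_⟩
    · rw [← hs₁.2.1]; exact hρ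
    have hl := hN₁.branch c (S i) (pay i) (k i)
    have hdom : (Γ.branch c (S i) (pay i) (k i)).dom ⊆ upDom (nx i) Δ.dom := by
      rw [Ctx.dom_branch, Set.union_subset_iff, Set.singleton_subset_iff]
      exact ⟨upDom_mono (hd₂.trans hd₁), shift_mem_upDom.2 hc.1⟩
    have := ih i ((Ctx.wf_iff hl).2 ⟨(upDom_finite hw.1 _).subset hdom,
      (((hw₂.lctx hN₁).up _ _).add (LCtx.wf_ent (hBw.2.2.2 i) _)).add
        (LCtx.wf_entFn (hBw.2.2.1 i))⟩) hl
    refine this.mono ?_ hdom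
    rw [← Ctx.branch, Ctx.ro_branch, hs₂.1, hs₁.1]
  | @rep Θ Δ Γ Γs c r n m nx k P pay S hs hc hE _ ih =>
    obtain ⟨hw₂, hw₃, hd₂, hd₃, hl₂⟩ := hs.exists_lists hw
    obtain ⟨N₁, N₂, hN₁, hN₂, rfl⟩ := hl₂ L hL
    -- A replicated receive owns only its own channel: the rest of the context is end-typed and has
    -- no components.
    obtain rfl := hN₁.unique ((Ctx.end_iff_lists _).1 hE)
    obtain ⟨_, e, hc⟩ := hc.chan_inv
    cases e
    have hc := (hc N₂ hN₂).mono hd₃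
    have hBw := hc.2.1
    rw [zero_add]
    refine ⟨pay, S, hc, fun i => ?_⟩
    have hl := hN₁.branch c (S i) (pay i) (repDepth r (k i))
    rw [LCtx.up_zero_left, zero_add] at hl
    have hdom : (Γ.branch c (S i) (pay i) (repDepth r (k i))).dom ⊆ upDom (nx i) Δ.dom := by
      rw [Ctx.dom_branch, Set.union_subset_iff, Set.singleton_subset_iff]
      exact ⟨upDom_mono hd₂, shift_mem_upDom.2 hc.1⟩
    have := ih i ((Ctx.wf_iff hl).2 ⟨(upDom_finite hw.1 _).subset hdom,
      (LCtx.wf_ent (hBw.2.2.2 i) _).add (LCtx.wf_entFn (hBw.2.2.1 i))⟩) hl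
    refine this.mono ?_ hdom
    rw [← Ctx.branch, Ctx.ro_branch, hs.1]
  | @defn Θ Δ Γ Γ' k P Q S hS hs _ hE _ ih₁ ih₂ =>
    obtain ⟨hw₁, hw₂, hd₁, hd₂, hl⟩ := hs.exists_lists hw
    obtain ⟨N₁, N₂, hN₁, hN₂, rfl⟩ := hl L hL
    obtain rfl := hN₁.unique ((Ctx.end_iff_lists _).1 hE)
    rw [zero_add]
    have hl := (hN₁.lift k 0).add (Ctx.binders_lists S)
    rw [LCtx.up_zero_left, zero_add] at hl
    have k₁ := ih₁ ((Ctx.wf_iff hl).2 ⟨?_, LCtx.wf_entFn hS⟩) hl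
    · have k₂ := ih₂ hw₂ hN₂
      rw [hs.2.1] at k₂
      rw [Ctx.ro_lift_zero_add_binders, Ctx.dom_lift_add_binders, hs.1] at k₁
      exact ⟨S, hS, k₁.mono subset_rfl (upDom_mono hd₁), k₂.mono subset_rfl hd₂⟩
    · rw [Ctx.dom_lift_add_binders]
      exact upDom_finite hw₁.1 _
  | @call Θ Δ Γ₀ X c Ss hX hE hv =>
    have hv' : ValsTyped Δ Γ₀ (c.map .chan ++ ([] : List RoleE).map .role)
        (Ss.map .sess ++ ([] : List RoleE).map .role) := by simpa using hv
    obtain ⟨-, -, -, -, -, L₀, L₁, rfl, h₀, hcs⟩ := hv'.inv hw hL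
    obtain rfl := h₀.unique ((Ctx.end_iff_lists _).1 hE)
    rw [zero_add]
    exact ⟨Ss, hX, hcs⟩

/-! ### From linear typing to typing -/

theorem LCtx.over_zero (D : Set Chan) : LCtx.Over D 0 := fun x hx => by simp at hx

theorem ChanTyped.exists_ent {D : Set Chan} {L : LCtx} {c : Chan} {S : SType}
    (h : ChanTyped D L c S) : ∃ S', S'.WF ∧ S'.Sub S ∧ L = LCtx.ent c S' := by
  obtain ⟨-, hw, ⟨S', hn, hs, e⟩ | ⟨hf, e⟩⟩ := h
  · exact ⟨S', hn.1, hs, by rw [e, LCtx.ent, hn.comp_eq]; rfl⟩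
  -- Without a component the channel is assumed at type `end`, which is below every well-formed type
  -- with head normal form `end`.
  · refine ⟨.fin, trivial, ?_, by rw [e, LCtx.ent, SType.comp_fin]; rfl⟩
    rw [← SType.sub_nf_right hw, hf]
    exact .refl _

/-- `Γ` is congruent to `c : S'` plus a context that gives all channels of `Γ` a type congruent to
`end`; value weakening absorbs the latter. -/
theorem ChanTyped.valTyped {Γ : Ctx} {L : LCtx} {c : Chan} {S : SType}
    (h : ChanTyped Γ.dom L c S) (hL : Γ.Lists L) : ValTyped Γ (.chan c) (.sess S) := by
  obtain ⟨Γ₂, hr, hd, hl⟩ := Ctx.exists_of_over Γ.ro (LCtx.over_zero Γ.dom)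
  obtain ⟨S', hw, hs, rfl⟩ := h.exists_ent
  refine .wkn (Γ₁ := .single c S') (Γ₂ := Γ₂) ?_ (.sub c hw h.2.1 hs)
    ((Ctx.end_iff_lists _).2 hl)
  refine hL.cong (by simpa using (Ctx.single_lists c S').add hl) ?_ ?_
  · simp [Ctx.add, Ctx.single, Ctx.entry, hr]
  · rw [Ctx.dom_add, hd, Ctx.dom_single, Set.singleton_union, Set.insert_eq_of_mem h.1]

theorem RoleE.In.valTyped {Γ : Ctx} {ρ : RoleE} (h : ρ.In ↑Γ.ro) (hL : Γ.Lists 0) :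
    ValTyped Γ (.role ρ) (.role ρ) := by
  have hE := (Ctx.end_iff_lists _).2 hL
  cases ρ with
  | name q =>
    refine .wkn (Γ₁ := .empty) (Γ₂ := Γ) ?_ (.roleName q) hE
    refine hL.cong (by simpa using (Ctx.lists_of_none (Γ := .empty) fun _ => rfl).add hL) ?_ ?_
    · simp [Ctx.add, Ctx.empty]
    · rw [Ctx.dom_add]
      have : Ctx.empty.dom = ∅ := by ext c; simp [Ctx.mem_dom, Ctx.empty]
      rw [this, Set.empty_union]
  | var a =>
    refine .wkn (Γ₁ := .role a) (Γ₂ := Γ) ?_ (.roleVar a) hE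
    refine hL.cong (by simpa using (Ctx.lists_of_none (Γ := .role a) fun _ => rfl).add hL) ?_ ?_
    · have := h a rfl
      simp only [Ctx.add, Ctx.role]
      rw [Finset.singleton_union, Finset.insert_eq_of_mem this]
    · rw [Ctx.dom_add]
      have : (Ctx.role a).dom = ∅ := by ext c; simp [Ctx.mem_dom, Ctx.role]
      rw [this, Set.empty_union]

theorem valsTyped_roles {Γ : Ctx} {W : List RoleE} {L : LCtx} (hL : Γ.Lists L)
    (h : ∀ ρ ∈ W, ρ.In ↑Γ.ro) :
    ∃ Γ₀ : Ctx, ValsTyped Γ Γ₀ (W.map .role) (W.map .role) ∧ Γ₀.Lists L ∧ Γ₀.dom = Γ.dom ∧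
      Γ₀.ro = Γ.ro := by
  induction W generalizing Γ with
  | nil => exact ⟨Γ, .nil Γ, hL, rfl, rfl⟩
  | cons ρ W ih =>
    obtain ⟨Γ₁, Γ₂, hs, h₁, h₂, hd₁, hd₂⟩ := Ctx.Lists.exists_split (L₁ := L) (L₂ := 0)
      (by rwa [add_zero])
    obtain ⟨Γ₀, hv, hl, hd, hr⟩ := ih h₁ fun ρ' hρ' => by
      rw [hs.1]; exact h ρ' (List.mem_cons_of_mem _ hρ')
    refine ⟨Γ₀, .cons hs (RoleE.In.valTyped ?_ h₂) hv, hl, hd.trans hd₁, hr.trans hs.1⟩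
    rw [hs.2.1]
    exact h ρ List.mem_cons_self

/-- The tail is arbitrary so that the role payloads can be typed afterwards, in the context that the
channels leave over. -/
theorem ChansTyped.valsTyped_append {Γ : Ctx} {D : Set Chan} {L₀ L₁ : LCtx} {cs : List Chan}
    {Ss : List SType} (h : ChansTyped D L₁ cs Ss) (hD : D = Γ.dom) (hL : Γ.Lists (L₀ + L₁)) :
    ∃ Γ' : Ctx, Γ'.Lists L₀ ∧ Γ'.dom = Γ.dom ∧ Γ'.ro = Γ.ro ∧ ∀ Γ₀ Vs Ts,
      ValsTyped Γ' Γ₀ Vs Ts → ValsTyped Γ Γ₀ (cs.map .chan ++ Vs) (Ss.map .sess ++ Ts) := by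
  induction h generalizing Γ with
  | nil => exact ⟨Γ, by rwa [add_zero] at hL, rfl, rfl, fun _ _ _ h => h⟩
  | @cons L₁ L₂ c S cs Ss hc _ ih =>
    subst hD
    obtain ⟨Γ₁, Γ₂, hs, h₁, h₂, hd₁, hd₂⟩ := Ctx.Lists.exists_split (L₁ := L₀ + L₂) (L₂ := L₁)
      (by rwa [add_assoc, add_comm L₂])
    obtain ⟨Γ', hl, hd, hr, hv⟩ := ih hd₁.symm h₁
    refine ⟨Γ', hl, hd.trans hd₁, hr.trans hs.1, fun Γ₀ Vs Ts h => ?_⟩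
    exact .cons hs ((hd₂ ▸ hc).valTyped h₂) (hv Γ₀ Vs Ts h)

/-- Linear typing implies typing. -/
theorem LTyped.typed {P : Proc} {Θ : PCtx} {Γ : Ctx} {L : LCtx}
    (h : LTyped P Θ ↑Γ.ro Γ.dom L) (hL : Γ.Lists L) : Typed Θ Γ P := by
  induction P generalizing Θ Γ L with
  | nil =>
    have h : L = 0 := h
    subst h
    exact .nil ((Ctx.end_iff_lists _).2 hL)
  | par P Q ihP ihQ =>
    obtain ⟨L₁, L₂, rfl, h₁, h₂⟩ := h
    obtain ⟨Γ₁, Γ₂, hs, hl₁, hl₂, hd₁, hd₂⟩ := hL.exists_split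
    rw [← hs.1, ← hd₁] at h₁
    rw [← hs.2.1, ← hd₂] at h₂
    exact .par hs (ihP h₁ hl₁) (ihQ h₂ hl₂)
  | nu P ih =>
    obtain ⟨Ψ, φ, K, hw, hφ, hs, hK, h⟩ := h
    refine .nu Ψ φ hw hφ hs (ih ?_ (hL.liftSess.add hK))
    rw [Ctx.dom_liftSess_add]
    simpa [Ctx.add, Ctx.liftSess, Protocol.assoc] using h
  | sum n c ρ m V W P ih =>
    refine .sum h.1 fun i => ?_
    obtain ⟨L₀, L₁, L₂, a, pay, S, rfl, h₁, h₂, h₃, h₄, h₅⟩ := h.2 i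
    -- The typing rule for sends takes the payloads off first, so their share is moved to the end.
    rw [add_right_comm] at hL
    obtain ⟨Γ₁, hl₁, hd₁, hr₁, hv₁⟩ := h₁.valsTyped_append rfl hL
    obtain ⟨Γ₂, hv₂, hl₂, hd₂, hr₂⟩ := valsTyped_roles (W := W i) hl₁ fun ρ' hρ' => by
      rw [hr₁]; exact h₂ ρ' hρ'
    obtain ⟨Γ₃, Γr, hs₃, hl₃, hlr, hd₃, hdr⟩ := Ctx.Lists.exists_split (Γ := Γ₂)
      (L₁ := L₀ + L₂) (L₂ := 0) (by rwa [add_zero])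
    obtain ⟨Γ₄, Γs, hs₄, hl₄, hls, hd₄, hds⟩ := hl₃.exists_split
    have er₃ : Γ₃.ro = Γ.ro := hs₃.1.trans (hr₂.trans hr₁)
    have ed₃ : Γ₃.dom = Γ.dom := hd₃.trans (hd₂.trans hd₁)
    refine .snd (S := S) (hv₁ _ _ _ hv₂) hs₃ hs₄ (ChanTyped.valTyped ?_ hls)
      (RoleE.In.valTyped ?_ hlr)
      (ih i ?_ (hl₄.add (Ctx.single_lists _ _)))
    · rw [hds, ed₃]; exact h₄
    · rw [hs₃.2.1, hr₂, hr₁]; exact h₃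
    · have e₁ : (Γ₄.add (.single (c i) S)).ro = Γ.ro := by
        simp [Ctx.add, Ctx.single, Ctx.entry, hs₄.1, er₃]
      have e₂ : (Γ₄.add (.single (c i) S)).dom = Γ.dom := by
        rw [Ctx.dom_add, Ctx.dom_single, hd₄, ed₃, Set.union_singleton, Set.insert_eq_of_mem h₄.1]
      rw [e₁, e₂]
      exact h₅
  | rcv c ρ n m nx k P ih =>
    obtain ⟨L₀, L₁, pay, S, rfl, h₁, h₂, h₃⟩ := h
    obtain ⟨Γ₃, Γr, hs₃, hl₃, hlr, hd₃, hdr⟩ := Ctx.Lists.exists_split (Γ := Γ)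
      (L₁ := L₀ + L₁) (L₂ := 0) (by rwa [add_zero])
    obtain ⟨Γ₄, Γs, hs₄, hl₄, hls, hd₄, hds⟩ := hl₃.exists_split
    refine .rcv (S := S) (pay := pay) hs₃ hs₄ (ChanTyped.valTyped ?_ hls)
      (RoleE.In.valTyped ?_ hlr) fun i => ?_
    · rw [hds, hd₃]; exact h₁
    · rw [hs₃.2.1]; exact h₂
    · refine ih i (Γ := Γ₄.branch c (S i) (pay i) (k i)) ?_ (hl₄.branch _ _ _ _)
      rw [Ctx.ro_branch, Ctx.dom_branch, hs₄.1, hs₃.1, hd₄, hd₃, Set.union_singleton,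
        Set.insert_eq_of_mem (shift_mem_upDom.2 h₁.1)]
      exact h₃ i
  | rep c r n m nx k P ih =>
    obtain ⟨pay, S, h₁, h₂⟩ := h
    obtain ⟨Γ₄, Γs, hs₄, hl₄, hls, hd₄, hds⟩ := Ctx.Lists.exists_split (Γ := Γ)
      (L₁ := 0) (L₂ := L) (by rwa [zero_add])
    refine .rep (S := S) (pay := pay) hs₄ (ChanTyped.valTyped ?_ hls)
      ((Ctx.end_iff_lists _).2 hl₄) fun i => ?_
    · rw [hds]; exact h₁
    · have hl := hl₄.branch c (S i) (pay i) (repDepth r (k i))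
      rw [LCtx.up_zero_left, zero_add] at hl
      refine ih i (Γ := Γ₄.branch c (S i) (pay i) (repDepth r (k i))) ?_ hl
      rw [Ctx.ro_branch, Ctx.dom_branch, hs₄.1, hd₄, Set.union_singleton,
        Set.insert_eq_of_mem (shift_mem_upDom.2 h₁.1)]
      exact h₂ i
  | defn k P Q ihP ihQ =>
    obtain ⟨S, hS, h₁, h₂⟩ := h
    obtain ⟨Γ₁, Γ₂, hs, hl₁, hl₂, hd₁, hd₂⟩ := Ctx.Lists.exists_split (Γ := Γ)
      (L₁ := 0) (L₂ := L) (by rwa [zero_add])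
    have hl := (hl₁.lift k 0).add (Ctx.binders_lists S)
    rw [LCtx.up_zero_left, zero_add] at hl
    refine .defn S hS hs (ihP ?_ hl) ((Ctx.end_iff_lists _).2 hl₁) (ihQ ?_ hl₂)
    · rw [Ctx.ro_lift_zero_add_binders, Ctx.dom_lift_add_binders, hs.1, hd₁]; exact h₁
    · rw [hs.2.1, hd₂]; exact h₂
  | call X c =>
    obtain ⟨Ss, hX, h⟩ := h
    obtain ⟨Γ', hl, -, -, hv⟩ := h.valsTyped_append (L₀ := 0) rfl (by rwa [zero_add])
    have := hv Γ' [] [] (.nil Γ')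
    rw [List.append_nil, List.append_nil] at this
    exact .call hX ((Ctx.end_iff_lists _).2 hl) this

/-! ### Communication -/

theorem SType.forall₂_sub_trans {l₁ l₂ l₃ : List SType} (hw : ∀ A ∈ l₂, A.WF)
    (h : List.Forall₂ SType.Sub l₁ l₂) (h' : List.Forall₂ SType.Sub l₂ l₃) :
    List.Forall₂ SType.Sub l₁ l₃ := by
  induction h generalizing l₃ with
  | nil => exact h'
  | cons h _ ih =>
    cases h' with
    | cons h₁ h₂ =>
      exact .cons (h.trans (hw _ List.mem_cons_self) h₁)
        (ih (fun A hA => hw A (List.mem_cons_of_mem _ hA)) h₂)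

theorem SType.forall₂_sub_rsubst {l₁ l₂ : List SType} (h : List.Forall₂ SType.Sub l₁ l₂)
    (σ : ℕ → RoleE) :
    List.Forall₂ SType.Sub (l₁.map (SType.rsubst σ)) (l₂.map (SType.rsubst σ)) := by
  induction h with
  | nil => exact .nil
  | cons h _ ih => exact .cons (h.rsubst σ) ih

/-- An input of a subtype is matched by the supertype. -/
theorem Input.of_sub {A B S : SType} {r : Option Role} {m : Label} {Ss : List SType} {k : ℕ}
    {keep : Multiset SType} (h : Input A r m Ss k S keep) (hs : A.Sub B) (hB : B.muDepth = 0) :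
    ∃ Ss' S' keep', Input B r m Ss' k S' keep' ∧ List.Forall₂ SType.Sub Ss Ss' ∧ S.Sub S' ∧
      (keep = 0 ∧ keep' = 0 ∨ keep = {A} ∧ keep' = {B}) := by
  cases h with
  | bra q n lab ar pay k cont i =>
    cases hs.rule with
    | refl =>
      exact ⟨_, _, _, .bra q n lab ar pay k cont i,
        SType.forall₂_ofFn_iff.2 fun _ => .refl _, .refl _, .inl ⟨rfl, rfl⟩⟩
    | unfoldR => simp [SType.muDepth] at hB
    | bra hi =>
      obtain ⟨j, e₁, e₂, h₁, h₂⟩ := hi i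
      rw [e₁, e₂]
      exact ⟨_, _, _, .bra q _ _ _ _ _ _ j, h₁, h₂, .inl ⟨rfl, rfl⟩⟩
  | rep r n lab ar pay k cont i =>
    cases hs.rule with
    | refl =>
      exact ⟨_, _, _, .rep r n lab ar pay k cont i,
        SType.forall₂_ofFn_iff.2 fun _ => .refl _, .refl _, .inr ⟨rfl, rfl⟩⟩
    | unfoldR => simp [SType.muDepth] at hB
    | rep hi =>
      obtain ⟨j, e₁, e₂, h₁, h₂⟩ := hi i
      rw [e₁, e₂]
      exact ⟨_, _, _, .rep r _ _ _ _ _ _ j, h₁, h₂, .inr ⟨rfl, rfl⟩⟩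

/-- A subtype of a type that inputs has an input from the same origin. -/
theorem Input.exists_of_sub {A B S : SType} {r : Option Role} {m : Label} {Ss : List SType} {k : ℕ}
    {keep : Multiset SType} (h : Input B r m Ss k S keep) (hs : A.Sub B) (hA : A.Nrm) :
    ∃ m Ss k S keep, Input A r m Ss k S keep := by
  cases h with
  | bra q n lab ar pay k cont i =>
    obtain ⟨n', lab', ar', pay', k', cont', rfl, -⟩ := hs.bra_right hA.2.1
    exact ⟨_, _, _, _, _, .bra q n' lab' ar' pay' k' cont' ⟨0, hA.1.1⟩⟩
  | rep r n lab ar pay k cont i =>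
    obtain ⟨n', lab', ar', pay', k', cont', rfl, -⟩ := hs.rep_right hA.2.1
    exact ⟨_, _, _, _, _, .rep r n' lab' ar' pay' k' cont' ⟨0, hA.1.1⟩⟩

/-- The labels of a well-formed branching are distinct, so the label determines the branch. -/
theorem Input.unique {B S S' : SType} {r r' : Option Role} {m m' : Label} {Ss Ss' : List SType}
    {k k' : ℕ} {keep keep' : Multiset SType} (h : Input B r m Ss k S keep)
    (h' : Input B r' m' Ss' k' S' keep') (hm : m = m') (hB : B.WF) :
    Ss = Ss' ∧ k = k' ∧ S = S' ∧ keep = keep' := by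
  cases h with
  | bra q n lab ar pay k cont i =>
    cases h' with
    | bra _ _ _ _ _ _ _ j =>
      obtain rfl := hB.2.1 hm
      exact ⟨rfl, rfl, rfl, rfl⟩
  | rep r n lab ar pay k cont i =>
    cases h' with
    | rep _ _ _ _ _ _ _ j =>
      obtain rfl := hB.2.1 hm
      exact ⟨rfl, rfl, rfl, rfl⟩

theorem Input.muDepth {B S : SType} {r : Option Role} {m : Label} {Ss : List SType} {k : ℕ}
    {keep : Multiset SType} (h : Input B r m Ss k S keep) : B.muDepth = 0 := by
  cases h <;> rfl

/-- A compatible receiver reacts to the message sent by a process, and continues with a subtype of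
the continuation the receiving process expects. -/
theorem React.of_compat {p q : Role} {T₀ R₀ R S S' : SType} {m : Label} {a : ℕ}
    {pay : Fin a → SType} {rs : List Role} {r : Option Role} {Ss : List SType} {k : ℕ}
    {keep' : Multiset SType} (hT : T₀.Nrm)
    (hs : T₀.Sub (.sel 1 (fun _ => .name q) (fun _ => m) (fun _ => a) (fun _ => pay)
      (fun _ => rs.map .name) (fun _ => S)))
    (hR₀ : R₀.Nrm) (hR : R₀.Sub R) (hw : R.WF) (hc : Compat p q T₀ R₀) (hr : r = none ∨ r = some p)
    (hin : Input R r m Ss k S' keep') :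
    ∃ (C S₀ : SType) (keep : Multiset SType),
      React p q T₀ R₀ C.comp (keep + (S₀.rsubst (instRo (recvRoles r rs p))).comp) ∧
      C.WF ∧ C.Sub S ∧ S₀.WF ∧ S₀.Sub S' ∧
      List.Forall₂ SType.Sub (List.ofFn pay)
        (Ss.map (SType.rsubst (instRo (recvRoles r rs p)))) ∧
      (keep = 0 ∧ keep' = 0 ∨ keep = {R₀} ∧ keep' = {R}) := by
  obtain ⟨n, tgt, lab, ar, pay₀, rol, cont, rfl, hi⟩ := hs.sel_right hT.2.1
  obtain ⟨i, e₁, e₂, e₃, h₁, h₂⟩ := hi 0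
  -- A subtype has fewer branches, so `R₀` is only known to input something from `r`; it is
  -- compatibility that provides the branch for this label.
  obtain ⟨Ss₀, S₀, keep, hin₀, h₃⟩ := hc rfl r (hin.exists_of_sub hR hR₀) hr i e₁
  have hlen : (rol i).length = rs.length := by rw [e₃, List.length_map]
  rw [hlen] at hin₀ h₃
  obtain ⟨Ss₁, S₁, keep₁, hin₁, h₄, h₅, h₆⟩ := hin₀.of_sub hR hin.muDepth
  -- The branch of `R` matching that of `R₀` has the label of the message, hence is the one the
  -- receiving process takes.
  obtain ⟨rfl, -, rfl, rfl⟩ := hin₁.unique hin e₂ hw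
  refine ⟨cont i, S₀, keep, .mk i rs e₁ e₃ hin₀ hr h₃, hT.1.2.2 i, h₂, (hin₀.wf hR₀.1).1, h₅, ?_,
    h₆⟩
  have h₇ := SType.forall₂_sub_rsubst h₃ (instRo (recvRoles r rs p))
  rw [← length_recvRoles r rs p, List.map_map] at h₇
  have e : SType.rsubst (instRo (recvRoles r rs p)) ∘ SType.rshift (recvRoles r rs p).length = id :=
    funext fun S => S.rshift_rsubst_instRo _
  rw [e, List.map_id] at h₇
  -- The chain runs from the payload types of the sending process through those of `T₀` and of `R₀`
  -- to those of `R`, the last two instantiated with the received roles.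
  refine SType.forall₂_sub_trans ?_ (SType.forall₂_sub_trans ?_ h₁ h₇)
    (SType.forall₂_sub_rsubst h₄ _)
  · intro A hA
    obtain ⟨B, hB, rfl⟩ := List.mem_map.1 hA
    exact (SType.wf_rsubst _ _).2 ((hin₀.wf hR₀.1).2.1 B hB)
  · intro A hA
    obtain ⟨j, rfl⟩ := (List.mem_ofFn' _ _).1 hA
    exact hT.1.2.1 i j

/-! ### Instantiation of received values -/

/-- The substitution of received values. -/
def Subst.inst (ds : List (ℕ × Role)) (rs : List Role) : Subst :=
  { Subst.id with
    ch := fun x => match ds[x]? with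
      | some d => .ep d.1 d.2
      | none => .var (x - ds.length)
    ro := instRo rs }

theorem Subst.maps_inst {ds : List (ℕ × Role)} {D : Set Chan} (hD : ∀ d ∈ ds, mkEp d ∈ D)
    (rs : List Role) (Θ : PCtx) (A : Set ℕ) :
    (Subst.inst ds rs).Maps (Θ.rshift rs.length) Θ (upRoles rs.length A) A (upDom ds.length D) D where
  pv X Ss hX := by
    obtain ⟨Ts, h, rfl⟩ := Option.map_eq_some_iff.1 hX
    have e : SType.rsubst (Subst.inst ds rs).ro ∘ SType.rshift rs.length = _root_.id :=
      funext fun S => S.rshift_rsubst_instRo _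
    rw [List.map_map, e, List.map_id]
    exact h
  ro a ha := by
    intro b hb
    change instRo rs a = _ at hb
    unfold instRo at hb
    by_cases h : a < rs.length
    · simp [List.getElem?_eq_getElem h] at hb
    · rw [List.getElem?_eq_none (not_lt.1 h)] at hb
      cases hb
      exact ha.resolve_left h
  ch c hc := by
    cases c with
    | ep s q => exact hc
    | var x =>
      change (match ds[x]? with
        | some d => Chan.ep d.1 d.2
        | none => .var (x - ds.length)) ∈ D
      by_cases h : x < ds.length
      · rw [List.getElem?_eq_getElem h]
        exact hD _ (List.getElem_mem h)
      · rw [List.getElem?_eq_none (not_lt.1 h)]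
        exact hc.resolve_left h

theorem Chan.shift_subst_inst (c : Chan) (ds : List (ℕ × Role)) (rs : List Role) :
    (c.shift ds.length).subst (Subst.inst ds rs) = c := by
  cases c with
  | ep s q => rfl
  | var x => simp [Chan.shift, Chan.subst, Subst.inst]

theorem ChansTyped.mem_dom {D : Set Chan} {L : LCtx} {cs : List Chan} {Ss : List SType}
    (h : ChansTyped D L cs Ss) : ∀ c ∈ cs, c ∈ D := by
  induction h with
  | nil => simp
  | cons h _ ih => exact List.forall_mem_cons.2 ⟨h.1, ih⟩

theorem LCtx.inst_up (ds : List (ℕ × Role)) (rs : List Role) (L : LCtx) :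
    LCtx.Inst (Subst.inst ds rs) L (L.up ds.length rs.length) := by
  refine Multiset.rel_map_right.2 (Multiset.rel_refl_of_refl_on fun x _ => ?_)
  refine ⟨(x.1.shift_subst_inst ds rs).symm, (SType.nrm_rsubst _ _).1, ?_⟩
  have : (x.2.rshift rs.length).rsubst (Subst.inst ds rs).ro = x.2 := x.2.rshift_rsubst_instRo rs
  simp only [Prod.map_snd, this]
  exact .refl _

/-- Typed arguments instantiate the entries of the parameters. -/
theorem ChansTyped.inst {σ : Subst} {D : Set Chan} {L : LCtx} {cs : List Chan} {Ts : List SType}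
    (h : ChansTyped D L cs Ts) {n : ℕ} {f : Fin n → Chan} {S : Fin n → SType}
    (hS : ∀ j, (S j).WF) (hs : List.Forall₂ SType.Sub Ts ((List.ofFn S).map (SType.rsubst σ.ro)))
    (hf : cs = List.ofFn fun j => (f j).subst σ) :
    LCtx.Inst σ L (∑ j, LCtx.ent (f j) (S j)) := by
  induction n generalizing L cs Ts with
  | zero =>
    rw [List.ofFn_zero] at hf
    subst hf
    cases h
    exact .zero σ
  | succ n ih =>
    rw [List.ofFn_succ] at hf hs
    subst hf
    cases h with
    | cons hc h =>
      cases hs with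
      | cons h₁ h₂ =>
        rw [Fin.sum_univ_succ]
        refine LCtx.Inst.add ?_ (ih h (fun j => hS j.succ) h₂ rfl)
        obtain ⟨S', hw, hs', rfl⟩ := hc.exists_ent
        exact LCtx.inst_ent_sub _ (hS 0) hw (hs'.trans hc.2.1 h₁)

theorem map_mkEp_eq_ofFn (ds : List (ℕ × Role)) (rs : List Role) :
    ds.map mkEp = List.ofFn fun j : Fin ds.length => (Chan.var j).subst (Subst.inst ds rs) := by
  refine List.ext_getElem (by simp) fun i h₁ h₂ => ?_
  simp [Chan.subst, Subst.inst, mkEp]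

/-- Instantiation of a typed process. -/
theorem LTyped.inst {P : Proc} {Θ : PCtx} {A : Set ℕ} {D : Set Chan} {L L' L₁ : LCtx}
    {ds : List (ℕ × Role)} {rs : List Role} {S : Fin ds.length → SType} {Ts : List SType}
    (h : LTyped P (Θ.rshift rs.length) (upRoles rs.length A) (upDom ds.length D)
      (L + LCtx.entFn S))
    (hL : LCtx.Inst (Subst.inst ds rs) L' L) (hc : ChansTyped D L₁ (ds.map mkEp) Ts)
    (hS : ∀ j, (S j).WF)
    (hs : List.Forall₂ SType.Sub Ts ((List.ofFn S).map (SType.rsubst (instRo rs)))) :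
    LTyped (P.inst ds rs) Θ A D (L' + L₁) :=
  h.subst (Subst.maps_inst (fun _ hd => hc.mem_dom _ (List.mem_map_of_mem hd)) rs Θ A)
    (hL.add (hc.inst hS hs (map_mkEp_eq_ofFn ds rs)))

/-- This is the substitution lemma for the identity, since instances of linear contexts are taken up
to subtyping. -/
theorem LTyped.narrow {P : Proc} {Θ : PCtx} {A : Set ℕ} {D : Set Chan} {L : LCtx} {c : Chan}
    {S S' : SType} (h : LTyped P Θ A D (L + LCtx.ent c S)) (hS : S.WF) (hS' : S'.WF)
    (hs : S'.Sub S) : LTyped P Θ A D (L + LCtx.ent c S') := by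
  have e : ∀ c : Chan, c.subst .id = c := by intro c; cases c <;> rfl
  have hi : LCtx.Inst .id (L + LCtx.ent c S') (L + LCtx.ent c S) := by
    refine .add ?_ ?_
    · refine Multiset.rel_refl_of_refl_on fun x _ => ⟨(e _).symm, _root_.id, ?_⟩
      rw [show Subst.id.ro = RoleE.var from rfl, SType.rsubst_var]
      exact .refl _
    · have := LCtx.inst_ent_sub (σ := .id) c hS hS'
        (by rwa [show Subst.id.ro = RoleE.var from rfl, SType.rsubst_var])
      rwa [e] at this
  have := h.subst (Θ' := Θ) (A' := A) (D' := D)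
    ⟨fun X Ss hX => by simp [Subst.id, SType.rsubst_var_eq, hX],
      fun a ha b hb => by cases hb; exact ha, fun c hc => by rwa [e]⟩ hi
  rwa [Proc.subst_id] at this

/-! ### Preservation of linear typing -/

theorem ChanTyped.exists_nrm {D : Set Chan} {L : LCtx} {c : Chan} {S : SType}
    (h : ChanTyped D L c S) (hS : S.muDepth = 0) (hS' : S ≠ .fin) :
    ∃ S', S'.Nrm ∧ S'.Sub S ∧ L = {(c, S')} := by
  obtain ⟨-, -, h | ⟨h, -⟩⟩ := h
  · exact h
  · rw [SType.nf_of_muDepth hS] at h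
    exact absurd h hS'

/-- A send reacts with a receiver of the same session. -/
theorem LTyped.communicate {s : ℕ} {p q : Role} {m : Label} {ds : List (ℕ × Role)}
    {rs : List Role} {Q P : Proc} {Θ : PCtx} {A : Set ℕ} {D : Set Chan} {L L₀ : LCtx}
    {R₀ R S : SType} {r : Option Role} {nx k : ℕ} {pay : Fin nx → SType} {keep' : Multiset SType}
    (hQ : LTyped (.snd (.ep s p) (.name q) m (ds.map mkEp) (rs.map .name) Q) Θ A D L)
    (hR₀ : R₀.Nrm) (hR : R₀.Sub R) (hw : R.WF) (hr : r = none ∨ r = some p)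
    (hin : Input R r m (List.ofFn pay) k S keep') (hd : ds.length = nx) (hk : rs.length = k)
    (hP : LTyped P (Θ.rshift (repDepth r k)) (upRoles (repDepth r k) A) (upDom nx D)
      (L₀.up nx (repDepth r k) + LCtx.ent (.ep s q) S + LCtx.entFn pay))
    (hs : (L + (L₀ + {(.ep s q, R₀)})).Safe) :
    ∃ (L₁ L₂ : LCtx) (keep : Multiset SType),
      (L + (L₀ + {(.ep s q, R₀)})).Reds (L₁ + (L₂ + keep.map (Prod.mk (.ep s q)))) ∧
      LTyped Q Θ A D L₁ ∧ LTyped (P.inst ds (recvRoles r rs p)) Θ A D L₂ ∧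
      (keep = 0 ∧ keep' = 0 ∨ keep = {R₀} ∧ keep' = {R}) := by
  subst hd hk
  obtain ⟨M₀, M₁, M₂, a, payT, T, rfl, hcs, -, -, hc, hQ'⟩ := hQ.2 0
  obtain ⟨T₀, hT, hTs, rfl⟩ := hc.exists_nrm rfl (by simp)
  have hTw : T.WF := hc.2.1.2.2 0
  have e : M₀ + M₁ + {(Chan.ep s p, T₀)} + (L₀ + {(Chan.ep s q, R₀)}) =
      (.ep s p, T₀) ::ₘ (.ep s q, R₀) ::ₘ (M₀ + M₁ + L₀) := by
    simp only [← Multiset.singleton_add]; abel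
  obtain ⟨C, S₀, keep, hre, hC, hCs, hS₀, hSs, hpay, hkeep⟩ :=
    React.of_compat hT hTs hR₀ hR hw (hs _ .refl s p q T₀ R₀ _ e) hr hin
  -- The sender keeps its rest and its continuation; the share `M₁` of the payload channels moves to
  -- the receiver.
  refine ⟨M₀ + LCtx.ent (.ep s p) C,
    L₀ + LCtx.ent (.ep s q) (S₀.rsubst (instRo (recvRoles r rs p))) + M₁, keep,
    .single ⟨s, p, q, T₀, R₀, _, _, _, hre, e, ?_⟩, hQ'.narrow hTw hC hCs, ?_, hkeep⟩
  · simp only [LCtx.ent, Multiset.map_add]; abel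
  · rw [← length_recvRoles r rs p] at hP
    refine hP.inst (.add (LCtx.inst_up _ _ _) ?_) hcs ?_ hpay
    · exact LCtx.inst_ent_sub (σ := .inst ds (recvRoles r rs p)) (.ep s q) (hin.wf hw).1
        ((SType.wf_rsubst _ _).2 hS₀) (hSs.rsubst _)
    · exact fun j => (hin.wf hw).2.1 _ ((List.mem_ofFn' _ _).2 ⟨j, rfl⟩)

theorem upRoles_zero (A : Set ℕ) : upRoles 0 A = A := by
  ext a; simp [upRoles]

theorem PCtx.rshift_zero (Θ : PCtx) : Θ.rshift 0 = Θ := by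
  funext X
  have : SType.rshift 0 = id := funext fun S => S.rsubst_var
  simp [PCtx.rshift, this]

/-- Simulated reduction preserves domain and role variables, so the reduct of a protocol's context
is again the context of a protocol. -/
theorem Protocol.eq_assoc {Γ : Ctx} {Ψ : Protocol} (hr : Γ.ro = ∅) (hd : Γ.dom = Ψ.assoc.dom) :
    Γ = Protocol.assoc (fun q => Γ.ch (.ep 0 q)) := by
  have h : ∀ c, Ψ.assoc.ch c = none → Γ.ch c = none := fun c hc => by
    by_contra h
    have : c ∈ Γ.dom := h
    rw [hd] at this
    exact this hc
  ext c
  · rcases c with ⟨_ | s, q⟩ | x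
    · rfl
    · rw [h _ rfl]; rfl
    · rw [h _ rfl]; rfl
  · rw [hr]; rfl

/-- Reduction preserves linear typing. -/
theorem Step.ltyped {P P' : Proc} (h : Step P P') {Θ : PCtx} {A : Set ℕ} {D : Set Chan} {L : LCtx}
    (hP : LTyped P Θ A D L) (hL : L.Safe) : ∃ L', L.Reds L' ∧ LTyped P' Θ A D L' := by
  induction h generalizing Θ A D L with
  | com s p q n m nx k P i ds rs Q hd hr =>
    obtain ⟨L₁, L₂, rfl, ⟨M₀, M₁, pay, S, rfl, hc, -, hb⟩, hQ⟩ := hP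
    obtain ⟨R₀, hR₀, hR, rfl⟩ := hc.exists_nrm rfl (by simp)
    rw [add_comm] at hL
    obtain ⟨N₁, N₂, keep, hre, h₁, h₂, ⟨rfl, -⟩ | ⟨-, h⟩⟩ := hQ.communicate hR₀ hR hc.2.1 (.inr rfl)
      (.bra q n m nx pay k S i) hd hr (hb i) hL
    · rw [Multiset.map_zero, add_zero] at hre
      exact ⟨N₂ + N₁, by rwa [add_comm, add_comm N₂], _, _, rfl, h₂, h₁⟩
    · exact absurd h.symm (Multiset.singleton_ne_zero _)
  | bang₁ s p q n m nx k P i ds rs Q hd hr =>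
    obtain ⟨L₁, L₂, rfl, hQ, ⟨pay, S, hc, hb⟩⟩ := hP
    obtain ⟨R₀, hR₀, hR, rfl⟩ := hc.exists_nrm rfl (by simp)
    -- A replicated receiver has no components besides its own, so its rest is zero.
    rw [← zero_add {(Chan.ep s p, R₀)}] at hL ⊢
    obtain ⟨N₁, N₂, keep, hre, h₁, h₂, ⟨-, h⟩ | ⟨rfl, -⟩⟩ := hQ.communicate hR₀ hR hc.2.1 (.inr rfl)
      (.rep (some q) n m nx pay k S i) hd hr (by rw [LCtx.up_zero_left, zero_add]; exact hb i) hL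
    · exact absurd h (Multiset.singleton_ne_zero _)
    · exact ⟨_, hre, N₁ + {(.ep s p, R₀)}, N₂, by rw [add_comm N₂, add_assoc]; rfl,
        ⟨N₁, _, rfl, h₁, pay, S, hc, hb⟩, h₂⟩
  | bang₂ s p q n m nx k P i ds rs Q hd hr =>
    obtain ⟨L₁, L₂, rfl, hQ, ⟨pay, S, hc, hb⟩⟩ := hP
    obtain ⟨R₀, hR₀, hR, rfl⟩ := hc.exists_nrm rfl (by simp)
    rw [← zero_add {(Chan.ep s p, R₀)}] at hL ⊢
    obtain ⟨N₁, N₂, keep, hre, h₁, h₂, ⟨-, h⟩ | ⟨rfl, -⟩⟩ := hQ.communicate hR₀ hR hc.2.1 (.inl rfl)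
      (.rep none n m nx pay k S i) hd hr (by rw [LCtx.up_zero_left, zero_add]; exact hb i) hL
    · exact absurd h (Multiset.singleton_ne_zero _)
    · exact ⟨_, hre, N₁ + {(.ep s p, R₀)}, N₂, by rw [add_comm N₂, add_assoc]; rfl,
        ⟨N₁, _, rfl, h₁, pay, S, hc, hb⟩, h₂⟩
  | choice n s q p m ds rs P j => exact ⟨L, .refl, Nat.one_pos, fun _ => hP.2 j⟩
  | call P Q ds =>
    obtain ⟨S, hS, h₁, L₁, L₂, rfl, ⟨Ss, hX, hc⟩, h₂⟩ := hP
    cases hX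
    refine ⟨_, .refl, S, hS, h₁, L₁, L₂, rfl, ?_, h₂⟩
    -- The body of a definition consumes only its parameters, and a call passes no roles.
    have := LTyped.inst (rs := []) (L := 0) (L' := 0) (Θ := Θ.cons (List.ofFn S)) (A := A)
      (S := S) (by
        rw [zero_add, List.length_nil, PCtx.rshift_zero, upRoles_zero]
        exact h₁) (.zero _) hc hS (by
        have e : instRo [] = RoleE.var := by funext a; simp [instRo]
        rw [e, SType.rsubst_var_eq, List.map_id]
        exact SType.forall₂_ofFn_iff.2 fun _ => .refl _)
    rwa [zero_add] at this
  | cong h₁ _ h₂ ih =>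
    obtain ⟨L', hr, h⟩ := ih (h₁.ltyped hP) hL
    exact ⟨L', hr, h₂.ltyped h⟩
  | par Q _ ih =>
    obtain ⟨L₁, L₂, rfl, h₁, h₂⟩ := hP
    obtain ⟨L', hr, h⟩ := ih h₁ hL.left
    exact ⟨L' + L₂, hr.add_right L₂, L', L₂, rfl, h, h₂⟩
  | nu _ ih =>
    obtain ⟨Ψ, φ, K, hw, hφ, hs, hK, h⟩ := hP
    obtain ⟨X, hX, h'⟩ := ih h (LCtx.Safe.renSess_add (Protocol.innermost hK) hL (hφ.safe hs hK))
    obtain ⟨L', K', rfl, hLr, hKr, -⟩ := LCtx.Reds.of_renSess_add (Protocol.innermost hK) hX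
    -- The protocol's share of the reduction is performed by its context; the result is the protocol
    -- of the reduct, with the same safety property.
    obtain ⟨Γ, hΓ, hro, hd, hl⟩ := hKr.simulate hK
    have e := Protocol.eq_assoc hro hd
    have hΓw : Γ.WF := (Ctx.wf_iff hl).2 ⟨?_, hKr.wf (hw.lctx hK)⟩
    · refine ⟨L', hLr, fun q => Γ.ch (.ep 0 q), φ, K', ⟨?_, fun q U hU => hΓw.2 _ U hU⟩, hφ,
        e ▸ hφ.reds hs hΓ, e ▸ hl, ?_⟩
      · exact hΓw.1.preimage (f := Chan.ep 0) fun _ _ _ _ h => by cases h; rfl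
      · convert h' using 1
        ext c
        rcases c with ⟨_ | s, q⟩ | x
        · have := Set.ext_iff.1 hd (.ep 0 q)
          exact this
        · rfl
        · rfl
    · rw [hd]
      refine (hw.1.image (Chan.ep 0)).subset ?_
      rintro (⟨_ | s, q⟩ | x) hc
      · exact ⟨q, hc, rfl⟩
      · exact absurd rfl hc
      · exact absurd rfl hc
  | defn k D _ ih =>
    obtain ⟨S, hS, h₁, h₂⟩ := hP
    obtain ⟨L', hr, h⟩ := ih h₂ hL
    exact ⟨L', hr, S, hS, h₁, h⟩

end MPSTBang

/-! ### Subject reduction -/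

theorem theorem1 (φ : MPSTBang.Ctx → Prop) (hφ : MPSTBang.IsSafety φ)
    (Θ : MPSTBang.PCtx) (Γ : MPSTBang.Ctx) (P P' : MPSTBang.Proc)
    (hΘ : Θ.WF) (hΓ : Γ.WF) (hP : MPSTBang.Typed Θ Γ P) (hsafe : φ Γ)
    (hstep : MPSTBang.Step P P') :
    ∃ Γ' : MPSTBang.Ctx, Γ'.WF ∧ Γ.Reds Γ' ∧ φ Γ' ∧ MPSTBang.Typed Θ Γ' P' := by
  obtain ⟨L, hL⟩ := MPSTBang.Ctx.exists_lists hΓ.1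
  obtain ⟨L', hr, h⟩ := hstep.ltyped (hP.ltyped hΓ hL) (hφ.safe hsafe hL)
  obtain ⟨Γ', hΓ', hro, hd, hl⟩ := hr.simulate hL
  -- The simulating context has the same role variables and channels, so the linear typing of the
  -- reduct is in the right scope.
  rw [← hro, ← hd] at h
  refine ⟨Γ', (MPSTBang.Ctx.wf_iff hl).2 ⟨?_, hr.wf (hΓ.lctx hL)⟩, hΓ', hφ.reds hsafe hΓ',
    h.typed hl⟩
  rw [hd]
  exact hΓ.1
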